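/- **Conventions.** Let $(K,v_0)$ be a field with a Krull valuation $v_0:K\to\Gamma\cup\{\infty\}$ (additive, arbitrary ordered abelian group $\Gamma$), with value group $v_0K=v_0(K^\times)$ and residue field $Kv_0$. Write $v_0K\infty=v_0K\cup\{\infty\}$. For $c\in K$ let $B_\gamma(c,K)=\{a\in K\mid v_0(a-c)\ge\gamma\}$ ($\gamma\in v_0K\infty$) be the closed ball and $B^\circ_\gamma(c,K)=\{a\in K\mid v_0(a-c)>\gamma\}$ ($\gamma\in v_0K$) the open ball of radius $\gamma$ around $c$. A ball carries its kind (closed or open) and its radius as part of the data, even if a ball of another kind or radius has the same elements. A ball $B$ is *contained* in $B'$ if it is a subset of $B'$ and its kind and radius are at least as narrow, where for $\gamma<\delta$ "closed of radius $\gamma$", "open of radius $\gamma$", "closed of radius $\delta$" are ordered from wide to narrow. A *nest of balls* is a nonempty set of balls linearly ordered by containment; it is *full* if it contains every ball that contains one of its members. An *approximation type* $\mathbf A$ over $(K,v_0)$ is a full nest of balls or the empty set. $\mathbf A_\gamma$ (resp. $\mathbf A_\gamma^\circ$) is the closed (resp. open) ball of radius $\gamma$ in $\mathbf A$, or $\emptyset$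 if there is none; $\operatorname{supp}\mathbf A$ is the set of $\gamma\in v_0K\infty$ such that $\mathbf A$ contains a closed ball of radius $\gamma$; $\bigcap\mathbf A$ is the intersection of all balls in $\mathbf A$ (it is $K$ if $\mathbf A=\emptyset$). For an extension $v$ of $v_0$ to a field $L\supseteq K$ and $x\in L$, $\operatorname{appr}_v(x,K)$ is the approximation type consisting of the nonempty sets among $\{c\in K\mid v(x-c)\ge\gamma\}$, $\gamma\in v_0K\infty$ (closed of radius $\gamma$), and $\{c\in K\mid v(x-c)>\gamma\}$, $\gamma\in v_0K$ (open of radius $\gamma$). $\mathbf A$ is *trivial* if $\mathbf A=\operatorname{appr}_{v_0}(c,K)$ for some $c\in K$. $\mathbf A$ is *immediate* if it is nonempty and $\bigcap\mathbf A=\emptyset$. It *fixes the value* of $f\in K[X]$ if for some $\delta\in\operatorname{supp}\mathbf A$ the value $v_0f(c)$ is constant for $c\in\mathbf A_\delta$. An immediate $\mathbf A$ is *transcendental* if it fixes the value of every $f\in K[X]$, and *algebraic* otherwise. A non-trivial $\mathbf A$ is *value-extending* if $\bigcap\mathbf A\neq\emptyset$ and $\mathbf A^\circ_\gamma\ne\emptyset$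 for every $\gamma\in\operatorname{supp}\mathbf A$; it is *residue-extending* if $\bigcap\mathbf A\ne\emptyset$ and for every $c\in K$ there is $\gamma\in\operatorname{supp}\mathbf A$ with $c\in\mathbf A_\gamma\setminus\mathbf A^\circ_\gamma$. An extension $v$ of $v_0$ to the rational function field $K(x)$ takes values in an ordered abelian group containing $v_0K$ (together with $\infty$). Two such extensions $v_1,v_2$ are identified (equivalent over $v_0$) if there is an order isomorphism $\rho:v_1K(x)\to v_2K(x)$ that is the identity on $v_0K$ with $v_2=\rho\circ v_1$. The extension is *immediate* if $vK(x)=v_0K$ and $K(x)v=Kv_0$; *value-transcendental* if $\dim_{\mathbb Q}\mathbb Q\otimes_{\mathbb Z}(vK(x)/v_0K)=1$ and $K(x)v|Kv_0$ is algebraic; *residue-transcendental* if $\operatorname{trdeg}(K(x)v|Kv_0)=1$ and $vK(x)/v_0K$ is a torsion group. For $b\in K$ and $\alpha$ in an ordered abelian group containing $v_0K$, the extension *obtained by assigning the value $\alpha$ to $z=x-b$* is the valuation $v$ on $K(x)=K(z)$ with $v\big(\sum_i c_iz^i\big)=\min_i(v_0c_i+i\alpha)$ for $c_i\in K$. **Theorem.**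 Let $(K,v_0)$ be a valued field and $K(x)$ the rational function field in one variable over $K$. For every extension $v$ of $v_0$ to $K(x)$, $\operatorname{appr}_v(x,K)$ is non-trivial and depends only on the equivalence class of $v$ over $v_0$. For every non-trivial approximation type $\mathbf A$ over $(K,v_0)$ there is an extension $v$ of $v_0$ to $K(x)$ with $\operatorname{appr}_v(x,K)=\mathbf A$. That is, the function $v\mapsto\operatorname{appr}_v(x,K)$ from the set of extensions of $v_0$ to $K(x)$ to the set of non-trivial approximation types over $(K,v_0)$ is surjective. Moreover: 1. If $\mathbf A$ is transcendental immediate, then the extension $v$ with $\operatorname{appr}_v(x,K)=\mathbf A$ is uniquely determined (up to equivalence over $v_0$) and immediate. 2. If $\mathbf A$ is algebraic immediate with $\operatorname{supp}\mathbf A\ne v_0K$, then there is a value-transcendental extension $v$ with $\operatorname{appr}_v(x,K)=\mathbf A$, and there is also a residue-transcendental one. If $\mathbf A$ is algebraic immediate with $\operatorname{supp}\mathbf A=v_0K$, then the extension $v$ with $\operatorname{appr}_v(x,K)=\mathbf A$ is uniquely determined (up to equivalence over $v_0$) and value-transcendental. 3. Let $\mathbf A$ be value-extending. Then in some ordered abelian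 group containing $v_0K$ there is an element $\alpha$ that is not a torsion element modulo $v_0K$ and satisfies $\gamma<\alpha$ for all $\gamma\in\operatorname{supp}\mathbf A$ and $\alpha<\varepsilon$ for all $\varepsilon\in v_0K\setminus\operatorname{supp}\mathbf A$. For every $b\in\bigcap\mathbf A$ and every such $\alpha$ (in any ordered abelian group containing $v_0K$), the extension $v$ of $v_0$ to $K(x)$ obtained by assigning the value $\alpha$ to $x-b$ exists, is unique, is value-transcendental, and satisfies $\operatorname{appr}_v(x,K)=\mathbf A$. 4. Let $\mathbf A$ be residue-extending. Then $\operatorname{supp}\mathbf A$ has a maximal element $\delta\in v_0K$, and $\bigcap\mathbf A=\mathbf A_\delta$. For every $b\in\bigcap\mathbf A$, the extension $v$ of $v_0$ to $K(x)$ obtained by assigning the value $\delta$ to $x-b$ exists, is unique, is residue-transcendental, and satisfies $\operatorname{appr}_v(x,K)=\mathbf A$. -/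

import Mathlib

universe u v w w' u₁

namespace ApproxTypes

/-! ## Valued fields

A valued field is a field `K` with a Krull valuation `v : K → Γ ∪ {∞}`, written additively, where
`Γ` is any ordered abelian group; `v` is not assumed to be onto. -/

section ValuedField

variable {K : Type*} [Field K] {Γ : Type*} [AddCommGroup Γ] [LinearOrder Γ] [IsOrderedAddMonoid Γ]

/-- The value group `vK = v(Kˣ) ⊆ Γ`. -/
def valueGroup (v : AddValuation K (WithTop Γ)) : AddSubgroup Γ where
  carrier := {γ | ∃ a : K, v a = (γ : WithTop Γ)}
  zero_mem' := ⟨1, by simp⟩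
  add_mem' := by
    rintro γ δ ⟨a, ha⟩ ⟨b, hb⟩
    exact ⟨a * b, by rw [AddValuation.map_mul, ha, hb, WithTop.coe_add]⟩
  neg_mem' := by
    rintro γ ⟨a, ha⟩
    have ha0 : a ≠ 0 := by
      rintro rfl
      rw [AddValuation.map_zero] at ha
      exact WithTop.coe_ne_top ha.symm
    refine ⟨a⁻¹, ?_⟩
    have h : v a + v a⁻¹ = 0 := by
      rw [← AddValuation.map_mul, mul_inv_cancel₀ ha0, AddValuation.map_one]
    rw [ha] at h
    cases hx : v a⁻¹ with
    | top => rw [hx] at h; simp at h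
    | coe x =>
      rw [hx] at h
      have h2 : γ + x = 0 := by exact_mod_cast h
      exact congrArg _ (eq_neg_of_add_eq_zero_right h2)

/-- The valuation ring `{a | v a ≥ 0}`. -/
def valuationRing (v : AddValuation K (WithTop Γ)) : ValuationSubring K where
  carrier := {a | 0 ≤ v a}
  mul_mem' := by
    intro a b ha hb
    simp only [Set.mem_ofPred_eq, AddValuation.map_mul] at *
    exact add_nonneg ha hb
  one_mem' := by simp
  add_mem' := fun ha hb => v.map_le_add ha hb
  zero_mem' := by simp
  neg_mem' := by
    intro a ha
    simpa only [Set.mem_ofPred_eq, AddValuation.map_neg] using ha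
  mem_or_inv_mem' := by
    intro a
    simp only [Set.mem_ofPred_eq]
    by_cases ha0 : a = 0
    · left; simp [ha0]
    by_contra! hcon
    have h : v a + v a⁻¹ = 0 := by
      rw [← AddValuation.map_mul, mul_inv_cancel₀ ha0, AddValuation.map_one]
    obtain ⟨h1, h2⟩ := hcon
    have h3 : v a + v a⁻¹ < 0 := by
      cases hx : v a with
      | top => rw [hx] at h1; simp at h1
      | coe x =>
        cases hy : v a⁻¹ with
        | top => rw [hy] at h2; simp at h2
        | coe y =>
          rw [hx] at h1
          rw [hy] at h2
          have h1' : x < 0 := by exact_mod_cast h1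
          have h2' : y < 0 := by exact_mod_cast h2
          exact_mod_cast add_neg h1' h2'
    exact absurd h h3.ne

/-- The residue field `Kv`. -/
abbrev resField (v : AddValuation K (WithTop Γ)) : Type _ :=
  IsLocalRing.ResidueField (valuationRing v)

end ValuedField

/-! ## Balls and approximation types -/

section Balls

variable {K : Type u} [Field K] {Γ : Type v} [AddCommGroup Γ] [LinearOrder Γ]
  [IsOrderedAddMonoid Γ]

/-- The kind and the radius of an ultrametric ball in a field with value group `V`: closed balls
have a radius in `V ∪ {∞}`, open balls have a radius in `V`. -/
inductive BallLabel (V : Type v) : Type v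
  | closed (γ : WithTop V) : BallLabel V
  | op (γ : V) : BallLabel V

/-- `ℓ.Wider ℓ'`: a ball with label `ℓ` is at least as wide as a concentric ball with label `ℓ'`.
So `closed γ`, `op γ`, `closed δ` get narrower in this order whenever `γ < δ`. -/
def BallLabel.Wider {V : Type v} [LinearOrder V] : BallLabel V → BallLabel V → Prop
  | .closed γ, .closed δ => γ ≤ δ
  | .closed γ, .op δ => γ ≤ (δ : WithTop V)
  | .op γ, .closed δ => (γ : WithTop V) < δ
  | .op γ, .op δ => γ ≤ δ

/-- For an embedding `ι` of `V` in an ordered group `G` and an element `g` of `G ∪ {∞}`, this says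
`g ≥ γ` for the label `closed γ` and `g > γ` for the label `op γ`. -/
def BallLabel.Holds {V : Type v} {G : Type*} [LinearOrder G] (ι : V → G) :
    BallLabel V → WithTop G → Prop
  | .closed γ, g => γ.map ι ≤ g
  | .op γ, g => ((ι γ : G) : WithTop G) < g

/-- The closed ball `B_γ(c,K) = {a | v(a-c) ≥ γ}` or open ball `B_γ°(c,K) = {a | v(a-c) > γ}`. -/
def ballSet (v₀ : AddValuation K (WithTop Γ)) (ℓ : BallLabel (valueGroup v₀)) (c : K) : Set K :=
  {a | ℓ.Holds (Subtype.val : valueGroup v₀ → Γ) (v₀ (a - c))}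

/-- An ultrametric ball of `(K,v₀)`. A ball comes with its kind (open or closed) and its radius:
these are part of the data, even if another kind or radius should define the same subset of `K`
(for instance, the open ball of radius `0` and the closed ball of radius `1` around the same
center, when the value group is `ℤ`). -/
@[ext]
structure Ball (v₀ : AddValuation K (WithTop Γ)) where
  label : BallLabel (valueGroup v₀)
  carrier : Set K
  exists_center : ∃ c : K, carrier = ballSet v₀ label c

/-- Containment of balls, for balls that carry a kind and a radius. -/
def Ball.ContainedIn {v₀ : AddValuation K (WithTop Γ)} (B B' : Ball v₀) : Prop :=
  B.carrier ⊆ B'.carrier ∧ B'.label.Wider B.label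

/-- A nest of balls: a nonempty collection of balls linearly ordered by inclusion. -/
def IsNest {v₀ : AddValuation K (WithTop Γ)} (N : Set (Ball v₀)) : Prop :=
  N.Nonempty ∧ ∀ B ∈ N, ∀ B' ∈ N, B.ContainedIn B' ∨ B'.ContainedIn B

/-- A full nest of balls: it contains every ball which contains some ball of the nest. -/
def IsFullNest {v₀ : AddValuation K (WithTop Γ)} (N : Set (Ball v₀)) : Prop :=
  IsNest N ∧ ∀ B ∈ N, ∀ B' : Ball v₀, B.ContainedIn B' → B' ∈ N

/-- An approximation type over `(K,v₀)`: a full nest of open and closed balls, or the empty set. -/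
@[ext]
structure ApproxType (v₀ : AddValuation K (WithTop Γ)) where
  balls : Set (Ball v₀)
  empty_or_full : balls = ∅ ∨ IsFullNest balls

namespace ApproxType

variable {v₀ : AddValuation K (WithTop Γ)} (A : ApproxType v₀)

/-- The ball of `A` with label `ℓ`; the empty set if `A` has no such ball. (There is at most one,
since the balls in a nest are comparable.) -/
def ballAt (ℓ : BallLabel (valueGroup v₀)) : Set K :=
  {a | ∃ B ∈ A.balls, B.label = ℓ ∧ a ∈ B.carrier}

/-- `A_γ`, the closed ball of radius `γ` in `A`, or `∅`. -/
def closedBall (γ : WithTop (valueGroup v₀)) : Set K := A.ballAt (.closed γ)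

/-- `A_γ°`, the open ball of radius `γ` in `A`, or `∅`. -/
def openBall (γ : valueGroup v₀) : Set K := A.ballAt (.op γ)

/-- The support of `A`: all `γ ∈ vK ∪ {∞}` such that `A` contains a closed ball of radius `γ`. -/
def supp : Set (WithTop (valueGroup v₀)) :=
  {γ | ∃ B ∈ A.balls, B.label = .closed γ}

/-- `⋂ A`, the intersection over all balls of `A`; this is `K` if `A` is empty. -/
def inter : Set K := {a | ∀ B ∈ A.balls, a ∈ B.carrier}

/-- `A` is immediate: nonempty with `⋂ A = ∅`. -/
def IsImmediate : Prop := A.balls.Nonempty ∧ A.inter = ∅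

/-- `A` fixes the value of `f`: for some `δ` in the support of `A`, the value `v₀(f(c))` is the same
for all `c ∈ A_δ`. -/
def FixesValue (f : Polynomial K) : Prop :=
  ∃ δ ∈ A.supp, ∀ c ∈ A.closedBall δ, ∀ c' ∈ A.closedBall δ, v₀ (f.eval c) = v₀ (f.eval c')

def IsTranscendentalImmediate : Prop := A.IsImmediate ∧ ∀ f : Polynomial K, A.FixesValue f

def IsAlgebraicImmediate : Prop := A.IsImmediate ∧ ∃ f : Polynomial K, ¬ A.FixesValue f

/-- `A_γ° ≠ ∅` for every `γ ∈ supp A` (meant for non-trivial `A`, where `supp A ⊆ vK`). -/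
def IsResidueImmediate : Prop := ∀ γ : valueGroup v₀, ↑γ ∈ A.supp → (A.openBall γ).Nonempty

def IsValueExtending : Prop := A.IsResidueImmediate ∧ A.inter.Nonempty

/-- For every `c ∈ K` there is `γ ∈ supp A` with `c ∈ A_γ ∖ A_γ°` (meant for non-trivial `A`). -/
def IsValueImmediate : Prop :=
  ∀ c : K, ∃ γ : valueGroup v₀, ↑γ ∈ A.supp ∧ c ∈ A.closedBall γ \ A.openBall γ

def IsResidueExtending : Prop := A.IsValueImmediate ∧ A.inter.Nonempty

end ApproxType

end Balls

/-! ## Extensions of valued fields -/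

section Extensions

variable {K : Type u} [Field K] {Γ : Type v} [AddCommGroup Γ] [LinearOrder Γ]
  [IsOrderedAddMonoid Γ]

/-- The valuation `v` on `L`, with values in the ordered abelian group `Γ'` in which the value group
of `v₀` is embedded by `ι`, extends `v₀`. (`v(0) = ∞` holds anyway.) -/
def Extends (v₀ : AddValuation K (WithTop Γ)) {L : Type*} [Field L] [Algebra K L] {Γ' : Type*}
    [AddCommGroup Γ'] [LinearOrder Γ'] [IsOrderedAddMonoid Γ'] (ι : valueGroup v₀ →+ Γ')
    (v : AddValuation L (WithTop Γ')) : Prop :=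
  ∀ (a : K) (γ : valueGroup v₀), v₀ a = ((γ : Γ) : WithTop Γ) →
    v (algebraMap K L a) = ((ι γ : Γ') : WithTop Γ')

/-- An extension `v` of the valuation `v₀` from `K` to `L`, with values in some ordered abelian
group containing the value group of `v₀`. -/
structure Extension (v₀ : AddValuation K (WithTop Γ)) (L : Type u₁) [Field L] [Algebra K L] where
  {Γ' : Type w}
  [instGroup : AddCommGroup Γ']
  [instOrder : LinearOrder Γ']
  [instOrdered : IsOrderedAddMonoid Γ']
  ι : valueGroup v₀ →+ Γ'
  strictMono : StrictMono ι
  v : AddValuation L (WithTop Γ')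
  isExt : Extends v₀ ι v

attribute [instance] Extension.instGroup Extension.instOrder Extension.instOrdered

namespace Extension

variable {v₀ : AddValuation K (WithTop Γ)}

/-- `(K,v₀)` as an extension of itself. -/
def self (v₀ : AddValuation K (WithTop Γ)) : Extension.{u, v, v, u} v₀ K where
  Γ' := Γ
  ι := (valueGroup v₀).subtype
  strictMono := fun _ _ h => h
  v := v₀
  isExt := fun _ _ h => h

variable {L : Type u₁} [Field L] [Algebra K L] (E : Extension.{u, v, w, u₁} v₀ L)

theorem v_algebraMap (a : K) :
    (∃ γ : valueGroup v₀, v₀ a = ((γ : Γ) : WithTop Γ) ∧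
      E.v (algebraMap K L a) = ((E.ι γ : E.Γ') : WithTop E.Γ')) ∨
    (v₀ a = ⊤ ∧ E.v (algebraMap K L a) = ⊤) := by
  cases h : v₀ a with
  | top =>
    right
    have h0 : a = 0 := (AddValuation.top_iff v₀).1 h
    simp [h0]
  | coe γ => exact Or.inl ⟨⟨γ, a, h⟩, rfl, E.isExt a ⟨γ, a, h⟩ h⟩

theorem holds_algebraMap (ℓ : BallLabel (valueGroup v₀)) (a : K) :
    ℓ.Holds E.ι (E.v (algebraMap K L a)) ↔
      ℓ.Holds (Subtype.val : valueGroup v₀ → Γ) (v₀ a) := by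
  rcases E.v_algebraMap a with ⟨γ, h1, h2⟩ | ⟨h1, h2⟩
  · rw [h1, h2]
    cases ℓ with
    | closed δ =>
      cases δ with
      | top => simp [BallLabel.Holds]
      | coe δ => simp [BallLabel.Holds, E.strictMono.le_iff_le]
    | op δ => simp [BallLabel.Holds, E.strictMono.lt_iff_lt]
  · rw [h1, h2]
    cases ℓ with
    | closed δ => simp [BallLabel.Holds]
    | op δ => simp [BallLabel.Holds]

/-- `appr_v(x,K)_γ = {c ∈ K | v(x-c) ≥ γ}` or `appr_v(x,K)_γ° = {c ∈ K | v(x-c) > γ}`. -/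
def trace (x : L) (ℓ : BallLabel (valueGroup v₀)) : Set K :=
  {c | ℓ.Holds E.ι (E.v (x - algebraMap K L c))}

theorem holds_add {ℓ : BallLabel (valueGroup v₀)} {y z : L} (hy : ℓ.Holds E.ι (E.v y))
    (hz : ℓ.Holds E.ι (E.v z)) : ℓ.Holds E.ι (E.v (y + z)) := by
  cases ℓ with
  | closed δ => exact E.v.map_le_add hy hz
  | op δ => exact E.v.map_lt_add hy hz

theorem holds_neg {ℓ : BallLabel (valueGroup v₀)} {y : L} (hy : ℓ.Holds E.ι (E.v y)) :
    ℓ.Holds E.ι (E.v (-y)) := by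
  rwa [AddValuation.map_neg]

theorem trace_eq_ballSet {x : L} {ℓ : BallLabel (valueGroup v₀)} {c : K} (hc : c ∈ E.trace x ℓ) :
    E.trace x ℓ = ballSet v₀ ℓ c := by
  ext a
  simp only [trace, ballSet, Set.mem_ofPred_eq] at *
  rw [← E.holds_algebraMap, RingHom.map_sub]
  constructor
  · intro ha
    have := E.holds_add hc (E.holds_neg ha)
    convert this using 2
    ring
  · intro ha
    have := E.holds_add hc (E.holds_neg ha)
    convert this using 2
    ring

theorem trace_mono {x : L} {ℓ ℓ' : BallLabel (valueGroup v₀)} (h : ℓ.Wider ℓ') :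
    E.trace x ℓ' ⊆ E.trace x ℓ := by
  intro c hc
  simp only [trace, Set.mem_ofPred_eq] at *
  have hm : Monotone (WithTop.map E.ι) := E.strictMono.monotone.withTop_map
  have hs : StrictMono (WithTop.map E.ι) := E.strictMono.withTop_map
  cases ℓ with
  | closed γ =>
    cases ℓ' with
    | closed δ => exact le_trans (hm h) hc
    | op δ => exact le_trans (hm h) (le_of_lt hc)
  | op γ =>
    cases ℓ' with
    | closed δ => exact lt_of_lt_of_le (hs h) hc
    | op δ => exact lt_of_le_of_lt (hm (WithTop.coe_le_coe.2 h)) hc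

theorem wider_total (ℓ ℓ' : BallLabel (valueGroup v₀)) : ℓ.Wider ℓ' ∨ ℓ'.Wider ℓ := by
  cases ℓ with
  | closed γ =>
    cases ℓ' with
    | closed δ => exact le_total γ δ
    | op δ => exact le_or_gt γ δ
  | op γ =>
    cases ℓ' with
    | closed δ => exact (le_or_gt δ γ).symm
    | op δ => exact le_total γ δ

theorem mem_trace_self {ℓ : BallLabel (valueGroup v₀)} (c : K) : c ∈ (self v₀).trace c ℓ := by
  have h : (self v₀).v (c - algebraMap K K c) = ⊤ := by simp
  simp only [trace, Set.mem_ofPred_eq, h]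
  cases ℓ with
  | closed γ => simp [BallLabel.Holds]
  | op γ => exact WithTop.coe_lt_top _

theorem ballSet_eq_trace_self (ℓ : BallLabel (valueGroup v₀)) (c : K) :
    (self v₀).trace c ℓ = ballSet v₀ ℓ c :=
  (self v₀).trace_eq_ballSet (mem_trace_self c)

/-- `appr_v(x,K)`, the approximation type of `x` over `K`: its balls are the nonempty sets among
the `appr_v(x,K)_γ` for `γ ∈ vK ∪ {∞}` (closed of radius `γ`) and the `appr_v(x,K)_γ°` for `γ ∈ vK`
(open of radius `γ`). -/
def appr (x : L) : ApproxType v₀ where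
  balls := {B | B.carrier = E.trace x B.label ∧ (E.trace x B.label).Nonempty}
  empty_or_full := by
    rcases Set.eq_empty_or_nonempty
      {B : Ball v₀ | B.carrier = E.trace x B.label ∧ (E.trace x B.label).Nonempty} with h | h
    · exact Or.inl h
    refine Or.inr ⟨⟨h, ?_⟩, ?_⟩
    · rintro B ⟨hB, -⟩ B' ⟨hB', -⟩
      rcases wider_total B.label B'.label with h | h
      · exact Or.inr ⟨by rw [hB, hB']; exact E.trace_mono h, h⟩
      · exact Or.inl ⟨by rw [hB, hB']; exact E.trace_mono h, h⟩
    · rintro B ⟨hB, c, hc⟩ B' ⟨hsub, hw⟩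
      have hc' : c ∈ E.trace x B'.label := E.trace_mono hw hc
      refine ⟨?_, c, hc'⟩
      obtain ⟨d, hd⟩ := B'.exists_center
      have hcB' : c ∈ B'.carrier := hsub (hB ▸ hc)
      rw [hd, ← ballSet_eq_trace_self] at hcB'
      rw [hd, E.trace_eq_ballSet hc', ← ballSet_eq_trace_self]
      exact (self v₀).trace_eq_ballSet hcB'

/-- The two extensions are equivalent over `v₀`: there is an order preserving isomorphism `ρ` of
their value groups which is the identity on the value group of `v₀` and carries the first valuation
to the second. -/
def EquivOver (E : Extension.{u, v, w, u₁} v₀ L) (E' : Extension.{u, v, w', u₁} v₀ L) : Prop :=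
  ∃ ρ : valueGroup E.v ≃+o valueGroup E'.v,
    (∀ (γ : valueGroup E.v) (g : valueGroup v₀), (γ : E.Γ') = E.ι g → (ρ γ : E'.Γ') = E'.ι g) ∧
    ∀ (y : L) (γ : valueGroup E.v), E.v y = ((γ : E.Γ') : WithTop E.Γ') →
      E'.v y = ((ρ γ : E'.Γ') : WithTop E'.Γ')

theorem nonneg_algebraMap_iff (a : K) : 0 ≤ E.v (algebraMap K L a) ↔ 0 ≤ v₀ a := by
  have h1 : WithTop.map E.ι (0 : WithTop (valueGroup v₀)) = 0 := by
    rw [← WithTop.coe_zero, WithTop.map_coe, map_zero, WithTop.coe_zero]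
  have h2 : WithTop.map (Subtype.val : valueGroup v₀ → Γ) (0 : WithTop (valueGroup v₀)) = 0 := by
    rw [← WithTop.coe_zero, WithTop.map_coe, ZeroMemClass.coe_zero, WithTop.coe_zero]
  have key := E.holds_algebraMap (.closed 0) a
  simp only [BallLabel.Holds] at key
  rwa [h1, h2] at key

/-- The inclusion of the valuation ring of `v₀` in that of the extension. -/
def ringMap : valuationRing v₀ →+* valuationRing E.v :=
  (algebraMap K L).restrict (valuationRing v₀) (valuationRing E.v)
    fun a ha => (E.nonneg_algebraMap_iff a).2 ha

instance isLocalHom_ringMap : IsLocalHom E.ringMap := by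
  refine ⟨fun a ha => ?_⟩
  obtain ⟨b, hb⟩ := ha.exists_right_inv
  have hb' : algebraMap K L a * (b : L) = 1 := congrArg Subtype.val hb
  have ha0 : (a : K) ≠ 0 := by
    intro h
    rw [h] at hb'
    simp at hb'
  have hinv : algebraMap K L ((a : K)⁻¹) = b := by
    rw [map_inv₀]
    exact inv_eq_of_mul_eq_one_right hb'
  have hmem : (a : K)⁻¹ ∈ valuationRing v₀ := by
    have h1 : (0 : WithTop E.Γ') ≤ E.v (algebraMap K L ((a : K)⁻¹)) := hinv ▸ b.2
    exact (E.nonneg_algebraMap_iff _).1 h1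
  exact IsUnit.of_mul_eq_one ⟨_, hmem⟩ (Subtype.ext (mul_inv_cancel₀ ha0))

/-- The canonical embedding of residue fields `Kv₀ → Lv`. -/
noncomputable def residueMap : resField v₀ →+* resField E.v :=
  IsLocalRing.ResidueField.map E.ringMap

/-- The extension is immediate: the canonical embeddings of value groups and of residue fields are
both onto. -/
def IsImmediate : Prop :=
  (∀ γ ∈ valueGroup E.v, ∃ g : valueGroup v₀, E.ι g = γ) ∧ Function.Surjective E.residueMap

/-- The quotient `vL/v₀K` of value groups. -/
abbrev ValueQuotient : Type w :=
  valueGroup E.v ⧸ (E.ι.range.addSubgroupOf (valueGroup E.v))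

/-- The extension is value-transcendental: `vL/v₀K` has rational rank `1`, and `Lv|Kv₀` is
algebraic. The rational rank is the `ℚ`-dimension after tensoring with `ℚ` over `ℤ`. -/
def IsValueTranscendental : Prop :=
  letI : Algebra (resField v₀) (resField E.v) := E.residueMap.toAlgebra
  Module.rank ℚ (TensorProduct ℤ ℚ E.ValueQuotient) = 1 ∧
    Algebra.IsAlgebraic (resField v₀) (resField E.v)

/-- The extension is residue-transcendental: `Lv|Kv₀` has transcendence degree `1`, and `vL/v₀K` is
a torsion group. -/
def IsResidueTranscendental : Prop :=
  letI : Algebra (resField v₀) (resField E.v) := E.residueMap.toAlgebra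
  Algebra.trdeg (resField v₀) (resField E.v) = 1 ∧ IsAddTorsion E.ValueQuotient

end Extension

/-- An approximation type over `(K,v₀)` is trivial if it is realized by some element of `K`. -/
def ApproxType.IsTrivial {v₀ : AddValuation K (WithTop Γ)} (A : ApproxType v₀) : Prop :=
  ∃ c : K, (Extension.self v₀).appr c = A

/-- The valuation `v` on `K(x)` extends `v₀` and satisfies, for `z = x - b`,
`v(c₀ + c₁ z + ⋯ + cₙ zⁿ) = min_i (v₀ cᵢ + i α)`. -/
def IsGaussExtension (v₀ : AddValuation K (WithTop Γ)) {Γ' : Type*}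
    [AddCommGroup Γ'] [LinearOrder Γ'] [IsOrderedAddMonoid Γ'] (ι : valueGroup v₀ →+ Γ')
    (b : K) (α : Γ') (v : AddValuation (RatFunc K) (WithTop Γ')) : Prop :=
  Extends v₀ ι v ∧ ∀ f : Polynomial K,
    v (Polynomial.aeval (RatFunc.X - RatFunc.C b) f) =
      (Finset.range (f.natDegree + 1)).inf fun i =>
        v (RatFunc.C (f.coeff i)) + ((i • α : Γ') : WithTop Γ')

end Extensions

end ApproxTypes

open ApproxTypes

/-! The balls of `appr` record how the values `v (x - c)`, for `c` in `K`, lie relative to the value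
group `v₀K`, and an extension is determined by its values on polynomials. So a valuation of `K[X]`
has to be built, or recovered, from `A`.

Outside the transcendental immediate case the construction is MacLane's augmentation. Let `f` be
monic, let `w` be defined on polynomials of degree `< deg f` and be multiplicative modulo `f`, and
suppose that the multiple of `f` discarded in reducing a product has larger value than the product
once `f` is given the value `α`. Then `∑ gᵢ fⁱ ↦ minᵢ (w gᵢ + i α)` is a valuation. Multiplicativity
is direct when no two terms of an expansion have equal value (`augment_map_mul`); in general `α` is
perturbed to `(α, 1)` in `H ×ₗ ℤ`, where ties disappear, and the result is projected back
(`augment_map_mul'`).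

Assume that polynomials of degree `< deg f` agree to leading order with constants. If `α` is
non-torsion modulo `v₀K`, each rational function agrees to leading order with some `c fⁿ`, and the
extension is value-transcendental (`isValueTranscendental_of_approx`). If the value is such a
minimum and `α` is the value of a constant `a`, the residue of `f / a` is transcendental and
generates the residue field, and the value group does not grow (`isResidueTranscendental_of_le`).

If some `b` lies in `⋂ A`, take `f = X - b`. Then `v (x - c)` is the minimum of `v (b - c)` and `α`,
so `A` is realized by an `α` filling the cut of `supp A`, or by `α = δ` if the open ball of radius
`δ` is missing.

If `⋂ A = ∅`, every `c` has a level, the value that `x - c` must have, and there is no largest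
level. By Kaplansky's argument one term of the Taylor expansion of `p` at `c` eventually dominates
(`exists_dominatesAt`). If `p` and its Hasse derivatives have eventual values, `v p` must be the
eventual value of `p`, and `p` agrees to leading order with a constant (`lt_val_aeval_sub`). When
all polynomials are fixed, this gives a unique, immediate extension. Otherwise let `f` have minimal
degree among the non-fixed polynomials; the value of `f c` is eventually `b + m • lev c`, and any
`α` above all of these gives an augmentation realizing `A`. Bounded levels leave room for `α` inside
`v₀K` as well as above it. Cofinal levels force `v f` above `v₀K`; values are then ordered
lexicographically, which gives uniqueness. -/

namespace ApproxTypes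

open Polynomial

/-! ### Expansions along a monic polynomial and the minimum function on them -/

section Augmentation

variable {K : Type*} [Field K] {H : Type*} [AddCommGroup H] [LinearOrder H] [IsOrderedAddMonoid H]

theorem natDegree_add_mul {f g q : K[X]} (hf : f.Monic) (hg : g.natDegree < f.natDegree)
    (hq : q ≠ 0) : (g + q * f).natDegree = q.natDegree + f.natDegree := by
  rw [natDegree_add_eq_right_of_natDegree_lt, natDegree_mul hq hf.ne_zero]
  rw [natDegree_mul hq hf.ne_zero]
  omega

theorem modByMonic_add_mul {f g q : K[X]} (hf : f.Monic) (hg : g.natDegree < f.natDegree) :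
    (g + q * f) %ₘ f = g ∧ (g + q * f) /ₘ f = q := by
  have := div_modByMonic_unique (f := g + q * f) q g hf
    ⟨by ring, degree_lt_degree hg⟩
  exact ⟨this.2, this.1⟩

theorem exists_eq_add_mul {f : K[X]} (hf : f.Monic) (hd : 0 < f.natDegree) (p : K[X]) :
    ∃ g q : K[X], g.natDegree < f.natDegree ∧ p = g + q * f :=
  ⟨p %ₘ f, p /ₘ f, natDegree_modByMonic_lt p hf (by rintro rfl; simp at hd), by
    rw [mul_comm]; exact (modByMonic_add_div p f).symm⟩

/-- Induction along `f`-adic expansions. -/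
theorem expansion_induction {f : K[X]} (hf : f.Monic) (hd : 0 < f.natDegree) {P : K[X] → Prop}
    (base : ∀ g : K[X], g.natDegree < f.natDegree → P g)
    (step : ∀ g q : K[X], g.natDegree < f.natDegree → q ≠ 0 → P q → P (g + q * f)) (p : K[X]) :
    P p := by
  induction hn : p.natDegree using Nat.strong_induction_on generalizing p with
  | _ n ih =>
    obtain ⟨g, q, hg, rfl⟩ := exists_eq_add_mul hf hd p
    by_cases hq : q = 0
    · simpa [hq] using base g hg
    · refine step g q hg hq (ih _ ?_ q rfl)
      rw [← hn, natDegree_add_mul hf hg hq]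
      omega

/-- The function `∑ gᵢ fⁱ ↦ minᵢ (w gᵢ + i α)` on `f`-adic expansions. -/
noncomputable def augment (f : K[X]) (w : K[X] → WithTop H) (α : H) (p : K[X]) : WithTop H :=
  if p.natDegree < f.natDegree ∨ f.natDegree = 0 then w p
  else min (w (p %ₘ f)) (augment f w α (p /ₘ f) + α)
termination_by p.natDegree
decreasing_by
  rename_i h
  push Not at h
  by_cases hf : f.Monic
  · rw [natDegree_divByMonic _ hf]; omega
  -- Division by a non-monic polynomial returns `0` by convention, so the degree drops in this case
  -- too.
  · rw [divByMonic_eq_of_not_monic _ hf]; simp; omega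

/-- The conditions on `w` under which `augment f w α` is a valuation. -/
structure IsAugmentable (f : K[X]) (w : K[X] → WithTop H) (α : H) : Prop where
  monic : f.Monic
  natDegree_pos : 0 < f.natDegree
  zero : w 0 = ⊤
  one : w 1 = 0
  ne_top : ∀ g : K[X], g.natDegree < f.natDegree → g ≠ 0 → w g ≠ ⊤
  neg : ∀ g : K[X], g.natDegree < f.natDegree → w (-g) = w g
  add : ∀ g h : K[X], g.natDegree < f.natDegree → h.natDegree < f.natDegree →
    min (w g) (w h) ≤ w (g + h)
  mul_mod : ∀ g h : K[X], g.natDegree < f.natDegree → h.natDegree < f.natDegree →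
    w (g * h %ₘ f) = w g + w h
  mul_div : ∀ g h : K[X], g.natDegree < f.natDegree → h.natDegree < f.natDegree → g ≠ 0 → h ≠ 0 →
    w g + w h < w (g * h /ₘ f) + α

namespace IsAugmentable

variable {f : K[X]} {w : K[X] → WithTop H} {α : H} (h : IsAugmentable f w α)
include h

theorem augment_of_lt {g : K[X]} (hg : g.natDegree < f.natDegree) : augment f w α g = w g := by
  rw [augment, if_pos (Or.inl hg)]

theorem augment_zero : augment f w α 0 = ⊤ := by
  rw [h.augment_of_lt (by simpa using h.natDegree_pos), h.zero]

theorem augment_add_mul {g : K[X]} (hg : g.natDegree < f.natDegree) (q : K[X]) :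
    augment f w α (g + q * f) = min (w g) (augment f w α q + α) := by
  by_cases hq : q = 0
  · simp [hq, h.augment_zero, h.augment_of_lt hg]
  · have hd := natDegree_add_mul h.monic hg hq
    have := h.natDegree_pos
    rw [augment, if_neg (by omega)]
    rw [(modByMonic_add_mul h.monic hg).1, (modByMonic_add_mul h.monic hg).2]

theorem augment_mul (q : K[X]) : augment f w α (q * f) = augment f w α q + α := by
  have := h.augment_add_mul (g := 0) (by simpa using h.natDegree_pos) q
  simpa [h.zero] using this

theorem augment_ne_top {p : K[X]} : p ≠ 0 → augment f w α p ≠ ⊤ := by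
  refine expansion_induction h.monic h.natDegree_pos (P := fun p => p ≠ 0 → augment f w α p ≠ ⊤)
    (fun g hg h0 => ?_) (fun g q hg h0 ih _ => ?_) p
  · rw [h.augment_of_lt hg]; exact h.ne_top g hg h0
  · rw [h.augment_add_mul hg]
    have h1 := ih h0
    intro h2
    rw [min_eq_top] at h2
    cases hA : augment f w α q with
    | top => exact h1 hA
    | coe a => rw [hA] at h2; exact WithTop.coe_ne_top h2.2

theorem augment_neg (p : K[X]) : augment f w α (-p) = augment f w α p := by
  refine expansion_induction h.monic h.natDegree_pos
    (P := fun p => augment f w α (-p) = augment f w α p)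
    (fun g hg => ?_) (fun g q hg h0 ih => ?_) p
  · rw [h.augment_of_lt hg, h.augment_of_lt (by simpa using hg), h.neg g hg]
  · rw [show -(g + q * f) = -g + (-q) * f by ring, h.augment_add_mul hg,
      h.augment_add_mul (by simpa using hg), ih, h.neg g hg]

theorem natDegree_add_lt {g g' : K[X]} (hg : g.natDegree < f.natDegree)
    (hg' : g'.natDegree < f.natDegree) : (g + g').natDegree < f.natDegree :=
  (natDegree_add_le _ _).trans_lt (max_lt hg hg')

theorem augment_add (p p' : K[X]) :
    min (augment f w α p) (augment f w α p') ≤ augment f w α (p + p') := by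
  revert p'
  refine expansion_induction h.monic h.natDegree_pos
    (P := fun p => ∀ p', min (augment f w α p) (augment f w α p') ≤ augment f w α (p + p'))
    (fun g hg p' => ?_) (fun g q hg h0 ih p' => ?_) p
  · obtain ⟨g', q', hg', rfl⟩ := exists_eq_add_mul h.monic h.natDegree_pos p'
    rw [show g + (g' + q' * f) = (g + g') + q' * f by ring, h.augment_add_mul hg',
      h.augment_add_mul (h.natDegree_add_lt hg hg'), h.augment_of_lt hg]
    have := h.add g g' hg hg'
    rw [← min_assoc]
    exact min_le_min_right _ this
  · obtain ⟨g', q', hg', rfl⟩ := exists_eq_add_mul h.monic h.natDegree_pos p'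
    rw [show g + q * f + (g' + q' * f) = (g + g') + (q + q') * f by ring, h.augment_add_mul hg',
      h.augment_add_mul (h.natDegree_add_lt hg hg'), h.augment_add_mul hg]
    have h1 := h.add g g' hg hg'
    have h2 := ih q'
    rw [le_min_iff]
    constructor
    · refine le_trans ?_ h1
      exact min_le_min (min_le_left _ _) (min_le_left _ _)
    · refine le_trans ?_ (add_le_add_left h2 _)
      rw [← min_add_add_right]
      exact min_le_min (min_le_right _ _) (min_le_right _ _)

/-- This is proved by hand because multiplicativity is still open at this point, so `augment` is not
yet an `AddValuation`. -/
theorem augment_add_eq {p p' : K[X]} (hlt : augment f w α p < augment f w α p') :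
    augment f w α (p + p') = augment f w α p := by
  apply le_antisymm
  · have := h.augment_add (p + p') (-p')
    rw [h.augment_neg, add_neg_cancel_right] at this
    rcases min_le_iff.1 this with h1 | h1
    · exact h1
    · exact absurd h1 (not_le.2 hlt)
  · have := h.augment_add p p'
    rwa [min_eq_left hlt.le] at this

end IsAugmentable

end Augmentation

/-! ### Comparisons of values needed for multiplicativity -/

section WithTopArithmetic

variable {H : Type*} [AddCommGroup H] [LinearOrder H] [IsOrderedAddMonoid H]
  {x y A B S : WithTop H} {α : H}

theorem withTop_le_add_iff : x ≤ y + α ↔ x + ((-α : H) : WithTop H) ≤ y := by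
  cases x <;> cases y <;> (try simp) <;> (try norm_cast) <;> (try grind)

theorem withTop_neg_add_le (hy : y < B + α) : x + y + ((-α : H) : WithTop H) ≤ x + B := by
  cases x <;> cases y <;> cases B <;> (try simp at *) <;> (try norm_cast at *) <;> (try grind)

theorem withTop_neg_add_le' (hx : x < A + α) (hy : y < B + α) :
    x + y + ((-α : H) : WithTop H) ≤ A + B + α := by
  cases x <;> cases y <;> cases A <;> cases B <;> (try simp at *) <;> (try norm_cast at *) <;>
    (try grind)

/-- The alternative `S = ⊤` is needed for a vanishing factor: then `x + y` and `S` are both infinite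
and the strict inequality fails. -/
theorem withTop_lt_of_add_lt (hx : x < A + α) (hy : B + α < y) (hs : x + y < S + α ∨ S = ⊤) :
    x + B < S := by
  cases x <;> cases y <;> cases S <;> cases B <;> (try simp at *) <;> (try norm_cast at *) <;>
    (try grind)

theorem withTop_add_lt_add (hx : x < A + α) (hy : B + α < y) : x + B < y + A := by
  cases x <;> cases y <;> cases A <;> cases B <;> (try simp at *) <;> (try norm_cast at *) <;>
    (try grind)

theorem withTop_add_lt_add_add (hx : x < A + α) (hy : B + α < y) : x + B < A + B + α := by
  cases x <;> cases y <;> cases A <;> cases B <;> (try simp at *) <;> (try norm_cast at *) <;>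
    (try grind)

theorem withTop_add_add_lt (hx : A + α < x) (hy : B + α < y) (hs : x + y < S + α ∨ S = ⊤) :
    A + B + α < S := by
  cases x <;> cases y <;> cases S <;> cases A <;> cases B <;> (try simp at *) <;>
    (try norm_cast at *) <;> (try grind)

theorem withTop_add_add_lt_add (hx : A + α < x) (hy : B + α < y) : A + B + α < x + B := by
  cases x <;> cases y <;> cases A <;> cases B <;> (try simp at *) <;> (try norm_cast at *) <;>
    (try grind)

end WithTopArithmetic

/-! ### Multiplicativity in the absence of ties -/

section Augmentation

variable {K : Type*} [Field K] {H : Type*} [AddCommGroup H] [LinearOrder H] [IsOrderedAddMonoid H]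

theorem withTop_add_lt_add_iff {x y : WithTop H} (a : H) : x + a < y + a ↔ x < y :=
  WithTop.add_lt_add_iff_right WithTop.coe_ne_top

namespace IsAugmentable

variable {f : K[X]} {w : K[X] → WithTop H} {α : H} (h : IsAugmentable f w α)
include h

theorem lt_augment_add {x : WithTop H} {p p' : K[X]} (h1 : x < augment f w α p)
    (h2 : x < augment f w α p') : x < augment f w α (p + p') :=
  (lt_min h1 h2).trans_le (h.augment_add p p')

theorem le_augment_add {x : WithTop H} {p p' : K[X]} (h1 : x ≤ augment f w α p)
    (h2 : x ≤ augment f w α p') : x ≤ augment f w α (p + p') :=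
  (le_min h1 h2).trans (h.augment_add p p')

/-- Multiplicativity, if the terms of an expansion have pairwise distinct values. -/
theorem augment_map_mul
    (hN : ∀ g q : K[X], g.natDegree < f.natDegree → q ≠ 0 → w g ≠ augment f w α q + α)
    (p p' : K[X]) : augment f w α (p * p') = augment f w α p + augment f w α p' := by
  induction hn : p.natDegree + p'.natDegree using Nat.strong_induction_on generalizing p p' with
  | _ n ih =>
    obtain ⟨g, q, hg, rfl⟩ := exists_eq_add_mul h.monic h.natDegree_pos p
    obtain ⟨g', q', hg', rfl⟩ := exists_eq_add_mul h.monic h.natDegree_pos p'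
    have hpos := h.natDegree_pos
    have hq : q ≠ 0 → (g + q * f).natDegree = q.natDegree + f.natDegree :=
      natDegree_add_mul h.monic hg
    have hq' : q' ≠ 0 → (g' + q' * f).natDegree = q'.natDegree + f.natDegree :=
      natDegree_add_mul h.monic hg'
    have hs0 : g * g' = (g * g' %ₘ f) + (g * g' /ₘ f) * f := by
      rw [mul_comm _ f]; exact (modByMonic_add_div _ f).symm
    have hr := h.mul_mod g g' hg hg'
    have hrd : (g * g' %ₘ f).natDegree < f.natDegree :=
      natDegree_modByMonic_lt _ h.monic (by rintro rfl; simp at hpos)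
    have hsd : (g * g' /ₘ f).natDegree < f.natDegree := by
      rw [natDegree_divByMonic _ h.monic]
      have := natDegree_mul_le (p := g) (q := g')
      omega
    have hs : w g + w g' < augment f w α (g * g' /ₘ f) + α ∨ g * g' /ₘ f = 0 := by
      by_cases h0 : g = 0
      · right; simp [h0]
      by_cases h0' : g' = 0
      · right; simp [h0']
      left
      rw [h.augment_of_lt hsd]
      exact h.mul_div g g' hg hg' h0 h0'
    -- The mixed products, and `q * q'` below, have smaller total degree, so the induction
    -- hypothesis evaluates them.
    have e1 : augment f w α (g * q') = w g + augment f w α q' := by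
      by_cases h0 : q' = 0
      · simp [h0, h.augment_zero]
      rw [← h.augment_of_lt hg]
      refine ih _ ?_ g q' rfl
      rw [← hn, hq' h0]
      have : g.natDegree ≤ (g + q * f).natDegree := by
        by_cases h1 : q = 0
        · simp [h1]
        · rw [hq h1]; omega
      omega
    have e2 : augment f w α (g' * q) = w g' + augment f w α q := by
      by_cases h0 : q = 0
      · simp [h0, h.augment_zero]
      rw [← h.augment_of_lt hg']
      refine ih _ ?_ g' q rfl
      rw [← hn, hq h0]
      have : g'.natDegree ≤ (g' + q' * f).natDegree := by
        by_cases h1 : q' = 0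
        · simp [h1]
        · rw [hq' h1]; omega
      omega
    have e3 : augment f w α (q * q' * f) = augment f w α q + augment f w α q' + α := by
      by_cases h0 : q = 0
      · simp [h0, h.augment_zero]
      by_cases h0' : q' = 0
      · simp [h0', h.augment_zero]
      rw [h.augment_mul, ih _ ?_ q q' rfl]
      rw [← hn, hq h0, hq' h0']
      omega
    have hx : w g ≠ augment f w α q + α ∨ q = 0 := by
      by_cases h0 : q = 0
      · exact Or.inr h0
      · exact Or.inl (hN g q hg h0)
    have hy : w g' ≠ augment f w α q' + α ∨ q' = 0 := by
      by_cases h0 : q' = 0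
      · exact Or.inr h0
      · exact Or.inl (hN g' q' hg' h0)
    -- Everything except the remainder of `g * g'` is collected into one quotient, so that
    -- `augment_add_mul` applies to the product.
    have hprod : (g + q * f) * (g' + q' * f) =
        (g * g' %ₘ f) + (g * g' /ₘ f + (g * q' + (g' * q + q * q' * f))) * f := by
      linear_combination hs0
    by_cases hp0 : g + q * f = 0
    · rw [hp0]; simp [h.augment_zero]
    by_cases hp0' : g' + q' * f = 0
    · rw [hp0']; simp [h.augment_zero]
    have hp1 := h.augment_ne_top hp0
    have hp1' := h.augment_ne_top hp0'
    rw [hprod, h.augment_add_mul hrd, h.augment_add_mul hg, h.augment_add_mul hg', hr]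
    rw [h.augment_add_mul hg] at hp1
    rw [h.augment_add_mul hg'] at hp1'
    replace hx : w g < augment f w α q + α ∨ augment f w α q + α < w g := by
      rcases hx with hx | hx
      · exact lt_or_gt_of_ne hx
      · subst hx
        left
        rw [h.augment_zero, top_add, lt_top_iff_ne_top]
        simpa [h.augment_zero] using hp1
    replace hy : w g' < augment f w α q' + α ∨ augment f w α q' + α < w g' := by
      rcases hy with hx | hx
      · exact lt_or_gt_of_ne hx
      · subst hx
        left
        rw [h.augment_zero, top_add, lt_top_iff_ne_top]
        simpa [h.augment_zero] using hp1'
    replace hs : w g + w g' < augment f w α (g * g' /ₘ f) + α ∨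
        augment f w α (g * g' /ₘ f) = ⊤ := by
      rcases hs with hs | hs
      · exact Or.inl hs
      · right; rw [hs, h.augment_zero]
    generalize g * g' /ₘ f = s at *
    -- In each case one product carries the minimum: the remainder of `g * g'`, or `g * q'`, `g' *
    -- q`, `q * q' * f` inside the quotient. In the last three cases strictness in `hx` and `hy`
    -- puts the rest of the quotient strictly above it.
    rcases hx with hx | hx <;> rcases hy with hy | hy
    · rw [min_eq_left hx.le, min_eq_left hy.le, min_eq_left]
      rw [withTop_le_add_iff]
      refine h.le_augment_add ?_ (h.le_augment_add ?_ (h.le_augment_add ?_ ?_))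
      · rw [← withTop_le_add_iff]
        rcases hs with hs | hs
        · exact hs.le
        · simp [hs]
      · rw [e1]; exact withTop_neg_add_le hy
      · rw [e2, add_comm (w g)]; exact withTop_neg_add_le hx
      · rw [e3]; exact withTop_neg_add_le' hx hy
    · have key : augment f w α (s + (g * q' + (g' * q + q * q' * f))) =
          augment f w α (g * q') := by
        rw [show s + (g * q' + (g' * q + q * q' * f)) =
          g * q' + (s + (g' * q + q * q' * f)) by ring]
        apply h.augment_add_eq
        refine h.lt_augment_add ?_ (h.lt_augment_add ?_ ?_)
        · rw [e1]; exact withTop_lt_of_add_lt hx hy hs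
        · rw [e1, e2]; exact withTop_add_lt_add hx hy
        · rw [e1, e3]; exact withTop_add_lt_add_add hx hy
      rw [key, e1, min_eq_left hx.le, min_eq_right hy.le, min_eq_right]
      · rw [add_assoc]
      · rw [add_assoc]; exact add_le_add_right hy.le _
    · have key : augment f w α (s + (g * q' + (g' * q + q * q' * f))) =
          augment f w α (g' * q) := by
        rw [show s + (g * q' + (g' * q + q * q' * f)) =
          g' * q + (s + (g * q' + q * q' * f)) by ring]
        apply h.augment_add_eq
        refine h.lt_augment_add ?_ (h.lt_augment_add ?_ ?_)
        · rw [add_comm (w g)] at hs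
          rw [e2]; exact withTop_lt_of_add_lt hy hx hs
        · rw [e1, e2]; exact withTop_add_lt_add hy hx
        · rw [e2, e3, add_comm (augment f w α q)]; exact withTop_add_lt_add_add hy hx
      rw [key, e2, min_eq_right hx.le, min_eq_left hy.le, min_eq_right]
      · rw [add_comm (w g'), add_right_comm]
      · rw [add_comm (w g'), add_right_comm]; exact add_le_add_left hx.le _
    · have key : augment f w α (s + (g * q' + (g' * q + q * q' * f))) =
          augment f w α (q * q' * f) := by
        rw [show s + (g * q' + (g' * q + q * q' * f)) =
          q * q' * f + (s + (g * q' + g' * q)) by ring]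
        apply h.augment_add_eq
        refine h.lt_augment_add ?_ (h.lt_augment_add ?_ ?_)
        · rw [e3]; exact withTop_add_add_lt hx hy hs
        · rw [e1, e3]; exact withTop_add_add_lt_add hx hy
        · rw [e2, e3, add_comm (augment f w α q)]; exact withTop_add_add_lt_add hy hx
      rw [key, e3, min_eq_right hx.le, min_eq_right hy.le, min_eq_right]
      · rw [add_add_add_comm, ← add_assoc]
      · refine (add_le_add hx.le hy.le).trans' (le_of_eq ?_)
        rw [add_add_add_comm, ← add_assoc]

end IsAugmentable

end Augmentation

/-! ### Removing ties by perturbing the value of the key polynomial -/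

section Augmentation

variable {K : Type*} [Field K] {H : Type*} [AddCommGroup H] [LinearOrder H] [IsOrderedAddMonoid H]

/-- The embedding `a ↦ (a, 0)` in the lexicographic product with `ℤ`. -/
def lexInl (H : Type*) [AddCommGroup H] : H →+ H ×ₗ ℤ where
  toFun a := toLex (a, 0)
  map_zero' := rfl
  map_add' a b := by rw [← toLex_add]; simp

/-- The first projection of the lexicographic product with `ℤ`. -/
def lexFst (H : Type*) [AddCommGroup H] : H ×ₗ ℤ →+ H where
  toFun a := (ofLex a).1
  map_zero' := rfl
  map_add' _ _ := rfl

theorem lexInl_strictMono : StrictMono (lexInl H) := by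
  intro a b h
  exact Prod.Lex.toLex_lt_toLex.2 (Or.inl h)

theorem lexFst_monotone : Monotone (lexFst H) := by
  intro a b h
  rcases Prod.Lex.le_iff.1 h with h | h
  · exact h.le
  · exact h.1.le

theorem withTop_map_add {G H : Type*} [AddCommGroup G] [AddCommGroup H] (φ : G →+ H)
    (x y : WithTop G) : (x + y).map φ = x.map φ + y.map φ := by
  cases x <;> cases y <;> simp [← WithTop.coe_add]

theorem withTop_map_zero {G H : Type*} [AddCommGroup G] [AddCommGroup H] (φ : G →+ H) :
    (0 : WithTop G).map φ = 0 := by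
  rw [← WithTop.coe_zero, WithTop.map_coe, map_zero, WithTop.coe_zero]

theorem withTop_map_eq_top {G H : Type*} (φ : G → H) (x : WithTop G) :
    x.map φ = ⊤ ↔ x = ⊤ := by
  cases x <;> simp

namespace IsAugmentable

variable {f : K[X]} {w : K[X] → WithTop H} {α : H} (h : IsAugmentable f w α)
include h

/-- The strict inequality `mul_div` is decided in the first coordinate, so it is insensitive to the
second. -/
theorem perturb : IsAugmentable f (fun p => (w p).map (lexInl H)) (toLex (α, (1 : ℤ))) where
  monic := h.monic
  natDegree_pos := h.natDegree_pos
  zero := by simp [h.zero]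
  one := by rw [h.one, withTop_map_zero]
  ne_top g hg h0 := by
    rw [Ne, withTop_map_eq_top]
    exact h.ne_top g hg h0
  neg g hg := by rw [h.neg g hg]
  add g g' hg hg' := by
    rw [← lexInl_strictMono.monotone.withTop_map.map_min]
    exact lexInl_strictMono.monotone.withTop_map (h.add g g' hg hg')
  mul_mod g g' hg hg' := by rw [h.mul_mod g g' hg hg', withTop_map_add]
  mul_div g g' hg hg' h0 h0' := by
    have h1 := h.mul_div g g' hg hg' h0 h0'
    have h2 := h.ne_top g hg h0
    have h3 := h.ne_top g' hg' h0'
    cases hx : w g with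
    | top => exact absurd hx h2
    | coe a =>
      cases hy : w g' with
      | top => exact absurd hy h3
      | coe b =>
        rw [hx, hy] at h1
        cases hz : w (g * g' /ₘ f) with
        | top => simp [← WithTop.coe_add]
        | coe c =>
          rw [hz] at h1
          have h4 : a + b < c + α := by exact_mod_cast h1
          rw [WithTop.map_coe, WithTop.map_coe, WithTop.map_coe]
          have h5 : lexInl H a + lexInl H b < lexInl H c + toLex (α, (1 : ℤ)) :=
            Prod.Lex.lt_iff.2 (Or.inl h4)
          exact_mod_cast h5

/-- The second coordinate is the exponent of `f` in the minimal term. A remainder has second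
coordinate `0` and a nonzero multiple of `f` at least `1`, which rules out ties. -/
theorem exists_augment_perturb {q : K[X]} (hq : q ≠ 0) : ∃ (a : H) (n : ℤ), 0 ≤ n ∧
    augment f (fun p => (w p).map (lexInl H)) (toLex (α, (1 : ℤ))) q =
      ((toLex (a, n) : H ×ₗ ℤ) : WithTop (H ×ₗ ℤ)) := by
  revert hq
  refine expansion_induction h.monic h.natDegree_pos (P := fun q => q ≠ 0 → ∃ (a : H) (n : ℤ),
    0 ≤ n ∧ augment f (fun p => (w p).map (lexInl H)) (toLex (α, (1 : ℤ))) q =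
      ((toLex (a, n) : H ×ₗ ℤ) : WithTop (H ×ₗ ℤ))) (fun g hg h0 => ?_)
      (fun g q hg h0 ih _ => ?_) q
  · rw [h.perturb.augment_of_lt hg]
    cases hx : w g with
    | top => exact absurd hx (h.ne_top g hg h0)
    | coe a => exact ⟨a, 0, le_rfl, rfl⟩
  · obtain ⟨a, n, hn, h1⟩ := ih h0
    rw [h.perturb.augment_add_mul hg, h1]
    rcases min_choice ((w g).map (lexInl H)) (((toLex (a, n) : H ×ₗ ℤ) : WithTop (H ×ₗ ℤ)) +
      ((toLex (α, (1 : ℤ)) : H ×ₗ ℤ) : WithTop (H ×ₗ ℤ))) with h2 | h2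
    · rw [h2]
      cases hx : w g with
      | top =>
        rw [hx, WithTop.map_top, min_eq_right le_top] at h2
        exact absurd h2 WithTop.coe_ne_top
      | coe a => exact ⟨a, 0, le_rfl, rfl⟩
    · rw [h2]
      exact ⟨a + α, n + 1, by omega, rfl⟩

/-- The first projection is additive and monotone, hence commutes with sums and minima, and it
undoes the embedding of the coefficients. -/
theorem map_lexFst_augment (p : K[X]) :
    (augment f (fun p => (w p).map (lexInl H)) (toLex (α, (1 : ℤ))) p).map (lexFst H) =
      augment f w α p := by
  have hw : ∀ x : WithTop H, (x.map (lexInl H)).map (lexFst H) = x := by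
    intro x
    cases x <;> rfl
  refine expansion_induction h.monic h.natDegree_pos (P := fun p =>
    (augment f (fun p => (w p).map (lexInl H)) (toLex (α, (1 : ℤ))) p).map (lexFst H) =
      augment f w α p) (fun g hg => ?_) (fun g q hg h0 ih => ?_) p
  · rw [h.perturb.augment_of_lt hg, h.augment_of_lt hg, hw]
  · have hm : Monotone (WithTop.map (lexFst H)) := lexFst_monotone.withTop_map
    rw [h.perturb.augment_add_mul hg, h.augment_add_mul hg, hm.map_min, withTop_map_add, ih, hw]
    rfl

theorem augment_map_mul' (p q : K[X]) :
    augment f w α (p * q) = augment f w α p + augment f w α q := by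
  rw [← h.map_lexFst_augment, ← h.map_lexFst_augment, ← h.map_lexFst_augment,
    h.perturb.augment_map_mul, withTop_map_add]
  intro g q hg hq
  obtain ⟨a, n, hn, h1⟩ := h.exists_augment_perturb hq
  rw [h1]
  cases hx : w g with
  | top => exact (WithTop.coe_ne_top).symm
  | coe b =>
    intro h2
    rw [WithTop.map_coe, ← WithTop.coe_add] at h2
    have h3 : lexInl H b = toLex (a, n) + toLex (α, (1 : ℤ)) := WithTop.coe_injective h2
    have h4 : (0 : ℤ) = n + 1 := congrArg (fun x => (ofLex x).2) h3
    omega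

/-- The augmentation as a valuation of the polynomial ring. -/
noncomputable def valuation : AddValuation K[X] (WithTop H) :=
  AddValuation.of (augment f w α) h.augment_zero
    (by rw [h.augment_of_lt (by simpa using h.natDegree_pos), h.one])
    h.augment_add h.augment_map_mul'

theorem valuation_apply (p : K[X]) : h.valuation p = augment f w α p := rfl

end IsAugmentable

theorem exists_addValuation_ratFunc (V : AddValuation K[X] (WithTop H))
    (hV : ∀ p, p ≠ 0 → V p ≠ ⊤) :
    ∃ V' : AddValuation (RatFunc K) (WithTop H), ∀ p, V' (algebraMap K[X] (RatFunc K) p) = V p := by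
  have hS : nonZeroDivisors K[X] ≤ (AddValuation.toValuation V).supp.primeCompl := by
    intro p hp hp'
    exact hV p (nonZeroDivisors.ne_zero hp) hp'
  refine ⟨AddValuation.ofValuation
    ((AddValuation.toValuation V).extendToLocalization hS (RatFunc K)), fun p => ?_⟩
  exact Valuation.extendToLocalization_apply_map_apply _ hS _ p

end Augmentation

/-! ### Valuations normalized to their value group, and extensions given on polynomials -/

section Normalized

variable {K : Type u} [Field K] {Γ : Type v} [AddCommGroup Γ] [LinearOrder Γ]
  [IsOrderedAddMonoid Γ] (v₀ : AddValuation K (WithTop Γ))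

open Classical in
/-- The underlying function of `val v₀`. -/
noncomputable def valFun (a : K) : WithTop (valueGroup v₀) :=
  if h : v₀ a = ⊤ then ⊤ else ((⟨(v₀ a).untop h, a, by simp⟩ : valueGroup v₀) :
    WithTop (valueGroup v₀))

theorem map_valFun (a : K) : (valFun v₀ a).map (Subtype.val : valueGroup v₀ → Γ) = v₀ a := by
  unfold valFun
  split_ifs with h
  · simp [h]
  · simp

theorem withTop_subtype_map_injective :
    Function.Injective (WithTop.map (Subtype.val : valueGroup v₀ → Γ)) :=
  Option.map_injective Subtype.val_injective

theorem withTop_subtype_map_strictMono :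
    StrictMono (WithTop.map (Subtype.val : valueGroup v₀ → Γ)) :=
  StrictMono.withTop_map fun _ _ h => h

/-- The valuation `v₀` with values in its value group. -/
noncomputable def val : AddValuation K (WithTop (valueGroup v₀)) :=
  AddValuation.of (valFun v₀)
    (withTop_subtype_map_injective v₀ (by rw [map_valFun]; simp))
    (withTop_subtype_map_injective v₀ (by
      rw [map_valFun, AddValuation.map_one]
      exact (withTop_map_zero (valueGroup v₀).subtype).symm))
    (fun a b => by
      rw [← (withTop_subtype_map_strictMono v₀).le_iff_le,
        (withTop_subtype_map_strictMono v₀).monotone.map_min, map_valFun, map_valFun, map_valFun]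
      exact v₀.map_add a b)
    (fun a b => withTop_subtype_map_injective v₀ (by
      rw [map_valFun, AddValuation.map_mul]
      refine Eq.trans ?_ (withTop_map_add (valueGroup v₀).subtype _ _).symm
      exact (congrArg₂ _ (map_valFun v₀ a) (map_valFun v₀ b)).symm))

theorem map_val (a : K) : (val v₀ a).map (Subtype.val : valueGroup v₀ → Γ) = v₀ a :=
  map_valFun v₀ a

theorem exists_val_eq (γ : valueGroup v₀) : ∃ a : K, val v₀ a = γ := by
  obtain ⟨a, ha⟩ := γ.2
  exact ⟨a, withTop_subtype_map_injective v₀ (by rw [map_val, ha]; rfl)⟩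

theorem holds_val (ℓ : BallLabel (valueGroup v₀)) (a : K) :
    ℓ.Holds (Subtype.val : valueGroup v₀ → Γ) (v₀ a) ↔ ℓ.Holds id (val v₀ a) := by
  rw [← map_val]
  cases ℓ with
  | closed γ =>
    simp only [BallLabel.Holds, WithTop.map_id, id]
    exact (withTop_subtype_map_strictMono v₀).le_iff_le
  | op γ =>
    simp only [BallLabel.Holds]
    exact (withTop_subtype_map_strictMono v₀).lt_iff_lt (a := (γ : WithTop (valueGroup v₀)))

variable {v₀}

theorem extends_iff {L : Type*} [Field L] [Algebra K L] {Γ' : Type*}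
    [AddCommGroup Γ'] [LinearOrder Γ'] [IsOrderedAddMonoid Γ'] {ι : valueGroup v₀ →+ Γ'}
    {V : AddValuation L (WithTop Γ')} :
    Extends v₀ ι V ↔ ∀ a, V (algebraMap K L a) = (val v₀ a).map ι := by
  constructor
  · intro h a
    have h1 := map_val v₀ a
    cases hx : val v₀ a with
    | top =>
      rw [hx] at h1
      have : a = 0 := (AddValuation.top_iff v₀).1 h1.symm
      simp [this]
    | coe γ =>
      rw [hx] at h1
      exact h a γ h1.symm
  · intro h a γ ha
    rw [h a]
    have : val v₀ a = γ := withTop_subtype_map_injective v₀ (by rw [map_val, ha]; rfl)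
    rw [this]; rfl

theorem Extension.v_algebraMap_eq {L : Type u₁} [Field L] [Algebra K L]
    (E : Extension.{u, v, w, u₁} v₀ L) (a : K) :
    E.v (algebraMap K L a) = (val v₀ a).map E.ι :=
  extends_iff.1 E.isExt a

/-- The restriction of an extension of `v₀` to the polynomial ring. -/
noncomputable def Extension.polyVal (E : Extension.{u, v, w, u} v₀ (RatFunc K)) :
    AddValuation K[X] (WithTop E.Γ') :=
  E.v.comap (algebraMap K[X] (RatFunc K))

theorem Extension.polyVal_apply (E : Extension.{u, v, w, u} v₀ (RatFunc K)) (p : K[X]) :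
    E.polyVal p = E.v (algebraMap K[X] (RatFunc K) p) := rfl

theorem Extension.polyVal_C (E : Extension.{u, v, w, u} v₀ (RatFunc K)) (a : K) :
    E.polyVal (C a) = (val v₀ a).map E.ι := by
  rw [← E.v_algebraMap_eq, E.polyVal_apply]
  rfl

theorem Extension.polyVal_eq_top (E : Extension.{u, v, w, u} v₀ (RatFunc K)) {p : K[X]} :
    E.polyVal p = ⊤ ↔ p = 0 := by
  rw [E.polyVal_apply, AddValuation.top_iff]
  simp

theorem exists_extension {H : Type w} [AddCommGroup H] [LinearOrder H] [IsOrderedAddMonoid H]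
    (ι : valueGroup v₀ →+ H) (hι : StrictMono ι) (V : AddValuation K[X] (WithTop H))
    (hV : ∀ p, p ≠ 0 → V p ≠ ⊤) (hC : ∀ a, V (C a) = (val v₀ a).map ι) :
    ∃ (v : AddValuation (RatFunc K) (WithTop H)) (hv : Extends v₀ ι v),
      ∀ p, (Extension.mk ι hι v hv).polyVal p = V p := by
  obtain ⟨V', hV'⟩ := exists_addValuation_ratFunc V hV
  refine ⟨V', extends_iff.2 fun a => ?_, fun p => hV' p⟩
  rw [← hC a, ← hV' (C a)]
  rfl

end Normalized

/-! ### Agreement to leading order, and residues -/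

section Approx

variable {L : Type*} [Field L] {H : Type*} [AddCommGroup H] [LinearOrder H] [IsOrderedAddMonoid H]
  {V : AddValuation L (WithTop H)}

theorem val_eq_of_lt_sub {R : Type*} [Ring R] {V : AddValuation R (WithTop H)} {x y : R}
    (h : V x < V (x - y)) : V y = V x :=
  V.map_eq_of_lt_sub (by rwa [V.map_sub_swap])

/-- The condition `V a < V (a - b)` says that `b / a` is a unit with residue `1`. Such elements form
a group, whence compatibility with products here and with inverses in `approx_inv`. -/
theorem approx_mul {a b c d : L} (h1 : V a < V (a - b)) (h2 : V c < V (c - d)) :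
    V (a * c) < V (a * c - b * d) := by
  have hb := val_eq_of_lt_sub h1
  have ha0 : V a ≠ ⊤ := (lt_of_lt_of_le h1 le_top).ne
  have hc0 : V c ≠ ⊤ := (lt_of_lt_of_le h2 le_top).ne
  rw [show a * c - b * d = (a - b) * c + b * (c - d) by ring]
  apply V.map_lt_add
  · rw [V.map_mul, V.map_mul]
    exact (WithTop.add_lt_add_iff_right hc0).2 h1
  · rw [V.map_mul, V.map_mul, hb]
    exact (WithTop.add_lt_add_iff_left ha0).2 h2

theorem val_inv_add {a : L} (ha : a ≠ 0) : V a⁻¹ + V a = 0 := by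
  rw [← V.map_mul, inv_mul_cancel₀ ha, V.map_one]

theorem approx_inv {a b : L} (h : V a < V (a - b)) : V a⁻¹ < V (a⁻¹ - b⁻¹) := by
  have hb := val_eq_of_lt_sub h
  have hat : V a ≠ ⊤ := (lt_of_lt_of_le h le_top).ne
  have ha : a ≠ 0 := (V.ne_top_iff).1 hat
  have hb0 : b ≠ 0 := (V.ne_top_iff).1 (hb ▸ hat)
  rw [show a⁻¹ - b⁻¹ = a⁻¹ * (b⁻¹ * -(a - b)) by field_simp; ring, V.map_mul, V.map_mul, V.map_neg]
  have h1 := val_inv_add (V := V) hb0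
  rw [hb] at h1
  have hbt : V b⁻¹ ≠ ⊤ := (V.ne_top_iff).2 (inv_ne_zero hb0)
  have hit : V a⁻¹ ≠ ⊤ := (V.ne_top_iff).2 (inv_ne_zero ha)
  have h2 : 0 < V b⁻¹ + V (a - b) := by
    rw [← h1]
    exact (WithTop.add_lt_add_iff_left hbt).2 h
  simpa using (WithTop.add_lt_add_iff_left hit).2 h2

theorem mem_maximalIdeal_iff (V : AddValuation L (WithTop H)) (x : valuationRing V) :
    x ∈ IsLocalRing.maximalIdeal (valuationRing V) ↔ 0 < V (x : L) := by
  have hx : 0 ≤ V (x : L) := x.2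
  rw [IsLocalRing.mem_maximalIdeal, mem_nonunits_iff]
  constructor
  · intro h
    refine lt_of_le_of_ne hx fun h0 => h ?_
    have hx0 : (x : L) ≠ 0 := by
      intro h1
      rw [h1, V.map_zero] at h0
      exact WithTop.coe_ne_top (a := (0 : H)) h0
    have h1 := val_inv_add (V := V) hx0
    rw [← h0, add_zero] at h1
    exact IsUnit.of_mul_eq_one (⟨(x : L)⁻¹, h1.ge⟩ : valuationRing V)
      (Subtype.ext (mul_inv_cancel₀ hx0))
  · intro h hu
    obtain ⟨y, hy⟩ := hu.exists_right_inv
    have h1 : V (x : L) + V (y : L) = 0 := by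
      rw [← V.map_mul, ← V.map_one]
      exact congrArg (fun z : valuationRing V => V (z : L)) hy
    have h2 : 0 ≤ V (y : L) := y.2
    exact absurd h1 (add_pos_of_pos_of_nonneg h h2).ne'

theorem residue_eq_iff (x y : valuationRing V) :
    IsLocalRing.residue _ x = IsLocalRing.residue _ y ↔ 0 < V ((x : L) - y) := by
  rw [← sub_eq_zero, ← map_sub, IsLocalRing.residue_eq_zero_iff, mem_maximalIdeal_iff]
  rfl

theorem residue_eq_zero_iff' (x : valuationRing V) :
    IsLocalRing.residue _ x = 0 ↔ 0 < V (x : L) := by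
  rw [IsLocalRing.residue_eq_zero_iff, mem_maximalIdeal_iff]

end Approx

/-! ### Approximation by constants and by monomials in a key polynomial -/

section Criteria

variable {K : Type u} [Field K] {Γ : Type v} [AddCommGroup Γ] [LinearOrder Γ]
  [IsOrderedAddMonoid Γ] {v₀ : AddValuation K (WithTop Γ)}
  (E : Extension.{u, v, w, u} v₀ (RatFunc K))

/-- Numerator and denominator are approximated separately; closure of `S` under quotients does the
rest. It is used with `S` the nonzero constants and with `S` the monomials `c fⁿ`. -/
theorem Extension.exists_approx_div {S : Submonoid (RatFunc K)ˣ}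
    (h : ∀ p : K[X], p ≠ 0 → ∃ s ∈ S, E.polyVal p <
      E.v (algebraMap K[X] (RatFunc K) p - (s : (RatFunc K)ˣ)))
    (hS : ∀ s ∈ S, s⁻¹ ∈ S) (y : RatFunc K) (hy : y ≠ 0) :
    ∃ s ∈ S, E.v y < E.v (y - (s : (RatFunc K)ˣ)) := by
  obtain ⟨s, hs, h1⟩ := h y.num (RatFunc.num_ne_zero hy)
  obtain ⟨t, ht, h2⟩ := h y.denom y.denom_ne_zero
  refine ⟨s * t⁻¹, S.mul_mem hs (hS t ht), ?_⟩
  have h3 := approx_mul h1 (approx_inv h2)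
  rw [← div_eq_mul_inv, RatFunc.num_div_denom] at h3
  simpa using h3

theorem Extension.exists_residue_eq {x : resField E.v} (hx : x ≠ 0) :
    ∃ (y : RatFunc K) (hy : 0 ≤ E.v y), E.v y = 0 ∧ y ≠ 0 ∧
      x = IsLocalRing.residue (valuationRing E.v) ⟨y, hy⟩ := by
  obtain ⟨⟨y, hy⟩, rfl⟩ := IsLocalRing.residue_surjective x
  rw [Ne, residue_eq_zero_iff'] at hx
  have h0 : E.v y = 0 := le_antisymm (not_lt.1 hx) hy
  refine ⟨y, hy, h0, ?_, rfl⟩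
  rintro rfl
  simp at h0

theorem nonneg_of_map_nonneg {c : K} (h : 0 ≤ E.v (algebraMap K (RatFunc K) c)) :
    c ∈ valuationRing v₀ :=
  (E.nonneg_algebraMap_iff c).1 h

theorem Extension.residueMap_eq {y : RatFunc K} (hy : 0 ≤ E.v y) {c : K}
    (hc : c ∈ valuationRing v₀) (h : 0 < E.v (y - algebraMap K (RatFunc K) c)) :
    E.residueMap (IsLocalRing.residue _ ⟨c, hc⟩) =
      IsLocalRing.residue (valuationRing E.v) ⟨y, hy⟩ := by
  have : E.residueMap (IsLocalRing.residue _ ⟨c, hc⟩) =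
    IsLocalRing.residue (valuationRing E.v) (E.ringMap ⟨c, hc⟩) := rfl
  rw [this, residue_eq_iff]
  rw [AddValuation.map_sub_swap]
  exact h

theorem Extension.residueMap_surjective_of_approx
    (h : ∀ y : RatFunc K, E.v y = 0 → ∃ c : K, 0 < E.v (y - algebraMap K (RatFunc K) c)) :
    Function.Surjective E.residueMap := by
  intro x
  by_cases hx : x = 0
  · exact ⟨0, by rw [hx, map_zero]⟩
  obtain ⟨y, hy, hy0, -, rfl⟩ := E.exists_residue_eq hx
  obtain ⟨c, hc⟩ := h y hy0
  have h1 : E.v (algebraMap K (RatFunc K) c) = 0 := by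
    rw [← hy0]
    exact val_eq_of_lt_sub (by rwa [hy0])
  exact ⟨_, E.residueMap_eq hy (nonneg_of_map_nonneg E h1.ge) hc⟩

/-- The units of `K(x)` of the form `c fⁿ`, with `c ∈ Kˣ` and `n ∈ ℤ`. -/
def monomialUnits {f : K[X]} (hf : f ≠ 0) : Subgroup (RatFunc K)ˣ where
  carrier := {s | ∃ (c : K) (n : ℤ), c ≠ 0 ∧
    (s : RatFunc K) = algebraMap K (RatFunc K) c * algebraMap K[X] (RatFunc K) f ^ n}
  one_mem' := ⟨1, 0, one_ne_zero, by simp⟩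
  mul_mem' := by
    rintro s t ⟨c, n, hc, hs⟩ ⟨d, m, hd, ht⟩
    refine ⟨c * d, n + m, mul_ne_zero hc hd, ?_⟩
    have : algebraMap K[X] (RatFunc K) f ≠ 0 := by simpa using hf
    rw [Units.val_mul, hs, ht, zpow_add₀ this, map_mul]
    ring
  inv_mem' := by
    rintro s ⟨c, n, hc, hs⟩
    exact ⟨c⁻¹, -n, inv_ne_zero hc, by simp [hs]; ring⟩

variable {f : K[X]} {α : E.Γ'}

theorem withTop_map_val_eq_coe {H : Type*} (ι : valueGroup v₀ → H) {c : K} (hc : c ≠ 0) :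
    ∃ γ : valueGroup v₀, val v₀ c = γ ∧ (val v₀ c).map ι = ((ι γ : H) : WithTop H) := by
  cases h : val v₀ c with
  | top => exact absurd ((val v₀).top_iff.1 h) hc
  | coe γ => exact ⟨γ, rfl, rfl⟩

theorem Extension.polyVal_monomial (hα : E.polyVal f = α) {c : K} (hc : c ≠ 0) (n : ℕ) :
    ∃ γ : valueGroup v₀, E.polyVal (C c * f ^ n) = ((E.ι γ + n • α : E.Γ') : WithTop E.Γ') := by
  obtain ⟨γ, -, hγ⟩ := withTop_map_val_eq_coe E.ι hc
  refine ⟨γ, ?_⟩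
  rw [AddValuation.map_mul, AddValuation.map_pow, hα, E.polyVal_C, hγ]
  norm_cast

/-- If `f` has non-torsion value and polynomials of smaller degree are approximated by constants,
then every nonzero polynomial is approximated by a monomial in `f`. -/
theorem Extension.exists_approx_monomial (hf : f.Monic) (hd : 0 < f.natDegree)
    (hα : E.polyVal f = α) (hα' : ∀ n : ℕ, 0 < n → n • α ∉ E.ι.range)
    (hres : ∀ g : K[X], g.natDegree < f.natDegree → g ≠ 0 →
      ∃ c : K, E.polyVal g < E.polyVal (g - C c)) (p : K[X]) :
    p ≠ 0 → ∃ (c : K) (n : ℕ), c ≠ 0 ∧ E.polyVal p < E.polyVal (p - C c * f ^ n) := by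
  have hc0 : ∀ g c, E.polyVal g < E.polyVal (g - C c) → c ≠ 0 := by
    rintro g _ h rfl
    simp at h
  refine expansion_induction hf hd (P := fun p => p ≠ 0 → ∃ (c : K) (n : ℕ), c ≠ 0 ∧
    E.polyVal p < E.polyVal (p - C c * f ^ n)) (fun g hg h0 => ?_) (fun g q hg h0 ih _ => ?_) p
  · obtain ⟨c, hc⟩ := hres g hg h0
    exact ⟨c, 0, hc0 g c hc, by simpa using hc⟩
  · obtain ⟨c, n, hcne, hc⟩ := ih h0
    have hq : E.polyVal (q * f) < E.polyVal (q * f - C c * f ^ (n + 1)) := by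
      rw [show q * f - C c * f ^ (n + 1) = (q - C c * f ^ n) * f by ring, AddValuation.map_mul,
        AddValuation.map_mul, hα]
      exact (withTop_add_lt_add_iff α).2 hc
    by_cases hg0 : g = 0
    · exact ⟨c, n + 1, hcne, by simpa [hg0] using hq⟩
    obtain ⟨d, hd⟩ := hres g hg hg0
    -- A tie would put a positive multiple of `α` into the value group of `v₀`, since the leading
    -- parts are a constant and a constant times `f ^ (n + 1)`.
    have hne : E.polyVal g ≠ E.polyVal (q * f) := by
      rw [← val_eq_of_lt_sub hd, ← val_eq_of_lt_sub hq, E.polyVal_C]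
      obtain ⟨γ, hγ⟩ := E.polyVal_monomial hα hcne (n + 1)
      obtain ⟨δ, -, hδ⟩ := withTop_map_val_eq_coe E.ι (hc0 g d hd)
      rw [hγ, hδ]
      intro h
      have h' : E.ι δ = E.ι γ + (n + 1) • α := WithTop.coe_injective h
      refine hα' (n + 1) n.succ_pos ⟨δ - γ, ?_⟩
      rw [map_sub, h']
      abel
    rcases lt_or_gt_of_ne hne with h | h
    · refine ⟨d, 0, hc0 g d hd, ?_⟩
      rw [AddValuation.map_add_eq_of_lt_left _ h,
        show g + q * f - C d * f ^ 0 = (g - C d) + q * f by ring]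
      exact AddValuation.map_lt_add _ hd h
    · refine ⟨c, n + 1, hcne, ?_⟩
      rw [AddValuation.map_add_eq_of_lt_right _ h, add_sub_assoc]
      exact AddValuation.map_lt_add _ h hq

/-- An element and its approximating constant have the same value, and the same residue if that
value is `0`. Both properties pass from polynomials to quotients. -/
theorem Extension.isImmediate_of_approx
    (h : ∀ p : K[X], p ≠ 0 → ∃ c : K, E.polyVal p < E.polyVal (p - C c)) : E.IsImmediate := by
  have key : ∀ y : RatFunc K, y ≠ 0 → ∃ c : K, c ≠ 0 ∧
      E.v y < E.v (y - algebraMap K (RatFunc K) c) := by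
    intro y hy
    obtain ⟨s, ⟨c, hc⟩, h1⟩ := E.exists_approx_div
      (S := (Units.map (algebraMap K (RatFunc K)).toMonoidHom).range.toSubmonoid) (fun p hp => by
        obtain ⟨c, hc⟩ := h p hp
        have hc0 : c ≠ 0 := by
          rintro rfl
          simp at hc
        refine ⟨_, ⟨Units.mk0 c hc0, rfl⟩, ?_⟩
        rw [E.polyVal_apply, E.polyVal_apply, map_sub] at hc
        exact hc) (fun s hs => Subgroup.inv_mem _ hs) y hy
    refine ⟨c, c.ne_zero, ?_⟩
    rw [← hc] at h1
    exact h1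
  refine ⟨?_, E.residueMap_surjective_of_approx fun y hy => ?_⟩
  · rintro γ ⟨y, hy⟩
    have hy0 : y ≠ 0 := by
      rintro rfl
      simp at hy
    obtain ⟨c, hc0, hc⟩ := key y hy0
    obtain ⟨g, -, hg⟩ := withTop_map_val_eq_coe E.ι hc0
    refine ⟨g, WithTop.coe_injective ?_⟩
    rw [← hy, ← hg, ← E.v_algebraMap_eq, val_eq_of_lt_sub hc]
  · have hy0 : y ≠ 0 := by
      rintro rfl
      simp at hy
    obtain ⟨c, -, hc⟩ := key y hy0
    exact ⟨c, by rwa [hy] at hc⟩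

end Criteria

/-! ### The criterion for value-transcendental extensions; values of expansions as minima -/

section Criteria

theorem zmultiples_nontorsion {G H : Type*} [AddCommGroup G] [AddCommGroup H] {ι : G →+ H} {α : H}
    (hα : ∀ n : ℕ, 0 < n → n • α ∉ ι.range) {n : ℤ} (hn : n • α ∈ ι.range) : n = 0 := by
  by_contra h0
  refine hα n.natAbs (Int.natAbs_pos.2 h0) ?_
  rcases Int.natAbs_eq n with h | h
  · rwa [h, natCast_zsmul] at hn
  · rw [h, neg_smul, natCast_zsmul] at hn
    simpa using neg_mem hn

theorem rank_tensorProduct_eq_one {Q : Type*} [AddCommGroup Q] (φ : ℤ →+ Q)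
    (hφ : Function.Bijective φ) : Module.rank ℚ (TensorProduct ℤ ℚ Q) = 1 := by
  let e : ℤ ≃ₗ[ℤ] Q := (AddEquiv.ofBijective φ hφ).toIntLinearEquiv
  let e' : TensorProduct ℤ ℚ Q ≃ₗ[ℚ] ℚ :=
    (TensorProduct.AlgebraTensorModule.congr (LinearEquiv.refl ℚ ℚ) e.symm).trans
      (TensorProduct.AlgebraTensorModule.rid ℤ ℚ ℚ)
  rw [Module.rank_eq_one_iff_finrank_eq_one, e'.finrank_eq, Module.finrank_self]

variable {K : Type u} [Field K] {Γ : Type v} [AddCommGroup Γ] [LinearOrder Γ]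
  [IsOrderedAddMonoid Γ] {v₀ : AddValuation K (WithTop Γ)}
  (E : Extension.{u, v, w, u} v₀ (RatFunc K)) {f : K[X]} {α : E.Γ'}

/-- Every nonzero rational function agrees to leading order with some `c fⁿ`. Hence the quotient of
value groups is infinite cyclic, generated by the class of `α`. Value `0` forces `n = 0`, so the
residue field does not grow at all. -/
theorem Extension.isValueTranscendental_of_approx (hf : f.Monic) (hd : 0 < f.natDegree)
    (hα : E.polyVal f = α) (hα' : ∀ n : ℕ, 0 < n → n • α ∉ E.ι.range)
    (hres : ∀ g : K[X], g.natDegree < f.natDegree → g ≠ 0 →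
      ∃ c : K, E.polyVal g < E.polyVal (g - C c)) : E.IsValueTranscendental := by
  have hF : algebraMap K[X] (RatFunc K) f ≠ 0 := by simpa using hf.ne_zero
  have key : ∀ y : RatFunc K, y ≠ 0 → ∃ (c : K) (n : ℤ), c ≠ 0 ∧
      E.v y < E.v (y - algebraMap K (RatFunc K) c * algebraMap K[X] (RatFunc K) f ^ n) := by
    intro y hy
    obtain ⟨s, ⟨c, n, hc, hs⟩, h1⟩ := E.exists_approx_div
      (S := (monomialUnits hf.ne_zero).toSubmonoid) (fun p hp => by
        obtain ⟨c, n, hc0, hc⟩ := E.exists_approx_monomial hf hd hα hα' hres p hp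
        have hc' : algebraMap K (RatFunc K) c ≠ 0 := by simpa using hc0
        refine ⟨Units.mk0 _ (mul_ne_zero hc' (zpow_ne_zero n hF)), ⟨c, n, hc0, rfl⟩, ?_⟩
        rw [E.polyVal_apply, E.polyVal_apply, map_sub, map_mul, map_pow] at hc
        rw [Units.val_mk0, zpow_natCast]
        exact hc) (fun s hs => Subgroup.inv_mem _ hs) y hy
    exact ⟨c, n, hc, by rwa [hs] at h1⟩
  have hzpow : ∀ n : ℤ, E.v (algebraMap K[X] (RatFunc K) f ^ n) =
      ((n • α : E.Γ') : WithTop E.Γ') := by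
    have hpow : ∀ n : ℕ, E.v (algebraMap K[X] (RatFunc K) f ^ n) =
        ((n • α : E.Γ') : WithTop E.Γ') := by
      intro n
      rw [AddValuation.map_pow, ← E.polyVal_apply, hα]
      norm_cast
    intro n
    rcases Int.eq_nat_or_neg n with ⟨m, rfl | rfl⟩
    · simpa using hpow m
    · have h1 := val_inv_add (V := E.v) (pow_ne_zero m hF)
      rw [hpow] at h1
      rw [zpow_neg, zpow_natCast]
      cases hx : E.v (algebraMap K[X] (RatFunc K) f ^ m)⁻¹ with
      | top => rw [hx] at h1; simp at h1
      | coe x =>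
        rw [hx] at h1
        have h2 : x + m • α = 0 := by exact_mod_cast h1
        rw [eq_neg_of_add_eq_zero_left h2, neg_smul, natCast_zsmul]
  have hval : ∀ (c : K) (n : ℤ), c ≠ 0 → ∃ γ : valueGroup v₀, val v₀ c = γ ∧
      E.v (algebraMap K (RatFunc K) c * algebraMap K[X] (RatFunc K) f ^ n) =
        ((E.ι γ + n • α : E.Γ') : WithTop E.Γ') := by
    intro c n hc
    obtain ⟨γ, h1, hγ⟩ := withTop_map_val_eq_coe E.ι hc
    refine ⟨γ, h1, ?_⟩
    rw [AddValuation.map_mul, hzpow, E.v_algebraMap_eq, hγ]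
    norm_cast
  unfold Extension.IsValueTranscendental
  constructor
  · let a : valueGroup E.v := ⟨α, algebraMap K[X] (RatFunc K) f, by rw [← E.polyVal_apply, hα]⟩
    refine rank_tensorProduct_eq_one
      (zmultiplesHom E.ValueQuotient (QuotientAddGroup.mk a)) ⟨?_, ?_⟩
    · rw [injective_iff_map_eq_zero]
      intro n hn
      rw [zmultiplesHom_apply, ← QuotientAddGroup.mk_zsmul, QuotientAddGroup.eq_zero_iff] at hn
      exact zmultiples_nontorsion hα' hn
    · intro x
      induction x using QuotientAddGroup.induction_on with
      | H x =>
        obtain ⟨γ, y, hy⟩ := x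
        have hy0 : y ≠ 0 := by
          rintro rfl
          simp at hy
        obtain ⟨c, n, hc, h1⟩ := key y hy0
        obtain ⟨δ, -, hδ⟩ := hval c n hc
        have h2 := val_eq_of_lt_sub h1
        rw [hδ, hy] at h2
        refine ⟨n, ?_⟩
        rw [zmultiplesHom_apply, ← QuotientAddGroup.mk_zsmul, QuotientAddGroup.eq]
        refine ⟨δ, ?_⟩
        have h3 : E.ι δ + n • α = γ := WithTop.coe_injective h2
        change E.ι δ = -(n • α) + γ
        rw [← h3]
        abel
  · have hs : Function.Surjective E.residueMap := by
      refine E.residueMap_surjective_of_approx fun y hy => ?_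
      have hy0 : y ≠ 0 := by
        rintro rfl
        simp at hy
      obtain ⟨c, n, hc, h1⟩ := key y hy0
      obtain ⟨δ, -, hδ⟩ := hval c n hc
      have h2 := val_eq_of_lt_sub h1
      rw [hδ, hy] at h2
      have h3 : E.ι δ + n • α = 0 := WithTop.coe_injective h2
      have h4 : n = 0 := by
        refine zmultiples_nontorsion hα' ⟨-δ, ?_⟩
        rw [map_neg, eq_comm, eq_neg_iff_add_eq_zero, add_comm, h3]
      refine ⟨c, ?_⟩
      rw [hy, h4] at h1
      simpa using h1
    let _ : Algebra (resField v₀) (resField E.v) := E.residueMap.toAlgebra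
    constructor
    intro x
    obtain ⟨a, rfl⟩ := hs x
    exact isAlgebraic_algebraMap a

/-- A lower bound property for the `f`-adic expansion of values. -/
theorem Extension.polyVal_comp_le (hd : 0 < f.natDegree)
    (hα : E.polyVal f = α) (hle : ∀ g q : K[X], g.natDegree < f.natDegree →
      E.polyVal (g + q * f) ≤ E.polyVal g) (i : ℕ) (P : K[X]) :
    E.polyVal (P.comp f) ≤ E.polyVal (C (P.coeff i)) + ((i • α : E.Γ') : WithTop E.Γ') := by
  induction i generalizing P with
  | zero =>
    rw [zero_smul, WithTop.coe_zero, add_zero]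
    conv_lhs => rw [← divX_mul_X_add P]
    rw [add_comp, mul_comp, X_comp, C_comp, add_comm]
    exact hle _ _ (by simpa using hd)
  | succ i ih =>
    have h1 : E.polyVal (P.comp f) ≤ E.polyVal (C (P.coeff 0)) := by
      conv_lhs => rw [← divX_mul_X_add P]
      rw [add_comp, mul_comp, X_comp, C_comp, add_comm]
      exact hle _ _ (by simpa using hd)
    have h2 : (P.divX).comp f * f = P.comp f - C (P.coeff 0) := by
      conv_rhs => rw [← divX_mul_X_add P]
      simp [add_comp]
    have h3 : E.polyVal (P.comp f) ≤ E.polyVal (P.divX.comp f * f) := by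
      rw [h2]
      exact AddValuation.map_le_sub _ le_rfl h1
    refine h3.trans ?_
    rw [AddValuation.map_mul, hα]
    refine (add_le_add_left (ih P.divX) _).trans (le_of_eq ?_)
    rw [coeff_divX, succ_nsmul, WithTop.coe_add, add_assoc]

/-- The one-sided bound `hle` suffices: subtracting `g` turns it into a bound by the value of `q *
f`. -/
theorem Extension.polyVal_eq_min (hle : ∀ g q : K[X], g.natDegree < f.natDegree →
      E.polyVal (g + q * f) ≤ E.polyVal g) {g : K[X]} (q : K[X]) (hg : g.natDegree < f.natDegree) :
    E.polyVal (g + q * f) = min (E.polyVal g) (E.polyVal (q * f)) := by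
  apply le_antisymm
  · refine le_min (hle g q hg) ?_
    have := AddValuation.map_sub E.polyVal (g + q * f) g
    rw [add_sub_cancel_left] at this
    rwa [min_eq_left (hle g q hg)] at this
  · exact AddValuation.map_add _ _ _

end Criteria

/-! ### The criterion for residue-transcendental extensions -/

section ResidueTranscendental

/-- Each `x` is a root of the linear polynomial `q X - p` over `k[t]`, so `t` alone is a
transcendence basis. -/
theorem trdeg_eq_one_of_transcendental {k F : Type u} [Field k] [Field F] [Algebra k F] {t : F}
    (ht : Transcendental k t)
    (h : ∀ x : F, ∃ p ∈ Algebra.adjoin k {t}, ∃ q ∈ Algebra.adjoin k {t}, q ≠ 0 ∧ x * q = p) :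
    Algebra.trdeg k F = 1 := by
  have hi : AlgebraicIndependent k (fun _ : PUnit.{u + 1} => t) :=
    algebraicIndependent_unique_type_iff.2 ht
  have hb : IsTranscendenceBasis k (fun _ : PUnit.{u + 1} => t) := by
    rw [hi.isTranscendenceBasis_iff_isAlgebraic, Set.range_const]
    constructor
    intro x
    obtain ⟨p, hp, q, hq, hq0, hx⟩ := h x
    refine ⟨C ⟨q, hq⟩ * X - C ⟨p, hp⟩, fun h0 => ?_, ?_⟩
    · have := congrArg (fun r => coeff r 1) h0
      simp [coeff_C] at this
      exact hq0 (congrArg Subtype.val this)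
    · have h1 : (algebraMap (Algebra.adjoin k {t}) F ⟨q, hq⟩) * x =
        algebraMap (Algebra.adjoin k {t}) F ⟨p, hp⟩ := by
        change q * x = p
        rw [mul_comm, hx]
      simp only [map_sub, map_mul, aeval_C, aeval_X, h1, sub_self]
  rw [← hb.cardinalMk_eq_trdeg]
  simp

theorem algebraMap_num_eq {K : Type*} [Field K] (y : RatFunc K) :
    algebraMap K[X] (RatFunc K) y.num = y * algebraMap K[X] (RatFunc K) y.denom := by
  have hden : algebraMap K[X] (RatFunc K) y.denom ≠ 0 := by simpa using y.denom_ne_zero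
  rw [← div_eq_iff hden, RatFunc.num_div_denom]

variable {K : Type u} [Field K] {Γ : Type v} [AddCommGroup Γ] [LinearOrder Γ]
  [IsOrderedAddMonoid Γ] {v₀ : AddValuation K (WithTop Γ)}
  (E : Extension.{u, v, w, u} v₀ (RatFunc K)) {f : K[X]}

/-- The residue of a polynomial of nonnegative value. -/
noncomputable def Extension.polyRes (p : K[X]) (hp : 0 ≤ E.polyVal p) : resField E.v :=
  IsLocalRing.residue (valuationRing E.v) ⟨algebraMap K[X] (RatFunc K) p, hp⟩

theorem Extension.polyRes_add {p q : K[X]} (hp : 0 ≤ E.polyVal p) (hq : 0 ≤ E.polyVal q)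
    (hpq : 0 ≤ E.polyVal (p + q)) : E.polyRes (p + q) hpq = E.polyRes p hp + E.polyRes q hq := by
  unfold Extension.polyRes
  rw [← map_add]
  congr 1
  exact Subtype.ext (map_add _ _ _)

theorem Extension.polyRes_mul {p q : K[X]} (hp : 0 ≤ E.polyVal p) (hq : 0 ≤ E.polyVal q)
    (hpq : 0 ≤ E.polyVal (p * q)) : E.polyRes (p * q) hpq = E.polyRes p hp * E.polyRes q hq := by
  unfold Extension.polyRes
  rw [← map_mul]
  congr 1
  exact Subtype.ext (map_mul _ _ _)

theorem Extension.polyRes_congr {p q : K[X]} (h : p = q) (hp : 0 ≤ E.polyVal p)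
    (hq : 0 ≤ E.polyVal q) : E.polyRes p hp = E.polyRes q hq := by
  subst h; rfl

theorem Extension.polyRes_mem_range {g : K[X]} (hg : 0 ≤ E.polyVal g)
    (h : g ≠ 0 → ∃ c : K, E.polyVal g < E.polyVal (g - C c)) :
    ∃ x, E.residueMap x = E.polyRes g hg := by
  by_cases h0 : 0 < E.polyVal g
  · refine ⟨0, ?_⟩
    rw [map_zero]
    exact ((residue_eq_zero_iff' _).2 h0).symm
  have h1 : E.polyVal g = 0 := le_antisymm (not_lt.1 h0) hg
  obtain ⟨c, hc⟩ := h (by rintro rfl; simp at h1)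
  have h2 : 0 ≤ E.v (algebraMap K (RatFunc K) c) := by
    have := val_eq_of_lt_sub hc
    rw [h1] at this
    exact this.ge
  refine ⟨_, E.residueMap_eq (c := c) hg (nonneg_of_map_nonneg E h2) ?_⟩
  rw [h1, E.polyVal_apply, map_sub] at hc
  exact hc

variable {a : K}

theorem Extension.polyVal_mul_C_inv (ha : a ≠ 0) (hα : E.polyVal f = E.polyVal (C a)) :
    E.polyVal (f * C a⁻¹) = 0 := by
  rw [AddValuation.map_mul, hα, ← AddValuation.map_mul, ← C_mul, mul_inv_cancel₀ ha, C_1,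
    AddValuation.map_one]

/-- In `g + q f` the remainder contributes a residue coming from `K`, and `q f` contributes the
residue of `a q` times that of `f / a`. Both summands have nonnegative value because the value of
the sum is their minimum. -/
theorem Extension.polyRes_mem_adjoin (hf : f.Monic) (hd : 0 < f.natDegree)
    (ha : a ≠ 0) (hα : E.polyVal f = E.polyVal (C a))
    (hle : ∀ g q : K[X], g.natDegree < f.natDegree → E.polyVal (g + q * f) ≤ E.polyVal g)
    (hres : ∀ g : K[X], g.natDegree < f.natDegree → g ≠ 0 →
      ∃ c : K, E.polyVal g < E.polyVal (g - C c))
    (S : Subring (resField E.v)) (hS : ∀ x, E.residueMap x ∈ S)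
    (ht : E.polyRes (f * C a⁻¹) (E.polyVal_mul_C_inv ha hα).ge ∈ S) (p : K[X])
    (hp : 0 ≤ E.polyVal p) : E.polyRes p hp ∈ S := by
  -- The scalar `b` is needed for the induction: `q` itself may have negative value, and each step
  -- multiplies the scalar by `a`.
  suffices H : ∀ (b : K) (hb : 0 ≤ E.polyVal (C b * p)), E.polyRes (C b * p) hb ∈ S by
    rw [E.polyRes_congr (show p = C 1 * p by simp) hp (by simpa using hp)]
    exact H 1 _
  refine expansion_induction hf hd (P := fun p => ∀ (b : K) (hb : 0 ≤ E.polyVal (C b * p)),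
    E.polyRes (C b * p) hb ∈ S) (fun g hg b hb => ?_) (fun g q hg h0 ih b hb => ?_) p
  · have hbg : (C b * g).natDegree < f.natDegree := (natDegree_C_mul_le b g).trans_lt hg
    obtain ⟨x, hx⟩ := E.polyRes_mem_range hb (hres _ hbg)
    exact hx ▸ hS x
  · have hbg : (C b * g).natDegree < f.natDegree := (natDegree_C_mul_le b g).trans_lt hg
    have e1 : C b * (g + q * f) = C b * g + C b * q * f := by ring
    have h1 := E.polyVal_eq_min hle (C b * q) hbg
    rw [← e1] at h1
    have h2 : 0 ≤ E.polyVal (C b * g) := by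
      rw [h1] at hb
      exact hb.trans (min_le_left _ _)
    have h3 : 0 ≤ E.polyVal (C b * q * f) := by
      rw [h1] at hb
      exact hb.trans (min_le_right _ _)
    have h4 : 0 ≤ E.polyVal (C (b * a) * q) := by
      rw [C_mul, mul_right_comm, AddValuation.map_mul _ _ (C a), ← hα, ← AddValuation.map_mul]
      exact h3
    have e2 : C b * q * f = C (b * a) * q * (f * C a⁻¹) := by
      rw [C_mul]
      have : C a * C a⁻¹ = 1 := by rw [← C_mul, mul_inv_cancel₀ ha, C_1]
      linear_combination -C b * q * f * this
    rw [E.polyRes_congr e1 hb (e1 ▸ hb), E.polyRes_add h2 h3, E.polyRes_congr e2 h3 (e2 ▸ h3),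
      E.polyRes_mul h4 (E.polyVal_mul_C_inv ha hα).ge]
    refine S.add_mem ?_ (S.mul_mem (ih _ h4) ht)
    obtain ⟨x, hx⟩ := E.polyRes_mem_range h2 (hres _ hbg)
    exact hx ▸ hS x

/-- Lift `P` to the valuation ring; a coefficient with nonzero residue has value `0`. By
`polyVal_comp_le` the value of the lift at `f / a` is at most that of its `i`-th term, which is `0`
because the powers of `a` cancel those of `f`. So the residue is not zero. -/
theorem Extension.transcendental_polyRes (hd : 0 < f.natDegree)
    (ha : a ≠ 0) (hα : E.polyVal f = E.polyVal (C a))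
    (hle : ∀ g q : K[X], g.natDegree < f.natDegree → E.polyVal (g + q * f) ≤ E.polyVal g)
    (P : (resField v₀)[X]) (hP : P ≠ 0) :
    P.eval₂ E.residueMap (E.polyRes (f * C a⁻¹) (E.polyVal_mul_C_inv ha hα).ge) ≠ 0 := by
  intro h0
  obtain ⟨Q, rfl⟩ := Polynomial.map_surjective _
    (IsLocalRing.residue_surjective (R := valuationRing v₀)) P
  obtain ⟨i, hi⟩ : ∃ i, (Q.map (IsLocalRing.residue (valuationRing v₀))).coeff i ≠ 0 := by
    by_contra! h
    exact hP (Polynomial.ext h)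
  rw [coeff_map, Ne, residue_eq_zero_iff'] at hi
  have hi0 : v₀ (Q.coeff i : K) = 0 := le_antisymm (not_lt.1 hi) (Q.coeff i).2
  have hcomp : (E.residueMap).comp (IsLocalRing.residue (valuationRing v₀)) =
    (IsLocalRing.residue (valuationRing E.v)).comp E.ringMap := rfl
  rw [eval₂_map, hcomp, Extension.polyRes, ← hom_eval₂, residue_eq_zero_iff'] at h0
  set Q' : K[X] := Q.map (valuationRing v₀).subtype with hQ'
  have h1 : ((eval₂ E.ringMap ⟨algebraMap K[X] (RatFunc K) (f * C a⁻¹),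
      (E.polyVal_mul_C_inv ha hα).ge⟩ Q : valuationRing E.v) : RatFunc K) =
      algebraMap K[X] (RatFunc K) ((Q'.comp (C a⁻¹ * X)).comp f) := by
    change (valuationRing E.v).subtype _ = _
    rw [hom_eval₂, comp_assoc, mul_comp, C_comp, X_comp, hQ', comp, eval₂_map, hom_eval₂,
      mul_comm (C a⁻¹)]
    rfl
  rw [h1] at h0
  have haα : ∃ γ : E.Γ', E.polyVal f = γ ∧ E.polyVal (C a⁻¹) = ((-γ : E.Γ') : WithTop E.Γ') := by
    have h2 := E.polyVal_mul_C_inv ha hα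
    rw [AddValuation.map_mul] at h2
    cases hx : E.polyVal f with
    | top => rw [hx] at h2; simp at h2
    | coe x =>
      cases hy : E.polyVal (C a⁻¹) with
      | top => rw [hy] at h2; simp at h2
      | coe y =>
        rw [hx, hy] at h2
        have h3 : x + y = 0 := by exact_mod_cast h2
        exact ⟨x, rfl, by rw [eq_neg_of_add_eq_zero_right h3]⟩
  obtain ⟨γ, hγ, hγ'⟩ := haα
  have h2 := E.polyVal_comp_le hd hγ hle i (Q'.comp (C a⁻¹ * X))
  have h3 : E.polyVal (C (Q'.coeff i)) = 0 := by
    have h4 := withTop_subtype_map_injective v₀ (a₁ := val v₀ (Q'.coeff i)) (a₂ := 0) (by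
      rw [map_val, hQ', coeff_map]
      refine Eq.trans ?_ (withTop_map_zero (valueGroup v₀).subtype).symm
      exact hi0)
    rw [E.polyVal_C, h4, withTop_map_zero]
  rw [comp_C_mul_X_coeff, C_mul, AddValuation.map_mul, h3, C_pow, AddValuation.map_pow, hγ',
    zero_add] at h2
  have h5 : i • ((-γ : E.Γ') : WithTop E.Γ') + ((i • γ : E.Γ') : WithTop E.Γ') = 0 := by
    have h6 : i • (-γ) + i • γ = 0 := by simp
    exact_mod_cast h6
  rw [h5] at h2
  exact absurd h0 (not_lt.2 h2)

theorem Extension.exists_polyVal_eq_of_le (hf : f.Monic) (hd : 0 < f.natDegree)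
    (hα : E.polyVal f = E.polyVal (C a))
    (hle : ∀ g q : K[X], g.natDegree < f.natDegree → E.polyVal (g + q * f) ≤ E.polyVal g)
    (hres : ∀ g : K[X], g.natDegree < f.natDegree → g ≠ 0 →
      ∃ c : K, E.polyVal g < E.polyVal (g - C c)) (p : K[X]) :
    ∃ c : K, E.polyVal p = E.polyVal (C c) := by
  have hbase : ∀ g : K[X], g.natDegree < f.natDegree → ∃ c : K, E.polyVal g = E.polyVal (C c) := by
    intro g hg
    by_cases h0 : g = 0
    · exact ⟨0, by simp [h0]⟩
    · obtain ⟨c, hc⟩ := hres g hg h0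
      exact ⟨c, (val_eq_of_lt_sub hc).symm⟩
  refine expansion_induction hf hd (P := fun p => ∃ c : K, E.polyVal p = E.polyVal (C c))
    hbase (fun g q hg h0 ih => ?_) p
  rw [E.polyVal_eq_min hle q hg]
  rcases min_choice (E.polyVal g) (E.polyVal (q * f)) with h | h
  · rw [h]; exact hbase g hg
  · rw [h]
    obtain ⟨c, hc⟩ := ih
    exact ⟨c * a, by rw [AddValuation.map_mul, hc, hα, ← AddValuation.map_mul, C_mul]⟩

/-- Every polynomial has the value of a constant, so the quotient of value groups vanishes. Scaling
numerator and denominator by the constant belonging to the denominator makes every nonzero residue a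
quotient of two polynomials in the residue of `f / a`. -/
theorem Extension.isResidueTranscendental_of_le (hf : f.Monic) (hd : 0 < f.natDegree)
    (ha : a ≠ 0) (hα : E.polyVal f = E.polyVal (C a))
    (hle : ∀ g q : K[X], g.natDegree < f.natDegree → E.polyVal (g + q * f) ≤ E.polyVal g)
    (hres : ∀ g : K[X], g.natDegree < f.natDegree → g ≠ 0 →
      ∃ c : K, E.polyVal g < E.polyVal (g - C c)) : E.IsResidueTranscendental := by
  have hval := E.exists_polyVal_eq_of_le hf hd hα hle hres
  unfold Extension.IsResidueTranscendental
  constructor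
  · let _ : Algebra (resField v₀) (resField E.v) := E.residueMap.toAlgebra
    refine trdeg_eq_one_of_transcendental
      (t := E.polyRes (f * C a⁻¹) (E.polyVal_mul_C_inv ha hα).ge) ?_ ?_
    · rintro ⟨P, hP, h0⟩
      exact E.transcendental_polyRes hd ha hα hle P hP h0
    · intro x
      have hmem := E.polyRes_mem_adjoin hf hd ha hα hle hres
        (Algebra.adjoin (resField v₀)
          {E.polyRes (f * C a⁻¹) (E.polyVal_mul_C_inv ha hα).ge}).toSubring
        (fun x => Subalgebra.algebraMap_mem _ x)
        (Algebra.subset_adjoin (Set.mem_singleton _))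
      by_cases hx : x = 0
      · exact ⟨0, Subalgebra.zero_mem _, 1, Subalgebra.one_mem _, one_ne_zero, by simp [hx]⟩
      obtain ⟨y, hy, hy0, hyne, rfl⟩ := E.exists_residue_eq hx
      have hnd := algebraMap_num_eq y
      obtain ⟨c, hc⟩ := hval y.denom
      have hc0 : c ≠ 0 := by
        rintro rfl
        rw [C_0, AddValuation.map_zero, E.polyVal_eq_top] at hc
        exact y.denom_ne_zero hc
      have hq := E.polyVal_mul_C_inv hc0 hc
      have hp : E.polyVal (y.num * C c⁻¹) = 0 := by
        rw [AddValuation.map_mul] at hq ⊢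
        rw [E.polyVal_apply y.num, hnd, AddValuation.map_mul, hy0, zero_add]
        exact hq
      refine ⟨E.polyRes _ hp.ge, hmem _ _, E.polyRes _ hq.ge, hmem _ _, ?_, ?_⟩
      · intro h0
        have h1 : 0 < E.polyVal (y.denom * C c⁻¹) := (residue_eq_zero_iff' _).1 h0
        rw [hq] at h1
        exact lt_irrefl _ h1
      · unfold Extension.polyRes
        rw [← map_mul]
        congr 1
        apply Subtype.ext
        change y * algebraMap K[X] (RatFunc K) (y.denom * C c⁻¹) =
          algebraMap K[X] (RatFunc K) (y.num * C c⁻¹)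
        rw [map_mul, map_mul, hnd, mul_assoc]
  · intro x
    suffices hx : x = 0 by
      rw [hx]
      exact IsOfFinAddOrder.zero
    induction x using QuotientAddGroup.induction_on with
    | H x =>
      obtain ⟨γ, y, hy⟩ := x
      rw [QuotientAddGroup.eq_zero_iff]
      have hy0 : y ≠ 0 := by
        rintro rfl
        simp at hy
      obtain ⟨c, hc⟩ := hval y.num
      obtain ⟨d, hd⟩ := hval y.denom
      have hc0 : c ≠ 0 := by
        rintro rfl
        rw [C_0, AddValuation.map_zero, E.polyVal_eq_top] at hc
        exact RatFunc.num_ne_zero hy0 hc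
      have hd0 : d ≠ 0 := by
        rintro rfl
        rw [C_0, AddValuation.map_zero, E.polyVal_eq_top] at hd
        exact y.denom_ne_zero hd
      have h1 : E.v y + E.polyVal y.denom = E.polyVal y.num := by
        rw [E.polyVal_apply, E.polyVal_apply, ← AddValuation.map_mul, algebraMap_num_eq]
      obtain ⟨s, -, hs⟩ := withTop_map_val_eq_coe E.ι hc0
      obtain ⟨t, -, ht⟩ := withTop_map_val_eq_coe E.ι hd0
      rw [hy, hc, hd, E.polyVal_C, E.polyVal_C, hs, ht] at h1
      have h2 : γ + E.ι t = E.ι s := by exact_mod_cast h1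
      refine ⟨s - t, ?_⟩
      change E.ι (s - t) = γ
      rw [map_sub, ← h2, add_sub_cancel_right]

end ResidueTranscendental

/-! ### Filling cuts in ordered abelian groups -/

section Cuts

/-- Every cut in an ordered abelian group is filled by a non-torsion element of an extension. -/
theorem exists_nontorsion_of_cut {G : Type v} [AddCommGroup G] [LinearOrder G]
    [IsOrderedAddMonoid G] (S : Set G) (hS : IsLowerSet S) :
    ∃ (Γ' : Type v) (_ : AddCommGroup Γ') (_ : LinearOrder Γ') (_ : IsOrderedAddMonoid Γ')
      (ι : G →+ Γ') (α : Γ'), StrictMono ι ∧ (∀ n : ℕ, 0 < n → n • α ∉ ι.range) ∧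
      ∀ γ : G, (γ ∈ S → ι γ < α) ∧ (γ ∉ S → α < ι γ) := by
  rcases S.eq_empty_or_nonempty with rfl | hne
  -- Here `α` has to lie below all of `G`: a new leading coordinate `-1` achieves this.
  · refine ⟨ℤ ×ₗ G, inferInstance, inferInstance, inferInstance,
      { toFun := fun γ => toLex (0, γ), map_zero' := rfl,
        map_add' := fun a b => by rw [← toLex_add]; simp }, toLex (-1, 0), ?_, ?_, ?_⟩
    · intro a b h
      exact Prod.Lex.toLex_lt_toLex.2 (Or.inr ⟨rfl, h⟩)
    · rintro n hn ⟨γ, h⟩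
      have h1 : (0 : ℤ) = n • (-1 : ℤ) := congrArg (fun x => (ofLex x).1) h
      simp at h1
      omega
    · intro γ
      refine ⟨fun h => absurd h (Set.notMem_empty γ), fun _ => ?_⟩
      exact Prod.Lex.toLex_lt_toLex.2 (Or.inl (by norm_num))
  · have : Nonempty S := hne.to_subtype
    -- In the ultrapower, the germ of the inclusion `S → G` along an ultrafilter refining `atTop` is
    -- at least every element of `S` and smaller than every element outside `S`.
    let U : Ultrafilter S := Ultrafilter.of Filter.atTop
    have hU : (U : Filter S) ≤ Filter.atTop := Ultrafilter.of_le _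
    refine ⟨Filter.Germ (U : Filter S) G ×ₗ ℤ, inferInstance, inferInstance, inferInstance,
      { toFun := fun γ => toLex ((γ : Filter.Germ (U : Filter S) G), 0), map_zero' := rfl,
        map_add' := fun a b => by rw [← toLex_add]; simp; rfl },
      -- The infinitesimal coordinate `1` makes `α` non-torsion, and makes the first inequality
      -- strict if `S` has a largest element.
      toLex (((Subtype.val : S → G) : Filter.Germ (U : Filter S) G), 1), ?_, ?_, ?_⟩
    · intro a b h
      exact Prod.Lex.toLex_lt_toLex.2 (Or.inl (Filter.Germ.const_lt h))
    · rintro n hn ⟨γ, h⟩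
      have h1 : (0 : ℤ) = n • (1 : ℤ) := congrArg (fun x => (ofLex x).2) h
      simp at h1
      omega
    · intro γ
      constructor
      · intro h
        have h1 : (γ : Filter.Germ (U : Filter S) G) ≤
            ((Subtype.val : S → G) : Filter.Germ (U : Filter S) G) :=
          Filter.Germ.coe_le.2 (hU (Filter.eventually_ge_atTop (⟨γ, h⟩ : S)))
        rcases h1.lt_or_eq with h2 | h2
        · exact Prod.Lex.toLex_lt_toLex.2 (Or.inl h2)
        · exact Prod.Lex.toLex_lt_toLex.2 (Or.inr ⟨h2, by norm_num⟩)
      · intro h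
        have h1 : ((Subtype.val : S → G) : Filter.Germ (U : Filter S) G) <
            (γ : Filter.Germ (U : Filter S) G) :=
          Filter.Germ.coe_lt.2 (Filter.Eventually.of_forall fun s =>
            lt_of_not_ge fun hs => h (hS hs s.2))
        exact Prod.Lex.toLex_lt_toLex.2 (Or.inl h1)

end Cuts

/-! ### Equivalence of extensions as equality of the comparison relations -/

section Equivalence

variable {K : Type u} [Field K] {Γ : Type v} [AddCommGroup Γ] [LinearOrder Γ]
  [IsOrderedAddMonoid Γ] {v₀ : AddValuation K (WithTop Γ)}

theorem withTop_add_le_add_iff {H : Type*} [AddCommGroup H] [LinearOrder H] [IsOrderedAddMonoid H]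
    {x y z : WithTop H} (hz : z ≠ ⊤) : x + z ≤ y + z ↔ x ≤ y :=
  WithTop.add_le_add_iff_right hz

theorem Extension.le_iff_of_polyVal (E : Extension.{u, v, w, u} v₀ (RatFunc K))
    (y z : RatFunc K) : E.v y ≤ E.v z ↔
      E.polyVal (y.num * z.denom) ≤ E.polyVal (z.num * y.denom) := by
  have hy : E.v (algebraMap K[X] (RatFunc K) y.denom) ≠ ⊤ := by
    rw [← E.polyVal_apply, Ne, E.polyVal_eq_top]; exact y.denom_ne_zero
  have hz : E.v (algebraMap K[X] (RatFunc K) z.denom) ≠ ⊤ := by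
    rw [← E.polyVal_apply, Ne, E.polyVal_eq_top]; exact z.denom_ne_zero
  rw [E.polyVal_apply, E.polyVal_apply, map_mul (algebraMap K[X] (RatFunc K)),
    map_mul (algebraMap K[X] (RatFunc K)), algebraMap_num_eq, algebraMap_num_eq,
    AddValuation.map_mul, AddValuation.map_mul, AddValuation.map_mul, AddValuation.map_mul,
    add_right_comm, withTop_add_le_add_iff hy, withTop_add_le_add_iff hz]

/-- The comparison relation determines when two values are equal, so sending `E.v y` to `E'.v y` is
well defined, additive and order preserving. Evaluating at constants shows that it fixes the value
group of `v₀`. -/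
theorem Extension.equivOver_of_le_iff {L : Type u₁} [Field L] [Algebra K L]
    {E : Extension.{u, v, w, u₁} v₀ L} {E' : Extension.{u, v, w', u₁} v₀ L}
    (h : ∀ y z, E.v y ≤ E.v z ↔ E'.v y ≤ E'.v z) : E.EquivOver E' := by
  have heq : ∀ y z, E.v y = E.v z ↔ E'.v y = E'.v z := fun y z => by
    rw [le_antisymm_iff, le_antisymm_iff, h y z, h z y]
  have hex : ∀ γ : valueGroup E.v, ∃ γ' : valueGroup E'.v, ∀ y, E.v y = ((γ : E.Γ') : WithTop E.Γ')
      → E'.v y = ((γ' : E'.Γ') : WithTop E'.Γ') := by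
    rintro ⟨γ, y, hy⟩
    cases hx : E'.v y with
    | top =>
      have : y = 0 := (AddValuation.top_iff _).1 hx
      rw [this] at hy
      simp at hy
    | coe x => exact ⟨⟨x, y, hx⟩, fun z hz => by rw [← hx, ← heq, hz, hy]⟩
  have hex' : ∀ γ' : valueGroup E'.v, ∃ γ : valueGroup E.v,
      ∀ y, E'.v y = ((γ' : E'.Γ') : WithTop E'.Γ') → E.v y = ((γ : E.Γ') : WithTop E.Γ') := by
    rintro ⟨γ, y, hy⟩
    cases hx : E.v y with
    | top =>
      have : y = 0 := (AddValuation.top_iff _).1 hx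
      rw [this] at hy
      simp at hy
    | coe x => exact ⟨⟨x, y, hx⟩, fun z hz => by rw [← hx, heq, hz, hy]⟩
  choose r hr using hex
  choose s hs using hex'
  refine ⟨{ toFun := r, invFun := s, left_inv := ?_, right_inv := ?_, map_add' := ?_,
            map_le_map_iff' := ?_ }, ?_, ?_⟩
  · intro γ
    obtain ⟨y, hy⟩ := γ.2
    apply Subtype.ext
    apply WithTop.coe_injective
    rw [← hs _ y (hr _ y hy), hy]
  · intro γ
    obtain ⟨y, hy⟩ := γ.2
    apply Subtype.ext
    apply WithTop.coe_injective
    rw [← hr _ y (hs _ y hy), hy]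
  · intro γ δ
    obtain ⟨y, hy⟩ := γ.2
    obtain ⟨z, hz⟩ := δ.2
    apply Subtype.ext
    apply WithTop.coe_injective
    rw [← hr (γ + δ) (y * z) (by rw [AddValuation.map_mul, hy, hz]; norm_cast),
      AddValuation.map_mul, hr γ y hy, hr δ z hz]
    norm_cast
  · intro γ δ
    obtain ⟨y, hy⟩ := γ.2
    obtain ⟨z, hz⟩ := δ.2
    have h1 := h y z
    rw [hy, hz, hr γ y hy, hr δ z hz, WithTop.coe_le_coe, WithTop.coe_le_coe] at h1
    exact h1.symm
  · intro γ g hg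
    obtain ⟨a, ha⟩ := exists_val_eq v₀ g
    have h1 : E.v (algebraMap K L a) = ((E.ι g : E.Γ') : WithTop E.Γ') := by
      rw [E.v_algebraMap_eq, ha]; rfl
    have h2 : E'.v (algebraMap K L a) = ((E'.ι g : E'.Γ') : WithTop E'.Γ') := by
      rw [E'.v_algebraMap_eq, ha]; rfl
    apply WithTop.coe_injective
    rw [← h2]
    exact (hr γ _ (by rw [h1, hg])).symm
  · exact fun y γ hy => hr γ y hy

theorem Extension.le_iff_of_equivOver {L : Type u₁} [Field L] [Algebra K L]
    {E : Extension.{u, v, w, u₁} v₀ L} {E' : Extension.{u, v, w', u₁} v₀ L}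
    (h : E.EquivOver E') (y z : L) : E.v y ≤ E.v z ↔ E'.v y ≤ E'.v z := by
  obtain ⟨ρ, -, hρ⟩ := h
  cases hz : E.v z with
  | top =>
    have : z = 0 := (AddValuation.top_iff _).1 hz
    simp [this]
  | coe c =>
    cases hy : E.v y with
    | top =>
      have h0 : y = 0 := (AddValuation.top_iff _).1 hy
      have h1 := hρ z ⟨c, z, hz⟩ hz
      rw [h0, h1, AddValuation.map_zero]
      simp
    | coe b =>
      rw [hρ z ⟨c, z, hz⟩ hz, hρ y ⟨b, y, hy⟩ hy, WithTop.coe_le_coe, WithTop.coe_le_coe]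
      exact (map_le_map_iff ρ (a := ⟨b, y, hy⟩) (b := ⟨c, z, hz⟩)).symm

/-- The right side uses only comparisons with constants, which an equivalence preserves; this is why
the approximation type is an invariant of the equivalence class. -/
theorem Extension.holds_iff {L : Type u₁} [Field L] [Algebra K L]
    (E : Extension.{u, v, w, u₁} v₀ L) (y : L) (ℓ : BallLabel (valueGroup v₀)) :
    ℓ.Holds E.ι (E.v y) ↔ match ℓ with
      | .closed γ => ∀ a : K, val v₀ a = γ → E.v (algebraMap K L a) ≤ E.v y
      | .op γ => ∀ a : K, val v₀ a = γ → ¬ E.v y ≤ E.v (algebraMap K L a) := by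
  cases ℓ with
  | closed γ =>
    simp only [BallLabel.Holds]
    constructor
    · intro h a ha
      rwa [E.v_algebraMap_eq, ha]
    · intro h
      cases γ with
      | top => simpa using h 0 (by simp)
      | coe γ =>
        obtain ⟨a, ha⟩ := exists_val_eq v₀ γ
        have := h a ha
        rwa [E.v_algebraMap_eq, ha] at this
  | op γ =>
    simp only [BallLabel.Holds]
    constructor
    · intro h a ha
      rw [E.v_algebraMap_eq, ha]
      exact not_le.2 h
    · intro h
      obtain ⟨a, ha⟩ := exists_val_eq v₀ γ
      have := h a ha
      rw [E.v_algebraMap_eq, ha] at this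
      exact not_le.1 this

theorem Extension.appr_eq_of_equivOver {L : Type u₁} [Field L] [Algebra K L]
    {E : Extension.{u, v, w, u₁} v₀ L} {E' : Extension.{u, v, w', u₁} v₀ L}
    (h : E.EquivOver E') (x : L) : E.appr x = E'.appr x := by
  have h1 : E.trace x = E'.trace x := by
    funext ℓ
    ext c
    change ℓ.Holds E.ι _ ↔ ℓ.Holds E'.ι _
    rw [E.holds_iff, E'.holds_iff]
    cases ℓ <;> simp only [Extension.le_iff_of_equivOver h]
  apply ApproxType.ext
  simp only [Extension.appr, h1]

end Equivalence

/-! ### Balls of an approximation type, and the type of the variable -/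

section Balls

variable {K : Type u} [Field K] {Γ : Type v} [AddCommGroup Γ] [LinearOrder Γ]
  [IsOrderedAddMonoid Γ] {v₀ : AddValuation K (WithTop Γ)}

theorem mem_ballSet_iff {ℓ : BallLabel (valueGroup v₀)} {a c : K} :
    a ∈ ballSet v₀ ℓ c ↔ ℓ.Holds id (val v₀ (a - c)) :=
  holds_val v₀ ℓ (a - c)

theorem ballSet_eq_of_mem {ℓ : BallLabel (valueGroup v₀)} {b c : K} (h : b ∈ ballSet v₀ ℓ c) :
    ballSet v₀ ℓ c = ballSet v₀ ℓ b := by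
  rw [← Extension.ballSet_eq_trace_self] at h
  rw [← Extension.trace_eq_ballSet _ h, Extension.ballSet_eq_trace_self]

theorem ballSet_subset {ℓ ℓ' : BallLabel (valueGroup v₀)} (h : ℓ.Wider ℓ') (b : K) :
    ballSet v₀ ℓ' b ⊆ ballSet v₀ ℓ b := by
  rw [← Extension.ballSet_eq_trace_self, ← Extension.ballSet_eq_trace_self]
  exact Extension.trace_mono _ h

theorem mem_ballSet_self (ℓ : BallLabel (valueGroup v₀)) (b : K) : b ∈ ballSet v₀ ℓ b := by
  rw [← Extension.ballSet_eq_trace_self]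
  exact Extension.mem_trace_self b

theorem Ball.carrier_eq {B : Ball v₀} {b : K} (h : b ∈ B.carrier) :
    B.carrier = ballSet v₀ B.label b := by
  obtain ⟨c, hc⟩ := B.exists_center
  rw [hc] at h ⊢
  exact ballSet_eq_of_mem h

theorem Ball.nonempty (B : Ball v₀) : B.carrier.Nonempty := by
  obtain ⟨c, hc⟩ := B.exists_center
  exact ⟨c, hc ▸ mem_ballSet_self _ c⟩

namespace ApproxType

variable {A A' : ApproxType v₀} {ℓ ℓ' : BallLabel (valueGroup v₀)} {a b c : K}

theorem full_of_mem {B : Ball v₀} (h : B ∈ A.balls) : IsFullNest A.balls := by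
  rcases A.empty_or_full with h0 | h0
  · rw [h0] at h
    exact absurd h (Set.notMem_empty B)
  · exact h0

theorem mem_ballAt_iff (hb : b ∈ A.ballAt ℓ) : c ∈ A.ballAt ℓ ↔ ℓ.Holds id (val v₀ (c - b)) := by
  rw [← mem_ballSet_iff]
  obtain ⟨B, hB, rfl, hbB⟩ := hb
  constructor
  · rintro ⟨B', hB', hl, hc⟩
    rcases (full_of_mem hB).1.2 B hB B' hB' with h | h
    · rw [Ball.carrier_eq (h.1 hbB), hl] at hc
      exact hc
    · rw [← Ball.carrier_eq hbB]
      exact h.1 hc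
  · intro h
    exact ⟨B, hB, rfl, by rwa [Ball.carrier_eq hbB]⟩

theorem mem_ballAt_of_wider (h : ℓ.Wider ℓ') (hb : b ∈ A.ballAt ℓ') : b ∈ A.ballAt ℓ := by
  obtain ⟨B, hB, rfl, hbB⟩ := hb
  refine ⟨⟨ℓ, ballSet v₀ ℓ b, b, rfl⟩, (full_of_mem hB).2 B hB _ ⟨?_, h⟩, rfl,
    mem_ballSet_self ℓ b⟩
  rw [Ball.carrier_eq hbB]
  exact ballSet_subset h b

theorem carrier_eq_ballAt {B : Ball v₀} (hB : B ∈ A.balls) : B.carrier = A.ballAt B.label := by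
  obtain ⟨b, hb⟩ := B.nonempty
  ext c
  rw [mem_ballAt_iff (b := b) ⟨B, hB, rfl, hb⟩, Ball.carrier_eq hb, mem_ballSet_iff]

/-- A ball is determined by its label and any one of its points. -/
theorem ext_ballAt (h : ∀ ℓ, A.ballAt ℓ = A'.ballAt ℓ) : A = A' := by
  have key : ∀ A A' : ApproxType v₀, (∀ ℓ, A.ballAt ℓ = A'.ballAt ℓ) → A.balls ⊆ A'.balls := by
    intro A A' h B hB
    obtain ⟨b, hb⟩ := B.nonempty
    have h1 : b ∈ A.ballAt B.label := ⟨B, hB, rfl, hb⟩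
    rw [h] at h1
    obtain ⟨B', hB', hl, hb'⟩ := h1
    have : B = B' := by
      apply Ball.ext hl.symm
      rw [Ball.carrier_eq hb, Ball.carrier_eq hb', hl]
    rwa [this]
  exact ApproxType.ext (Set.Subset.antisymm (key A A' h) (key A' A fun ℓ => (h ℓ).symm))

theorem mem_supp_iff {γ : WithTop (valueGroup v₀)} :
    γ ∈ A.supp ↔ (A.ballAt (.closed γ)).Nonempty := by
  constructor
  · rintro ⟨B, hB, hl⟩
    obtain ⟨b, hb⟩ := B.nonempty
    exact ⟨b, B, hB, hl, hb⟩
  · rintro ⟨b, B, hB, hl, -⟩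
    exact ⟨B, hB, hl⟩

theorem mem_ballAt_of_mem_inter (hb : b ∈ A.inter) (h : (A.ballAt ℓ).Nonempty) :
    b ∈ A.ballAt ℓ := by
  obtain ⟨c, B, hB, hl, -⟩ := h
  exact ⟨B, hB, hl, hb B hB⟩

theorem mem_inter_of_forall (h : ∀ ℓ, (A.ballAt ℓ).Nonempty → b ∈ A.ballAt ℓ) : b ∈ A.inter := by
  intro B hB
  obtain ⟨c, hc⟩ := B.nonempty
  rw [carrier_eq_ballAt hB]
  exact h _ ⟨c, B, hB, rfl, hc⟩

theorem supp_down {γ δ : WithTop (valueGroup v₀)} (h : γ ≤ δ) (hδ : δ ∈ A.supp) : γ ∈ A.supp := by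
  rw [mem_supp_iff] at *
  obtain ⟨b, hb⟩ := hδ
  exact ⟨b, mem_ballAt_of_wider (ℓ := .closed γ) (ℓ' := .closed δ) h hb⟩

end ApproxType

open ApproxType

theorem Extension.ballAt_appr {L : Type u₁} [Field L] [Algebra K L]
    (E : Extension.{u, v, w, u₁} v₀ L) (x : L) (ℓ : BallLabel (valueGroup v₀)) :
    (E.appr x).ballAt ℓ = E.trace x ℓ := by
  ext c
  constructor
  · rintro ⟨B, hB, rfl, hc⟩
    have := hB.1
    rwa [this] at hc
  · intro hc
    exact ⟨⟨ℓ, E.trace x ℓ, c, E.trace_eq_ballSet hc⟩, ⟨rfl, c, hc⟩, rfl, hc⟩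

theorem Extension.appr_eq_iff {L : Type u₁} [Field L] [Algebra K L]
    (E : Extension.{u, v, w, u₁} v₀ L) (x : L) (A : ApproxType v₀) :
    E.appr x = A ↔ ∀ ℓ c, ℓ.Holds E.ι (E.v (x - algebraMap K L c)) ↔ c ∈ A.ballAt ℓ := by
  constructor
  · rintro rfl ℓ c
    rw [E.ballAt_appr]
    rfl
  · intro h
    apply ext_ballAt
    intro ℓ
    rw [E.ballAt_appr]
    ext c
    exact h ℓ c

theorem Extension.v_X_sub (E : Extension.{u, v, w, u} v₀ (RatFunc K)) (c : K) :
    E.v (RatFunc.X - algebraMap K (RatFunc K) c) = E.polyVal (X - C c) := by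
  rw [E.polyVal_apply, map_sub (algebraMap K[X] (RatFunc K)), RatFunc.algebraMap_X, RatFunc.algebraMap_C]
  rfl

theorem Extension.appr_X_eq_iff (E : Extension.{u, v, w, u} v₀ (RatFunc K)) (A : ApproxType v₀) :
    E.appr RatFunc.X = A ↔ ∀ ℓ c, ℓ.Holds E.ι (E.polyVal (X - C c)) ↔ c ∈ A.ballAt ℓ := by
  rw [E.appr_eq_iff]
  simp only [E.v_X_sub]

theorem holds_top {V : Type*} {G : Type*} [LinearOrder G] (ι : V → G) (ℓ : BallLabel V) :
    ℓ.Holds ι (⊤ : WithTop G) := by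
  cases ℓ with
  | closed γ => exact le_top
  | op γ => exact WithTop.coe_lt_top _

theorem holds_min {V : Type*} {G : Type*} [LinearOrder G] (ι : V → G) (ℓ : BallLabel V)
    (x y : WithTop G) : ℓ.Holds ι (min x y) ↔ ℓ.Holds ι x ∧ ℓ.Holds ι y := by
  cases ℓ with
  | closed γ => exact le_min_iff
  | op γ => exact lt_min_iff

theorem holds_map {V : Type*} {G : Type*} [LinearOrder V] [LinearOrder G] {ι : V → G}
    (hι : StrictMono ι) (ℓ : BallLabel V) (x : WithTop V) :
    ℓ.Holds ι (x.map ι) ↔ ℓ.Holds id x := by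
  cases ℓ with
  | closed γ =>
    simp only [BallLabel.Holds, WithTop.map_id, id]
    exact hι.withTop_map.le_iff_le
  | op γ =>
    simp only [BallLabel.Holds]
    exact hι.withTop_map.lt_iff_lt (a := (γ : WithTop V))

/-- A trivial type contains a closed ball of radius `∞` around some `c`, which would give the
nonzero element `X - c` infinite value. -/
theorem Extension.appr_X_not_isTrivial (E : Extension.{u, v, w, u} v₀ (RatFunc K)) :
    ¬ (E.appr RatFunc.X).IsTrivial := by
  rintro ⟨c, hc⟩
  have h1 := ((E.appr_X_eq_iff _).1 rfl (.closed ⊤) c).2 (by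
    rw [← hc, Extension.ballAt_appr]
    exact Extension.mem_trace_self c)
  have h2 : E.polyVal (X - C c) = ⊤ := top_le_iff.1 h1
  exact X_sub_C_ne_zero c (E.polyVal_eq_top.1 h2)

namespace ApproxType

variable {A : ApproxType v₀}

/-- A closed ball of radius `∞` is a single point `c`, and fullness then puts every ball around `c`
into `A`. -/
theorem ballAt_top_eq_empty (hA : ¬ A.IsTrivial) : A.ballAt (.closed ⊤) = ∅ := by
  by_contra hne
  obtain ⟨c, hc⟩ := Set.nonempty_iff_ne_empty.2 hne
  refine hA ⟨c, ?_⟩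
  apply ext_ballAt
  intro ℓ
  have hl : c ∈ A.ballAt ℓ := mem_ballAt_of_wider (ℓ' := .closed ⊤) (by
    cases ℓ with
    | closed γ => exact le_top
    | op γ => exact WithTop.coe_lt_top _) hc
  ext a
  rw [mem_ballAt_iff hl, Extension.ballAt_appr, ← mem_ballSet_iff,
    Extension.ballSet_eq_trace_self]

end ApproxType

/-- The approximation type of `x` if `v` is given by the assignment of a value to `x - b`. -/
theorem Extension.appr_X_eq_of_linear (E : Extension.{u, v, w, u} v₀ (RatFunc K))
    {A : ApproxType v₀} {b : K} (hb : b ∈ A.inter)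
    (hle : ∀ g q : K[X], g.natDegree < (X - C b).natDegree →
      E.polyVal (g + q * (X - C b)) ≤ E.polyVal g)
    (h : ∀ ℓ : BallLabel (valueGroup v₀),
      ℓ.Holds E.ι (E.polyVal (X - C b)) ↔ (A.ballAt ℓ).Nonempty) : E.appr RatFunc.X = A := by
  rw [E.appr_X_eq_iff]
  intro ℓ c
  -- Writing `X - c = (b - c) + (X - b)` gives `v (x - c)` as the minimum of `v (b - c)` and `v (x -
  -- b)`.
  have h1 := E.polyVal_eq_min hle (g := C (b - c)) 1 (by simp)
  rw [one_mul, show C (b - c) + (X - C b) = X - C c by simp, E.polyVal_C] at h1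
  rw [h1, holds_min, h, holds_map E.strictMono]
  constructor
  · rintro ⟨h2, h3⟩
    rw [mem_ballAt_iff (mem_ballAt_of_mem_inter hb h3), AddValuation.map_sub_swap]
    exact h2
  · intro hc
    refine ⟨?_, c, hc⟩
    rw [AddValuation.map_sub_swap, ← mem_ballAt_iff (mem_ballAt_of_mem_inter hb ⟨c, hc⟩)]
    exact hc

end Balls

/-! ### Extensions assigning a value to `x - b` -/

section Gauss

variable {K : Type u} [Field K] {Γ : Type v} [AddCommGroup Γ] [LinearOrder Γ]
  [IsOrderedAddMonoid Γ] {v₀ : AddValuation K (WithTop Γ)}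

theorem exists_extension_of_isAugmentable {H : Type w} [AddCommGroup H] [LinearOrder H]
    [IsOrderedAddMonoid H] (ι : valueGroup v₀ →+ H) (hι : StrictMono ι) {f : K[X]}
    {W : K[X] → WithTop H} {α : H} (h : IsAugmentable f W α)
    (hC : ∀ a, W (C a) = (val v₀ a).map ι) :
    ∃ (v : AddValuation (RatFunc K) (WithTop H)) (hv : Extends v₀ ι v),
      (Extension.mk ι hι v hv).polyVal f = α ∧
      (∀ g q : K[X], g.natDegree < f.natDegree → (Extension.mk ι hι v hv).polyVal (g + q * f) ≤
        (Extension.mk ι hι v hv).polyVal g) ∧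
      ∀ g : K[X], g.natDegree < f.natDegree → (Extension.mk ι hι v hv).polyVal g = W g := by
  obtain ⟨v, hv, hp⟩ := exists_extension ι hι h.valuation (fun p hp => h.augment_ne_top hp)
    (fun a => by
      rw [h.valuation_apply, h.augment_of_lt (by simpa using h.natDegree_pos), hC])
  refine ⟨v, hv, ?_, fun g q hg => ?_, fun g hg => ?_⟩
  · rw [hp, h.valuation_apply]
    have := h.augment_mul 1
    rwa [one_mul, h.augment_of_lt (g := 1) (by simpa using h.natDegree_pos), h.one,
      zero_add] at this
  · rw [hp, hp, h.valuation_apply, h.valuation_apply, h.augment_add_mul hg, h.augment_of_lt hg]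
    exact min_le_left _ _
  · rw [hp, h.valuation_apply, h.augment_of_lt hg]

/-- Remainders modulo `X - b` are constants, so a product of two of them has quotient `0`, and
`mul_div` puts no restriction on `α`. -/
theorem isAugmentable_linear {H : Type w} [AddCommGroup H] [LinearOrder H] [IsOrderedAddMonoid H]
    (ι : valueGroup v₀ →+ H) (hι : StrictMono ι) (b : K) (α : H) :
    IsAugmentable (X - C b) (fun p => (val v₀ (p.coeff 0)).map ι) α where
  monic := monic_X_sub_C b
  natDegree_pos := by simp
  zero := by simp
  one := by simp
  ne_top g hg h0 := by
    rw [natDegree_X_sub_C, Nat.lt_one_iff] at hg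
    rw [Ne, withTop_map_eq_top, AddValuation.top_iff]
    intro h1
    rw [eq_C_of_natDegree_eq_zero hg, h1, C_0] at h0
    exact h0 rfl
  neg g hg := by rw [coeff_neg, AddValuation.map_neg]
  add g h hg hh := by
    rw [coeff_add, ← hι.monotone.withTop_map.map_min]
    exact hι.monotone.withTop_map (AddValuation.map_add _ _ _)
  mul_mod g h hg hh := by
    rw [natDegree_X_sub_C, Nat.lt_one_iff] at hg hh
    rw [(modByMonic_eq_self_iff (monic_X_sub_C b)).2, mul_coeff_zero, AddValuation.map_mul,
      withTop_map_add]
    apply degree_lt_degree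
    rw [eq_C_of_natDegree_eq_zero hg, eq_C_of_natDegree_eq_zero hh, ← C_mul, natDegree_C]
    simp
  mul_div g h hg hh hg0 hh0 := by
    rw [natDegree_X_sub_C, Nat.lt_one_iff] at hg hh
    rw [(divByMonic_eq_zero_iff (monic_X_sub_C b)).2]
    · have h1 : ∀ p : K[X], p.natDegree = 0 → p ≠ 0 → (val v₀ (p.coeff 0)).map ι ≠ ⊤ := by
        intro p hp h0
        rw [Ne, withTop_map_eq_top, AddValuation.top_iff]
        intro h1
        rw [eq_C_of_natDegree_eq_zero hp, h1, C_0] at h0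
        exact h0 rfl
      simpa [lt_top_iff_ne_top] using ⟨by simpa using h1 g hg hg0, by simpa using h1 h hh hh0⟩
    · apply degree_lt_degree
      rw [eq_C_of_natDegree_eq_zero hg, eq_C_of_natDegree_eq_zero hh, ← C_mul, natDegree_C]
      simp

theorem Extension.polyVal_comp_eq (E : Extension.{u, v, w, u} v₀ (RatFunc K)) {f : K[X]} {α : E.Γ'}
    (hd : 0 < f.natDegree) (hα : E.polyVal f = α)
    (hle : ∀ g q : K[X], g.natDegree < f.natDegree → E.polyVal (g + q * f) ≤ E.polyVal g)
    (P : K[X]) : E.polyVal (P.comp f) = (Finset.range (P.natDegree + 1)).inf fun i =>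
      E.polyVal (C (P.coeff i)) + ((i • α : E.Γ') : WithTop E.Γ') := by
  apply le_antisymm
  · exact Finset.le_inf fun i _ => E.polyVal_comp_le hd hα hle i P
  · rw [comp, eval₂_eq_sum_range]
    refine AddValuation.map_le_sum _ fun i hi => ?_
    refine (Finset.inf_le hi).trans (le_of_eq ?_)
    rw [AddValuation.map_mul, AddValuation.map_pow, hα]
    norm_cast

theorem aeval_X_sub_C (b : K) (P : K[X]) :
    aeval (RatFunc.X - RatFunc.C b) P = algebraMap K[X] (RatFunc K) (P.comp (X - C b)) := by
  rw [comp, hom_eval₂, aeval_def, map_sub, RatFunc.algebraMap_X, RatFunc.algebraMap_C]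
  rfl

theorem comp_X_add_C_comp (b : K) (p : K[X]) : (p.comp (X + C b)).comp (X - C b) = p := by
  simp [comp_assoc]

/-- The formula for the minimum gives the two conditions on testing it at `X` and at a constant plus
a multiple of `X`, rewritten in powers of `X - b`. Conversely the one-step bound, iterated, bounds
the value by every term of the expansion. -/
theorem isGaussExtension_iff {H : Type w} [AddCommGroup H] [LinearOrder H]
    [IsOrderedAddMonoid H] (ι : valueGroup v₀ →+ H) (hι : StrictMono ι) {b : K} {α : H}
    {v : AddValuation (RatFunc K) (WithTop H)} (hv : Extends v₀ ι v) :
    IsGaussExtension v₀ ι b α v ↔ (Extension.mk ι hι v hv).polyVal (X - C b) = α ∧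
      ∀ g q : K[X], g.natDegree < (X - C b).natDegree →
        (Extension.mk ι hι v hv).polyVal (g + q * (X - C b)) ≤
          (Extension.mk ι hι v hv).polyVal g := by
  set E := Extension.mk ι hι v hv
  have hform : IsGaussExtension v₀ ι b α v ↔ ∀ P : K[X], E.polyVal (P.comp (X - C b)) =
      (Finset.range (P.natDegree + 1)).inf fun i =>
        E.polyVal (C (P.coeff i)) + ((i • α : H) : WithTop H) := by
    refine ⟨fun h P => ?_, fun h => ⟨hv, fun P => ?_⟩⟩
    · rw [E.polyVal_apply, ← aeval_X_sub_C]
      simp only [E.polyVal_apply, RatFunc.algebraMap_C]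
      exact h.2 P
    · have h1 := h P
      rw [E.polyVal_apply, ← aeval_X_sub_C] at h1
      simp only [E.polyVal_apply, RatFunc.algebraMap_C] at h1
      exact h1
  rw [hform]
  constructor
  · intro h
    constructor
    · have h1 := h X
      rw [X_comp, natDegree_X] at h1
      rw [h1]
      simp [Finset.range_add_one]
    · intro g q hg
      rw [natDegree_X_sub_C, Nat.lt_one_iff] at hg
      have h1 := h (C (g.coeff 0) + q.comp (X + C b) * X)
      rw [add_comp, mul_comp, C_comp, X_comp, comp_X_add_C_comp, ← eq_C_of_natDegree_eq_zero hg]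
        at h1
      rw [h1]
      refine (Finset.inf_le (Finset.mem_range.2 (Nat.succ_pos _))).trans (le_of_eq ?_)
      rw [coeff_add, mul_coeff_zero, coeff_X_zero, mul_zero, add_zero,
        ← eq_C_of_natDegree_eq_zero hg, zero_smul, WithTop.coe_zero, add_zero]
  · rintro ⟨h1, h2⟩ P
    exact E.polyVal_comp_eq (by simp) h1 h2 P

theorem existsUnique_isGaussExtension {H : Type w} [AddCommGroup H] [LinearOrder H]
    [IsOrderedAddMonoid H] (ι : valueGroup v₀ →+ H) (hι : StrictMono ι) (b : K) (α : H) :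
    ∃! v : AddValuation (RatFunc K) (WithTop H), IsGaussExtension v₀ ι b α v := by
  obtain ⟨v, hv, h1, h2, -⟩ := exists_extension_of_isAugmentable ι hι
    (isAugmentable_linear (v₀ := v₀) ι hι b α) (by simp)
  refine ⟨v, (isGaussExtension_iff ι hι hv).2 ⟨h1, h2⟩, fun v' h' => ?_⟩
  have h := (isGaussExtension_iff ι hι hv).2 ⟨h1, h2⟩
  have hpoly : ∀ p : K[X], v' (algebraMap K[X] (RatFunc K) p) =
      v (algebraMap K[X] (RatFunc K) p) := by
    intro p
    rw [← comp_X_add_C_comp b p, ← aeval_X_sub_C, h.2, h'.2]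
    congr 1
    funext i
    congr 1
    exact (extends_iff.1 h'.1 _).trans (extends_iff.1 hv _).symm
  apply AddValuation.ext
  intro y
  rw [← RatFunc.num_div_denom y, AddValuation.map_div, AddValuation.map_div, hpoly, hpoly]

theorem Extension.exists_lt_sub_C_of_linear (E : Extension.{u, v, w, u} v₀ (RatFunc K)) (b : K)
    (g : K[X]) (hg : g.natDegree < (X - C b).natDegree) (h0 : g ≠ 0) :
    ∃ c : K, E.polyVal g < E.polyVal (g - C c) := by
  rw [natDegree_X_sub_C, Nat.lt_one_iff] at hg
  refine ⟨g.coeff 0, ?_⟩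
  rw [← eq_C_of_natDegree_eq_zero hg, sub_self, AddValuation.map_zero, lt_top_iff_ne_top, Ne,
    E.polyVal_eq_top]
  exact h0

theorem isValueTranscendental_of_isGaussExtension {H : Type w} [AddCommGroup H] [LinearOrder H]
    [IsOrderedAddMonoid H] (ι : valueGroup v₀ →+ H) (hι : StrictMono ι) {b : K} {α : H}
    (hα : ∀ n : ℕ, 0 < n → n • α ∉ ι.range) {v : AddValuation (RatFunc K) (WithTop H)}
    (hv : IsGaussExtension v₀ ι b α v) : (Extension.mk ι hι v hv.1).IsValueTranscendental :=
  Extension.isValueTranscendental_of_approx _ (monic_X_sub_C b) (by simp)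
    ((isGaussExtension_iff ι hι hv.1).1 hv).1 hα (Extension.exists_lt_sub_C_of_linear _ b)

theorem isResidueTranscendental_of_isGaussExtension {H : Type w} [AddCommGroup H] [LinearOrder H]
    [IsOrderedAddMonoid H] (ι : valueGroup v₀ →+ H) (hι : StrictMono ι) {b : K}
    {δ : valueGroup v₀} {v : AddValuation (RatFunc K) (WithTop H)}
    (hv : IsGaussExtension v₀ ι b (ι δ) v) :
    (Extension.mk ι hι v hv.1).IsResidueTranscendental := by
  obtain ⟨a, ha⟩ := exists_val_eq v₀ δ
  have h := (isGaussExtension_iff ι hι hv.1).1 hv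
  refine Extension.isResidueTranscendental_of_le _ (monic_X_sub_C b) (by simp) (a := a) ?_ ?_
    h.2 (Extension.exists_lt_sub_C_of_linear _ b)
  · rintro rfl
    simp at ha
  · rw [h.1, Extension.polyVal_C, ha]
    rfl

open ApproxType

/-- As `α` never equals a value `ι γ`, the conditions `α ≥ ι γ` and `α > ι γ` coincide and say `γ ∈
supp A`. Residue-immediacy says that `A` likewise has an open ball wherever it has a closed one. -/
theorem appr_eq_of_isValueExtending {A : ApproxType v₀} (hA : ¬ A.IsTrivial)
    (h : A.IsValueExtending) {b : K} (hb : b ∈ A.inter) {H : Type w} [AddCommGroup H]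
    [LinearOrder H] [IsOrderedAddMonoid H] (ι : valueGroup v₀ →+ H) (hι : StrictMono ι) {α : H}
    (hα : ∀ γ : valueGroup v₀, (↑γ ∈ A.supp → ι γ < α) ∧ (↑γ ∉ A.supp → α < ι γ))
    {v : AddValuation (RatFunc K) (WithTop H)} (hv : IsGaussExtension v₀ ι b α v) :
    (Extension.mk ι hι v hv.1).appr RatFunc.X = A := by
  have h1 := (isGaussExtension_iff ι hι hv.1).1 hv
  refine Extension.appr_X_eq_of_linear _ hb h1.2 fun ℓ => ?_
  rw [h1.1]
  have hcl : ∀ γ : valueGroup v₀, ι γ < α ↔ (A.ballAt (.closed γ)).Nonempty := by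
    intro γ
    rw [← mem_supp_iff]
    exact ⟨fun h2 => by_contra fun h3 => lt_asymm h2 ((hα γ).2 h3), (hα γ).1⟩
  have hne : ∀ γ : valueGroup v₀, ι γ ≠ α := by
    intro γ h2
    by_cases h3 : (γ : WithTop (valueGroup v₀)) ∈ A.supp
    · exact ((hα γ).1 h3).ne h2
    · exact ((hα γ).2 h3).ne' h2
  cases ℓ with
  | closed γ =>
    cases γ with
    | top =>
      rw [ballAt_top_eq_empty hA]
      simp [BallLabel.Holds]
    | coe γ =>
      rw [← hcl]
      simp only [BallLabel.Holds, WithTop.map_coe, WithTop.coe_le_coe]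
      exact ⟨fun h2 => lt_of_le_of_ne h2 (hne γ), le_of_lt⟩
  | op γ =>
    simp only [BallLabel.Holds, WithTop.coe_lt_coe]
    constructor
    · intro h2
      exact h.1 γ (mem_supp_iff.2 ((hcl γ).1 h2))
    · rintro ⟨c, hc⟩
      exact (hcl γ).2 ⟨c, mem_ballAt_of_wider (ℓ := .closed γ) (ℓ' := .op γ) (le_refl _) hc⟩

/-- The missing open ball makes the closed ball of radius `δ` the narrowest one, so the labels
occurring in `A` are those at least as wide. -/
theorem appr_eq_of_openBall_eq_empty {A : ApproxType v₀} {b : K} (hb : b ∈ A.inter)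
    {δ : valueGroup v₀} (hδ : ↑δ ∈ A.supp) (hδ' : A.openBall δ = ∅) {H : Type w} [AddCommGroup H]
    [LinearOrder H] [IsOrderedAddMonoid H] (ι : valueGroup v₀ →+ H) (hι : StrictMono ι)
    {v : AddValuation (RatFunc K) (WithTop H)} (hv : IsGaussExtension v₀ ι b (ι δ) v) :
    (Extension.mk ι hι v hv.1).appr RatFunc.X = A := by
  have h1 := (isGaussExtension_iff ι hι hv.1).1 hv
  refine Extension.appr_X_eq_of_linear _ hb h1.2 fun ℓ => ?_
  have hop : ∀ γ : WithTop (valueGroup v₀), (δ : WithTop (valueGroup v₀)) < γ →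
      ¬ (A.ballAt (.closed γ)).Nonempty := by
    rintro γ hγ ⟨c, hc⟩
    have : c ∈ A.openBall δ := mem_ballAt_of_wider (ℓ := .op δ) (ℓ' := .closed γ) hγ hc
    rw [hδ'] at this
    exact this
  rw [h1.1]
  cases ℓ with
  | closed γ =>
    have : ((ι δ : H) : WithTop H) = (δ : WithTop (valueGroup v₀)).map ι := rfl
    rw [this]
    simp only [BallLabel.Holds]
    rw [hι.withTop_map.le_iff_le]
    exact ⟨fun h2 => mem_supp_iff.1 (supp_down h2 hδ), fun h2 => not_lt.1 fun h3 => hop γ h3 h2⟩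
  | op γ =>
    simp only [BallLabel.Holds, WithTop.coe_lt_coe]
    rw [hι.lt_iff_lt]
    constructor
    · intro h2
      obtain ⟨c, hc⟩ := mem_supp_iff.1 hδ
      exact ⟨c, mem_ballAt_of_wider (ℓ := .op γ) (ℓ' := .closed δ) (WithTop.coe_lt_coe.2 h2) hc⟩
    · rintro ⟨c, hc⟩
      by_contra h2
      have : c ∈ A.openBall δ :=
        mem_ballAt_of_wider (ℓ := .op δ) (ℓ' := .op γ) (not_lt.1 h2) hc
      rw [hδ'] at this
      exact this

theorem ApproxType.isGreatest_of_openBall_eq_empty {A : ApproxType v₀} {δ : valueGroup v₀}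
    (hδ : ↑δ ∈ A.supp) (hδ' : A.openBall δ = ∅) :
    IsGreatest A.supp (δ : WithTop (valueGroup v₀)) := by
  refine ⟨hδ, fun γ hγ => not_lt.1 fun h => ?_⟩
  obtain ⟨c, hc⟩ := mem_supp_iff.1 hγ
  have : c ∈ A.openBall δ := mem_ballAt_of_wider (ℓ := .op δ) (ℓ' := .closed γ) h hc
  rw [hδ'] at this
  exact this

theorem ApproxType.inter_eq_closedBall {A : ApproxType v₀} {δ : valueGroup v₀}
    (hδ : ↑δ ∈ A.supp) (hδ' : A.openBall δ = ∅) : A.inter = A.closedBall δ := by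
  ext b
  refine ⟨fun hb => mem_ballAt_of_mem_inter hb (mem_supp_iff.1 hδ), fun hb => ?_⟩
  refine mem_inter_of_forall fun ℓ hℓ => ?_
  rcases Extension.wider_total ℓ (.closed δ) with h | h
  · exact mem_ballAt_of_wider h hb
  · obtain ⟨c, hc⟩ := hℓ
    cases ℓ with
    | closed γ =>
      have h1 := (isGreatest_of_openBall_eq_empty hδ hδ').2 (mem_supp_iff.2 ⟨c, hc⟩)
      have h2 : γ = δ := le_antisymm h1 h
      rw [h2]
      exact hb
    | op γ =>
      have : c ∈ A.openBall δ := mem_ballAt_of_wider (ℓ := .op δ) (ℓ' := .op γ)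
        (WithTop.coe_le_coe.1 h) hc
      rw [hδ'] at this
      exact absurd this (Set.notMem_empty c)

end Gauss

open Filter

/-! ### Eventual values along levels and Kaplansky's dominant Taylor term -/

section Levels

variable {K : Type*} [Field K] {G : Type*} [AddCommGroup G] [LinearOrder G] [IsOrderedAddMonoid G]
  {v : AddValuation K (WithTop G)} {lev : K → G}

/-- `lev c` behaves like the value of `x - c`, for a limit `x` of a pseudo-convergent family. -/
structure IsLevel (v : AddValuation K (WithTop G)) (lev : K → G) : Prop where
  val_sub : ∀ c c', lev c < lev c' → v (c' - c) = lev c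
  exists_lt : ∀ c, ∃ c', lev c < lev c'

/-- The filter of all sets containing some `{c' | lev c ≤ lev c'}`. -/
def levelFilter (lev : K → G) : Filter K := ⨅ c, 𝓟 {c' | lev c ≤ lev c'}

omit [AddCommGroup G] [IsOrderedAddMonoid G] in
theorem eventually_levelFilter {P : K → Prop} :
    (∀ᶠ c in levelFilter lev, P c) ↔ ∃ c₀, ∀ c, lev c₀ ≤ lev c → P c := by
  rw [levelFilter, Filter.Eventually, mem_iInf_of_directed]
  · rfl
  · intro c d
    rcases le_total (lev c) (lev d) with h | h
    · exact ⟨d, principal_mono.2 fun a ha => h.trans ha, le_rfl⟩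
    · exact ⟨c, le_rfl, principal_mono.2 fun a ha => h.trans ha⟩

omit [AddCommGroup G] [IsOrderedAddMonoid G] in
theorem levelFilter_neBot : (levelFilter lev).NeBot := by
  rw [neBot_iff]
  intro h
  have : ∀ᶠ _ in levelFilter lev, False := by rw [h]; exact eventually_bot
  obtain ⟨c₀, hc⟩ := eventually_levelFilter.1 this
  exact hc c₀ le_rfl

/-- The value of `p` is eventually constant. -/
def FixesVal (v : AddValuation K (WithTop G)) (lev : K → G) (p : K[X]) : Prop :=
  ∃ l : WithTop G, ∀ᶠ c in levelFilter lev, v (p.eval c) = l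

open Classical in
/-- The eventual value of `p`. -/
noncomputable def evVal (v : AddValuation K (WithTop G)) (lev : K → G) (p : K[X]) : WithTop G :=
  if h : FixesVal v lev p then h.choose else ⊤

theorem evVal_eq {p : K[X]} {l : WithTop G} (h : ∀ᶠ c in levelFilter lev, v (p.eval c) = l) :
    evVal v lev p = l := by
  have hp : FixesVal v lev p := ⟨l, h⟩
  rw [evVal, dif_pos hp]
  have := levelFilter_neBot (lev := lev)
  obtain ⟨c, h1, h2⟩ := (hp.choose_spec.and h).exists
  rw [← h1, h2]

theorem FixesVal.eventually {p : K[X]} (h : FixesVal v lev p) :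
    ∀ᶠ c in levelFilter lev, v (p.eval c) = evVal v lev p := by
  obtain ⟨l, hl⟩ := h
  rwa [evVal_eq hl]

theorem fixesVal_C (a : K) : FixesVal v lev (C a) := ⟨v a, by simp⟩

theorem evVal_C (a : K) : evVal v lev (C a) = v a := evVal_eq (by simp)

theorem FixesVal.mul {p q : K[X]} (hp : FixesVal v lev p) (hq : FixesVal v lev q) :
    FixesVal v lev (p * q) := by
  refine ⟨evVal v lev p + evVal v lev q, ?_⟩
  filter_upwards [hp.eventually, hq.eventually] with c h1 h2
  rw [eval_mul, AddValuation.map_mul, h1, h2]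

theorem evVal_mul {p q : K[X]} (hp : FixesVal v lev p) (hq : FixesVal v lev q) :
    evVal v lev (p * q) = evVal v lev p + evVal v lev q := by
  apply evVal_eq
  filter_upwards [hp.eventually, hq.eventually] with c h1 h2
  rw [eval_mul, AddValuation.map_mul, h1, h2]

theorem evVal_neg {p : K[X]} (hp : FixesVal v lev p) : evVal v lev (-p) = evVal v lev p := by
  apply evVal_eq
  filter_upwards [hp.eventually] with c h1
  rw [eval_neg, AddValuation.map_neg, h1]

theorem evVal_add {p q : K[X]} (hp : FixesVal v lev p) (hq : FixesVal v lev q)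
    (hpq : FixesVal v lev (p + q)) :
    min (evVal v lev p) (evVal v lev q) ≤ evVal v lev (p + q) := by
  have := levelFilter_neBot (lev := lev)
  obtain ⟨c, h1, h2, h3⟩ := (hp.eventually.and (hq.eventually.and hpq.eventually)).exists
  rw [← h1, ← h2, ← h3, eval_add]
  exact AddValuation.map_add _ _ _

namespace IsLevel

variable (h : IsLevel v lev)
include h

theorem eventually_lt (c₀ : K) : ∀ᶠ c in levelFilter lev, lev c₀ < lev c := by
  obtain ⟨c₁, h1⟩ := h.exists_lt c₀
  exact eventually_levelFilter.2 ⟨c₁, fun c hc => h1.trans_le hc⟩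

theorem eventually_eval_ne_zero {p : K[X]} (hp : p ≠ 0) :
    ∀ᶠ c in levelFilter lev, p.eval c ≠ 0 := by
  classical
  have : ∀ᶠ c in levelFilter lev, ∀ r ∈ p.roots.toFinset, lev r < lev c :=
    (Filter.eventually_all_finset _).2 fun r _ => h.eventually_lt r
  filter_upwards [this] with c hc h0
  exact lt_irrefl _ (hc c (by simpa [hp] using h0))

theorem evVal_ne_top {p : K[X]} (hp : p ≠ 0) (hf : FixesVal v lev p) : evVal v lev p ≠ ⊤ := by
  have := levelFilter_neBot (lev := lev)
  obtain ⟨c, h1, h2⟩ := (hf.eventually.and (h.eventually_eval_ne_zero hp)).exists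
  rw [← h1]
  exact AddValuation.ne_top_iff _ |>.2 h2

theorem evVal_X_sub_C (c : K) : ∀ᶠ a in levelFilter lev, v ((X - C c).eval a) = lev c := by
  filter_upwards [h.eventually_lt c] with a ha
  rw [eval_sub, eval_X, eval_C, h.val_sub c a ha]

/-- The difference of the two sides is a constant plus `j - i` times the level, which increases
strictly. Either it becomes nonnegative somewhere and is positive at all larger levels, or it is
negative throughout. -/
theorem eventually_lt_or_gt {i j : ℕ} (hij : i < j) (a b : G) :
    (∀ᶠ c in levelFilter lev, a + i • lev c < b + j • lev c) ∨
      (∀ᶠ c in levelFilter lev, b + j • lev c < a + i • lev c) := by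
  obtain ⟨k, hk, rfl⟩ : ∃ k, k ≠ 0 ∧ j = i + k := ⟨j - i, by omega, by omega⟩
  have hmono : ∀ c c', lev c < lev c' → k • lev c < k • lev c' := fun c c' hc =>
    nsmul_lt_nsmul_right hk hc
  simp only [add_nsmul]
  by_cases hex : ∃ c₀, a ≤ b + k • lev c₀
  · left
    obtain ⟨c₀, hc₀⟩ := hex
    filter_upwards [h.eventually_lt c₀] with c hc
    have := hmono _ _ hc
    generalize k • lev c = x at *
    generalize k • lev c₀ = y at *
    generalize i • lev c = z at *
    grind
  · right
    push Not at hex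
    refine Eventually.of_forall fun c => ?_
    have := hex c
    generalize k • lev c = x at *
    generalize i • lev c = z at *
    grind

/-- Among finitely many monomials in the level, one is eventually strictly dominant. -/
theorem exists_dominant (β : ℕ → WithTop G) (s : Finset ℕ) (hs : ∃ i ∈ s, β i ≠ ⊤) :
    ∃ m ∈ s, β m ≠ ⊤ ∧ ∀ᶠ c in levelFilter lev, ∀ i ∈ s, i ≠ m →
      β m + ((m • lev c : G) : WithTop G) < β i + ((i • lev c : G) : WithTop G) := by
  have htop : ∀ (m i : ℕ) (c : K), β m ≠ ⊤ → β i = ⊤ →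
      β m + ((m • lev c : G) : WithTop G) < β i + ((i • lev c : G) : WithTop G) := by
    intro m i c hm hi
    rw [hi, top_add, lt_top_iff_ne_top]
    exact WithTop.add_ne_top.2 ⟨hm, WithTop.coe_ne_top⟩
  have hpair : ∀ i j : ℕ, i ≠ j → β i ≠ ⊤ → β j ≠ ⊤ →
      (∀ᶠ c in levelFilter lev,
        β i + ((i • lev c : G) : WithTop G) < β j + ((j • lev c : G) : WithTop G)) ∨
      (∀ᶠ c in levelFilter lev,
        β j + ((j • lev c : G) : WithTop G) < β i + ((i • lev c : G) : WithTop G)) := by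
    intro i j hij hi hj
    lift β i to G using hi with a
    lift β j to G using hj with b
    norm_cast
    rcases lt_or_gt_of_ne hij with h1 | h1
    · exact h.eventually_lt_or_gt h1 a b
    · exact (h.eventually_lt_or_gt h1 b a).symm
  induction s using Finset.induction_on with
  | empty => simp at hs
  | insert j s hj ih =>
    by_cases hs' : ∃ i ∈ s, β i ≠ ⊤
    · obtain ⟨m, hm, hm0, hdom⟩ := ih hs'
      have hjm : j ≠ m := by
        rintro rfl
        exact hj hm
      have hfirst : (∀ᶠ c in levelFilter lev,
          β m + ((m • lev c : G) : WithTop G) < β j + ((j • lev c : G) : WithTop G)) →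
          ∀ᶠ c in levelFilter lev, ∀ i ∈ insert j s, i ≠ m →
            β m + ((m • lev c : G) : WithTop G) < β i + ((i • lev c : G) : WithTop G) := by
        intro h1
        filter_upwards [hdom, h1] with c h2 h3 i hi him
        rcases Finset.mem_insert.1 hi with rfl | hi
        · exact h3
        · exact h2 i hi him
      by_cases hj0 : β j = ⊤
      · exact ⟨m, Finset.mem_insert_of_mem hm, hm0,
          hfirst (Eventually.of_forall fun c => htop m j c hm0 hj0)⟩
      rcases hpair m j hjm.symm hm0 hj0 with h1 | h1
      · exact ⟨m, Finset.mem_insert_of_mem hm, hm0, hfirst h1⟩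
      · refine ⟨j, Finset.mem_insert_self _ _, hj0, ?_⟩
        filter_upwards [hdom, h1] with c h2 h3 i hi hij
        rcases Finset.mem_insert.1 hi with rfl | hi
        · exact absurd rfl hij
        · by_cases him : i = m
          · rw [him]; exact h3
          · exact h3.trans (h2 i hi him)
    · push Not at hs'
      obtain ⟨i, hi, hi0⟩ := hs
      have hij : i = j := by
        rcases Finset.mem_insert.1 hi with rfl | hi
        · rfl
        · exact absurd (hs' i hi) hi0
      subst hij
      refine ⟨i, Finset.mem_insert_self _ _, hi0, Eventually.of_forall fun c k hk hki => ?_⟩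
      rcases Finset.mem_insert.1 hk with rfl | hk
      · exact absurd rfl hki
      · exact htop i k c hi0 (hs' k hk)

end IsLevel

theorem dominant_lt {G : Type*} [AddCommGroup G] [LinearOrder G] [IsOrderedAddMonoid G] {m : ℕ}
    (hm : 1 ≤ m) (b : G) {x y : G} (h : x < y) : b + m • x < b + m • y :=
  add_lt_add_right (nsmul_lt_nsmul_right (by omega) h) b

/-- In the Taylor expansion of `p` at `c`, the term of degree `m` dominates. -/
def DominatesAt (v : AddValuation K (WithTop G)) (lev : K → G) (p : K[X]) (m : ℕ) (b : G) (c : K) :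
    Prop :=
  m ∈ Finset.Icc 1 p.natDegree ∧ v ((hasseDeriv m p).eval c) = b ∧
    ∀ i ∈ Finset.Icc 1 p.natDegree, i ≠ m →
      ((b + m • lev c : G) : WithTop G) <
        v ((hasseDeriv i p).eval c) + ((i • lev c : G) : WithTop G)

theorem aeval_sub_eq_sum {L : Type*} [CommRing L] [Algebra K L] (p : K[X]) (c : K) (y : L) :
    aeval y p - algebraMap K L (p.eval c) = ∑ i ∈ Finset.Icc 1 p.natDegree,
      algebraMap K L ((hasseDeriv i p).eval c) * (y - algebraMap K L c) ^ i := by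
  have h1 : p = ∑ i ∈ Finset.range (p.natDegree + 1),
      C ((hasseDeriv i p).eval c) * (X - C c) ^ i := by
    conv_lhs => rw [← sum_taylor_eq p c]
    rw [sum_over_range _ (by simp), natDegree_taylor]
    simp only [taylor_coeff]
  have h2 : aeval y p = ∑ i ∈ Finset.range (p.natDegree + 1),
      algebraMap K L ((hasseDeriv i p).eval c) * (y - algebraMap K L c) ^ i := by
    conv_lhs => rw [h1]
    simp
  rw [h2, Finset.range_eq_Ico, Finset.sum_eq_sum_Ico_succ_bot (Nat.succ_pos _)]
  simp only [hasseDeriv_zero', pow_zero, mul_one, add_sub_cancel_left]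
  rfl

/-- In the Taylor sum exactly one term has the smallest value. The point `y` lives in an arbitrary
algebra so as to cover both points of `K` and the variable `X`. -/
theorem DominatesAt.val_aeval_sub {p : K[X]} {m : ℕ} {b : G} {c : K}
    (hd : DominatesAt v lev p m b c) {L : Type*} [CommRing L] [Algebra K L] {H : Type*}
    [AddCommGroup H] [LinearOrder H] [IsOrderedAddMonoid H] {V : AddValuation L (WithTop H)}
    {ι : G →+ H} (hι : StrictMono ι) (hV : ∀ a, V (algebraMap K L a) = (v a).map ι) {y : L}
    (hy : V (y - algebraMap K L c) = ((ι (lev c) : H) : WithTop H)) :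
    V (aeval y p - algebraMap K L (p.eval c)) = ((ι (b + m • lev c) : H) : WithTop H) := by
  obtain ⟨hm, hb, hlt⟩ := hd
  have hterm : ∀ i, V (algebraMap K L ((hasseDeriv i p).eval c) * (y - algebraMap K L c) ^ i) =
      (v ((hasseDeriv i p).eval c) + ((i • lev c : G) : WithTop G)).map ι := by
    intro i
    rw [AddValuation.map_mul, AddValuation.map_pow, hV, hy, withTop_map_add, WithTop.map_coe,
      map_nsmul]
    norm_cast
  have hmterm : V (algebraMap K L ((hasseDeriv m p).eval c) * (y - algebraMap K L c) ^ m) =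
      ((ι (b + m • lev c) : H) : WithTop H) := by
    rw [hterm, hb]
    rfl
  rw [aeval_sub_eq_sum, ← Finset.add_sum_erase _ _ hm, AddValuation.map_add_eq_of_lt_left, hmterm]
  rw [hmterm]
  refine AddValuation.map_lt_sum _ WithTop.coe_ne_top fun i hi => ?_
  rw [hterm]
  exact hι.withTop_map (hlt i (Finset.mem_of_mem_erase hi) (Finset.ne_of_mem_erase hi))

namespace IsLevel

variable (h : IsLevel v lev)
include h

/-- With eventual values `βᵢ` of the Hasse derivatives, one of the expressions `βᵢ + i • lev c` is
eventually strictly smallest. The top derivative is a nonzero constant, so not all `βᵢ` are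
infinite. -/
theorem exists_dominatesAt {p : K[X]} (hp : 0 < p.natDegree)
    (hfix : ∀ i ∈ Finset.Icc 1 p.natDegree, FixesVal v lev (hasseDeriv i p)) :
    ∃ (m : ℕ) (b : G), 1 ≤ m ∧ ∀ᶠ c in levelFilter lev, DominatesAt v lev p m b c := by
  have hp0 : p ≠ 0 := by
    rintro rfl
    simp at hp
  have hn : p.natDegree ∈ Finset.Icc 1 p.natDegree := Finset.mem_Icc.2 ⟨hp, le_rfl⟩
  obtain ⟨m, hm, hm0, hdom⟩ := h.exists_dominant (fun i => evVal v lev (hasseDeriv i p))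
    (Finset.Icc 1 p.natDegree) ⟨p.natDegree, hn, by
      rw [hasseDeriv_natDegree_eq_C, evVal_C, AddValuation.ne_top_iff]
      exact leadingCoeff_ne_zero.2 hp0⟩
  have hall : ∀ᶠ c in levelFilter lev, ∀ i ∈ Finset.Icc 1 p.natDegree,
      v ((hasseDeriv i p).eval c) = evVal v lev (hasseDeriv i p) :=
    (Filter.eventually_all_finset _).2 fun i hi => (hfix i hi).eventually
  obtain ⟨b, hb⟩ := WithTop.ne_top_iff_exists.1 hm0
  refine ⟨m, b, (Finset.mem_Icc.1 hm).1, ?_⟩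
  filter_upwards [hdom, hall] with c h1 h2
  refine ⟨hm, by rw [h2 m hm, hb], fun i hi him => ?_⟩
  rw [h2 i hi, WithTop.coe_add, hb]
  exact h1 i hi him

theorem val_eval_sub {p : K[X]} {m : ℕ} {b : G} {c c' : K} (hd : DominatesAt v lev p m b c)
    (hc : lev c < lev c') : v (p.eval c' - p.eval c) = ((b + m • lev c : G) : WithTop G) := by
  have := hd.val_aeval_sub (V := v) (ι := AddMonoidHom.id G) (y := c') (fun _ _ h => h)
    (fun a => by
      rw [show ((AddMonoidHom.id G : G →+ G) : G → G) = id from rfl, WithTop.map_id]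
      rfl) (h.val_sub c c' hc)
  simpa using this

/-- If `p` has an eventual value, it is smaller than the dominant term. -/
theorem evVal_lt_dominant {p : K[X]} (hp : FixesVal v lev p) {m : ℕ} (hm : 1 ≤ m) {b : G}
    (hd : ∀ᶠ c in levelFilter lev, DominatesAt v lev p m b c) :
    ∀ᶠ c in levelFilter lev, evVal v lev p < ((b + m • lev c : G) : WithTop G) := by
  obtain ⟨c₀, h0⟩ := eventually_levelFilter.1 (hd.and hp.eventually)
  filter_upwards [h.eventually_lt c₀] with c hc
  -- Both values at `c₀` and `c` equal the eventual one, so it is at most the dominant term at `c₀`;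
  -- that term grows strictly with the level.
  have h1 := h.val_eval_sub (h0 c₀ le_rfl).1 hc
  have h2 : evVal v lev p ≤ ((b + m • lev c₀ : G) : WithTop G) := by
    rw [← h1]
    exact AddValuation.map_le_sub _ (h0 c hc.le).2.ge (h0 c₀ le_rfl).2.ge
  exact h2.trans_lt (WithTop.coe_lt_coe.2 (dominant_lt hm b hc))

/-- If `p` has no eventual value, its value is that of the dominant term. -/
theorem val_eval_eq_dominant {p : K[X]} (hp : ¬ FixesVal v lev p) {m : ℕ} (hm : 1 ≤ m) {b : G}
    (hd : ∀ᶠ c in levelFilter lev, DominatesAt v lev p m b c) :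
    ∀ᶠ c in levelFilter lev, v (p.eval c) = ((b + m • lev c : G) : WithTop G) := by
  obtain ⟨c₀, h0⟩ := eventually_levelFilter.1 hd
  -- A value below the dominant term would persist at all higher levels, making `p` fixed.
  have hge : ∀ c, lev c₀ ≤ lev c → ((b + m • lev c : G) : WithTop G) ≤ v (p.eval c) := by
    intro c hc
    by_contra hlt
    rw [not_le] at hlt
    refine hp ⟨v (p.eval c), ?_⟩
    filter_upwards [h.eventually_lt c] with c' hc'
    have h1 := h.val_eval_sub (h0 c hc) hc'
    exact AddValuation.map_eq_of_lt_sub _ (by rw [h1]; exact hlt)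
  refine eventually_levelFilter.2 ⟨c₀, fun c hc => le_antisymm ?_ (hge c hc)⟩
  -- If the value at `c` were larger, then at a higher `c'` it would also exceed the dominant term
  -- at `c`, and so would the difference, whose value is exactly that term.
  by_contra hlt
  rw [not_le] at hlt
  obtain ⟨c', hc'⟩ := h.exists_lt c
  have h1 := h.val_eval_sub (h0 c hc) hc'
  have h2 := hge c' (hc.trans hc'.le)
  have h3 : ((b + m • lev c : G) : WithTop G) < v (p.eval c' - p.eval c) := by
    refine lt_of_lt_of_le (lt_min ?_ hlt) (AddValuation.map_sub v (p.eval c') (p.eval c))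
    exact lt_of_lt_of_le (WithTop.coe_lt_coe.2 (dominant_lt hm b hc')) h2
  rw [h1] at h3
  exact lt_irrefl _ h3

/-- The value of `p` at `y` is its eventual value, and `p` is approximated there by constants. -/
theorem lt_val_aeval_sub {p : K[X]} (hp0 : p ≠ 0) (hp : FixesVal v lev p)
    (hfix : ∀ i ∈ Finset.Icc 1 p.natDegree, FixesVal v lev (hasseDeriv i p))
    {L : Type*} [CommRing L] [Algebra K L] {H : Type*}
    [AddCommGroup H] [LinearOrder H] [IsOrderedAddMonoid H] {V : AddValuation L (WithTop H)}
    {ι : G →+ H} (hι : StrictMono ι) (hV : ∀ a, V (algebraMap K L a) = (v a).map ι) {y : L}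
    (hy : ∀ c, V (y - algebraMap K L c) = ((ι (lev c) : H) : WithTop H)) :
    V (aeval y p) = (evVal v lev p).map ι ∧
      ∃ c, V (aeval y p) < V (aeval y p - algebraMap K L c) := by
  have := levelFilter_neBot (lev := lev)
  have htop := h.evVal_ne_top hp0 hp
  suffices H : ∃ c, v (p.eval c) = evVal v lev p ∧
      (evVal v lev p).map ι < V (aeval y p - algebraMap K L (p.eval c)) by
    obtain ⟨c, h1, h2⟩ := H
    have h3 : V (aeval y p) = (evVal v lev p).map ι := by
      rw [← h1, ← hV]
      exact AddValuation.map_eq_of_lt_sub _ (by rwa [hV, h1])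
    exact ⟨h3, _, by rw [h3]; exact h2⟩
  rcases Nat.eq_zero_or_pos p.natDegree with hn | hn
  · obtain ⟨c, hc⟩ := hp.eventually.exists
    refine ⟨c, hc, ?_⟩
    rw [aeval_sub_eq_sum, hn]
    simp only [zero_lt_one, Finset.Icc_eq_empty_of_lt, Finset.sum_empty, AddValuation.map_zero]
    rw [lt_top_iff_ne_top, Ne, withTop_map_eq_top]
    exact htop
  · obtain ⟨m, b, hm, hd⟩ := h.exists_dominatesAt hn hfix
    obtain ⟨c, h1, h2, h3⟩ := (hp.eventually.and
      ((h.evVal_lt_dominant hp hm hd).and hd)).exists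
    refine ⟨c, h1, ?_⟩
    rw [h3.val_aeval_sub hι hV (hy c)]
    exact hι.withTop_map h2

end IsLevel

end Levels

/-! ### Levels of immediate approximation types; the transcendental case -/

section Immediate

variable {K : Type u} [Field K] {Γ : Type v} [AddCommGroup Γ] [LinearOrder Γ]
  [IsOrderedAddMonoid Γ] {v₀ : AddValuation K (WithTop Γ)} {A : ApproxType v₀}
  {lev : K → valueGroup v₀}

open ApproxType

/-- `lev` describes the balls of `A`. -/
def IsLevelOf (A : ApproxType v₀) (lev : K → valueGroup v₀) : Prop :=
  ∀ (ℓ : BallLabel (valueGroup v₀)) (c : K),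
    c ∈ A.ballAt ℓ ↔ ℓ.Holds id ((lev c : valueGroup v₀) : WithTop (valueGroup v₀))

theorem holds_of_wider {G : Type*} [LinearOrder G] {ℓ ℓ' : BallLabel G} (h : ℓ.Wider ℓ')
    {x : WithTop G} (hx : ℓ'.Holds id x) : ℓ.Holds id x := by
  cases ℓ <;> cases ℓ' <;> simp only [BallLabel.Holds, BallLabel.Wider, WithTop.map_id, id] at * <;>
    first
      | exact h.trans hx
      | exact h.trans hx.le
      | exact h.trans_le hx
      | exact (WithTop.coe_le_coe.2 h).trans_lt hx

theorem holds_mono {G : Type*} [LinearOrder G] {ℓ : BallLabel G} {x y : WithTop G} (h : x ≤ y)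
    (hx : ℓ.Holds id x) : ℓ.Holds id y := by
  cases ℓ
  · exact le_trans hx h
  · exact lt_of_lt_of_le hx h

/-- Some ball of `A` misses `c`; for `b` in that ball the level is the value of `c - b`. Wider balls
can be tested with center `b`, and narrower ones cannot contain `c`. -/
theorem exists_isLevelOf (hA : A.IsImmediate) : ∃ lev, IsLevelOf A lev := by
  suffices H : ∀ c, ∃ γ : valueGroup v₀, ∀ ℓ : BallLabel (valueGroup v₀),
      c ∈ A.ballAt ℓ ↔ ℓ.Holds id (γ : WithTop (valueGroup v₀)) by
    choose lev hlev using H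
    exact ⟨lev, fun ℓ c => hlev c ℓ⟩
  intro c
  have hc : c ∉ A.inter := by rw [hA.2]; exact Set.notMem_empty c
  simp only [ApproxType.inter, Set.mem_ofPred_eq, not_forall] at hc
  obtain ⟨B, hB, hcB⟩ := hc
  obtain ⟨b, hb⟩ := B.nonempty
  have hbA : b ∈ A.ballAt B.label := ⟨B, hB, rfl, hb⟩
  rw [carrier_eq_ballAt hB, mem_ballAt_iff hbA] at hcB
  cases hγ : val v₀ (c - b) with
  | top => rw [hγ] at hcB; exact absurd (holds_top _ _) hcB
  | coe γ =>
    rw [hγ] at hcB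
    refine ⟨γ, fun ℓ => ?_⟩
    rcases Extension.wider_total ℓ B.label with h | h
    · rw [mem_ballAt_iff (mem_ballAt_of_wider h hbA), hγ]
    · constructor
      · intro hc
        have := mem_ballAt_of_wider h hc
        rw [mem_ballAt_iff hbA, hγ] at this
        exact absurd this hcB
      · intro hc
        exact absurd (holds_of_wider h hc) hcB

namespace IsLevelOf

variable (h : IsLevelOf A lev)
include h

/-- If `c'` has larger level than `c`, both balls of radius `lev c` contain `c'`, while `c` is only
in the closed one. A point of maximal level would lie in every ball of `A`. -/
theorem isLevel (hA : A.IsImmediate) : IsLevel (val v₀) lev where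
  val_sub c c' hc := by
    rw [AddValuation.map_sub_swap]
    have hmem : ∀ ℓ : BallLabel (valueGroup v₀), c' ∈ A.ballAt ℓ →
        (ℓ.Holds id (val v₀ (c - c')) ↔
          ℓ.Holds id ((lev c : valueGroup v₀) : WithTop (valueGroup v₀))) := by
      intro ℓ hℓ
      rw [← h ℓ c, mem_ballAt_iff hℓ]
    have h1 := hmem (.op (lev c)) ((h _ _).2 (WithTop.coe_lt_coe.2 hc))
    have h2 := hmem (.closed (lev c)) ((h _ _).2 (by
      simp only [BallLabel.Holds, WithTop.map_id, id]
      exact WithTop.coe_le_coe.2 hc.le))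
    simp only [BallLabel.Holds, id, lt_irrefl, iff_false] at h1
    simp only [BallLabel.Holds, WithTop.map_id, id, le_refl, iff_true] at h2
    exact le_antisymm (not_lt.1 h1) h2
  exists_lt c := by
    by_contra! hmax
    have : c ∈ A.inter := by
      refine mem_inter_of_forall fun ℓ => ?_
      rintro ⟨a, ha⟩
      rw [h] at ha ⊢
      exact holds_mono (WithTop.coe_le_coe.2 (hmax a)) ha
    rw [hA.2] at this
    exact this

theorem mem_closedBall_iff {γ : WithTop (valueGroup v₀)} {c : K} :
    c ∈ A.closedBall γ ↔ γ ≤ lev c := by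
  refine (h _ c).trans ?_
  simp only [BallLabel.Holds, WithTop.map_id, id]

theorem mem_supp_iff' {γ : WithTop (valueGroup v₀)} : γ ∈ A.supp ↔ ∃ c, γ ≤ lev c := by
  rw [mem_supp_iff]
  exact exists_congr fun c => h.mem_closedBall_iff

theorem fixesValue_iff (p : K[X]) : A.FixesValue p ↔ FixesVal (val v₀) lev p := by
  have hval : ∀ a b : K, v₀ a = v₀ b ↔ val v₀ a = val v₀ b := by
    intro a b
    rw [← map_val v₀ a, ← map_val v₀ b]
    exact (withTop_subtype_map_injective v₀).eq_iff
  constructor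
  · rintro ⟨δ, hδ, hc⟩
    obtain ⟨c₀, hc₀⟩ := h.mem_supp_iff'.1 hδ
    refine ⟨val v₀ (p.eval c₀), eventually_levelFilter.2 ⟨c₀, fun c hcc => ?_⟩⟩
    rw [← hval]
    exact hc c (h.mem_closedBall_iff.2 (hc₀.trans (WithTop.coe_le_coe.2 hcc))) c₀
      (h.mem_closedBall_iff.2 hc₀)
  · rintro ⟨l, hl⟩
    obtain ⟨c₀, hc₀⟩ := eventually_levelFilter.1 hl
    refine ⟨lev c₀, h.mem_supp_iff'.2 ⟨c₀, le_rfl⟩, fun c hc c' hc' => ?_⟩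
    rw [hval, hc₀ c (WithTop.coe_le_coe.1 (h.mem_closedBall_iff.1 hc)),
      hc₀ c' (WithTop.coe_le_coe.1 (h.mem_closedBall_iff.1 hc'))]

theorem appr_eq_iff (E : Extension.{u, v, w, u} v₀ (RatFunc K)) :
    E.appr RatFunc.X = A ↔
      ∀ c, E.polyVal (X - C c) = ((E.ι (lev c) : E.Γ') : WithTop E.Γ') := by
  rw [E.appr_X_eq_iff]
  constructor
  · intro h1 c
    have h2 : ∀ ℓ : BallLabel (valueGroup v₀), ℓ.Holds E.ι (E.polyVal (X - C c)) ↔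
        ℓ.Holds id ((lev c : valueGroup v₀) : WithTop (valueGroup v₀)) :=
      fun ℓ => (h1 ℓ c).trans (h ℓ c)
    apply le_antisymm
    · have := h2 (.op (lev c))
      simp only [BallLabel.Holds, id, lt_irrefl, iff_false] at this
      exact not_lt.1 this
    · have := h2 (.closed (lev c))
      simp only [BallLabel.Holds, WithTop.map_id, id, le_refl, iff_true] at this
      exact this
  · intro h1 ℓ c
    rw [h ℓ c, h1 c]
    exact holds_map E.strictMono ℓ ((lev c : valueGroup v₀) : WithTop (valueGroup v₀))

theorem supp_eq_range_iff : A.supp =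
    Set.range (fun γ : valueGroup v₀ => (γ : WithTop (valueGroup v₀))) ↔ ∀ γ, ∃ c, γ ≤ lev c := by
  constructor
  · intro h1 γ
    have : (γ : WithTop (valueGroup v₀)) ∈ A.supp := by rw [h1]; exact ⟨γ, rfl⟩
    obtain ⟨c, hc⟩ := h.mem_supp_iff'.1 this
    exact ⟨c, WithTop.coe_le_coe.1 hc⟩
  · intro h1
    ext γ
    rw [h.mem_supp_iff']
    constructor
    · rintro ⟨c, hc⟩
      obtain ⟨g, hg, -⟩ := WithTop.le_coe_iff.1 hc
      exact ⟨g, hg.symm⟩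
    · rintro ⟨g, rfl⟩
      obtain ⟨c, hc⟩ := h1 g
      exact ⟨c, WithTop.coe_le_coe.2 hc⟩

end IsLevelOf

theorem Extension.polyVal_eq_evVal (hlev : IsLevel (val v₀) lev)
    (E : Extension.{u, v, w, u} v₀ (RatFunc K))
    (hE : ∀ c, E.polyVal (X - C c) = ((E.ι (lev c) : E.Γ') : WithTop E.Γ')) {p : K[X]}
    (hp : FixesVal (val v₀) lev p)
    (hfix : ∀ i ∈ Finset.Icc 1 p.natDegree, FixesVal (val v₀) lev (hasseDeriv i p)) (hp0 : p ≠ 0) :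
    E.polyVal p = (evVal (val v₀) lev p).map E.ι ∧
      ∃ c, E.polyVal p < E.polyVal (p - C c) := by
  have := hlev.lt_val_aeval_sub hp0 hp hfix (V := E.polyVal) E.strictMono
    (fun a => E.polyVal_C a) (y := X) hE
  rwa [aeval_X_left_apply] at this

section Transcendental

/-- The eventual value, as a valuation. -/
noncomputable def evValuation
    (hfix : ∀ p, FixesVal (val v₀) lev p) : AddValuation K[X] (WithTop (valueGroup v₀)) :=
  AddValuation.of (evVal (val v₀) lev) (by rw [← C_0, evVal_C, AddValuation.map_zero])
    (by rw [← C_1, evVal_C, AddValuation.map_one])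
    (fun p q => evVal_add (hfix p) (hfix q) (hfix _))
    (fun p q => evVal_mul (hfix p) (hfix q))

/-- The eventual value is a valuation, and any extension realizing `A` must agree with it on
polynomials. Leading-order approximation by constants makes the extension immediate. -/
theorem exists_extension_of_transcendental (h : IsLevelOf A lev) (hlev : IsLevel (val v₀) lev)
    (hfix : ∀ p, FixesVal (val v₀) lev p) :
    ∃ E : Extension.{u, v, v, u} v₀ (RatFunc K), E.appr RatFunc.X = A ∧ E.IsImmediate ∧
      ∀ E' : Extension.{u, v, w, u} v₀ (RatFunc K), E'.appr RatFunc.X = A → E.EquivOver E' := by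
  obtain ⟨V, hV, hp⟩ := exists_extension (AddMonoidHom.id (valueGroup v₀)) (fun _ _ h => h)
    (evValuation hfix) (fun p hp => hlev.evVal_ne_top hp (hfix p)) (fun a => by
      refine (evVal_C a).trans ?_
      rw [show ((AddMonoidHom.id (valueGroup v₀) : valueGroup v₀ →+ valueGroup v₀) :
        valueGroup v₀ → valueGroup v₀) = id from rfl, WithTop.map_id]
      rfl)
  have hE : (Extension.mk (AddMonoidHom.id (valueGroup v₀)) (fun _ _ h => h) V hV).appr
      RatFunc.X = A := by
    rw [h.appr_eq_iff]
    intro c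
    rw [hp]
    exact evVal_eq (hlev.evVal_X_sub_C c)
  refine ⟨_, hE, Extension.isImmediate_of_approx _ fun p hp0 => ?_, fun E' hE' => ?_⟩
  · exact (Extension.polyVal_eq_evVal hlev _ ((h.appr_eq_iff _).1 hE) (hfix p)
      (fun i _ => hfix _) hp0).2
  · have key : ∀ (E : Extension.{u, v, w, u} v₀ (RatFunc K)), E.appr RatFunc.X = A → ∀ p,
        E.polyVal p = (evVal (val v₀) lev p).map E.ι := by
      intro E hE p
      by_cases hp0 : p = 0
      · rw [hp0, ← C_0, evVal_C, E.polyVal_C]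
      · exact (Extension.polyVal_eq_evVal hlev _ ((h.appr_eq_iff _).1 hE) (hfix p)
          (fun i _ => hfix _) hp0).1
    apply Extension.equivOver_of_le_iff
    intro y z
    rw [Extension.le_iff_of_polyVal, Extension.le_iff_of_polyVal, key E' hE', key E' hE',
      E'.strictMono.withTop_map.le_iff_le, hp, hp]
    rfl

end Transcendental

end Immediate

/-! ### Non-fixed polynomials of minimal degree as key polynomials -/

section Levels

variable {K : Type*} [Field K] {G : Type*} [AddCommGroup G] [LinearOrder G] [IsOrderedAddMonoid G]
  {v : AddValuation K (WithTop G)} {lev : K → G}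

/-- `f` is monic of minimal degree among the polynomials without an eventual value. -/
structure IsMinimalNonfixed (v : AddValuation K (WithTop G)) (lev : K → G) (f : K[X]) : Prop where
  monic : f.Monic
  not_fixesVal : ¬ FixesVal v lev f
  fixesVal : ∀ g : K[X], g.natDegree < f.natDegree → FixesVal v lev g

theorem exists_isMinimalNonfixed (h : ∃ p, ¬ FixesVal v lev p) :
    ∃ f, IsMinimalNonfixed v lev f := by
  classical
  have hex : ∃ n, ∃ p : K[X], p.natDegree = n ∧ ¬ FixesVal v lev p := by
    obtain ⟨p, hp⟩ := h
    exact ⟨_, p, rfl, hp⟩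
  obtain ⟨p, hpn, hp⟩ := Nat.find_spec hex
  have hmin : ∀ g : K[X], g.natDegree < p.natDegree → FixesVal v lev g := by
    intro g hg
    by_contra hg'
    exact Nat.find_min hex (by rwa [← hpn]) ⟨g, rfl, hg'⟩
  have hp0 : p ≠ 0 := by
    rintro rfl
    exact hp (by simpa using fixesVal_C (v := v) (lev := lev) 0)
  have hl : p.leadingCoeff ≠ 0 := leadingCoeff_ne_zero.2 hp0
  refine ⟨p * C p.leadingCoeff⁻¹, monic_mul_leadingCoeff_inv hp0, fun hf => hp ?_, ?_⟩
  · have := hf.mul (fixesVal_C p.leadingCoeff)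
    rwa [mul_assoc, ← C_mul, inv_mul_cancel₀ hl, C_1, mul_one] at this
  · rwa [natDegree_mul_C (inv_ne_zero hl)]

namespace IsMinimalNonfixed

variable {f : K[X]} (hf : IsMinimalNonfixed v lev f) (hlev : IsLevel v lev)
include hf

theorem natDegree_pos : 0 < f.natDegree := by
  rw [Nat.pos_iff_ne_zero]
  intro h
  apply hf.not_fixesVal
  rw [eq_C_of_natDegree_eq_zero h]
  exact fixesVal_C _

include hlev

/-- The polynomial `X - c` has eventual value `lev c`. The consequence of interest is that each `X -
c` lies below the degree of `f` and keeps this value under augmentation. -/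
theorem one_lt_natDegree : 1 < f.natDegree := by
  have h0 := hf.natDegree_pos
  by_contra h
  have h1 : f.natDegree = 1 := by omega
  apply hf.not_fixesVal
  rw [hf.monic.eq_X_add_C h1, ← sub_neg_eq_add, ← C_neg]
  exact ⟨_, hlev.evVal_X_sub_C _⟩

omit hlev in
theorem fixesVal_hasseDeriv {g : K[X]} (hg : g.natDegree ≤ f.natDegree) :
    ∀ i ∈ Finset.Icc 1 g.natDegree, FixesVal v lev (hasseDeriv i g) := by
  intro i hi
  apply hf.fixesVal
  have h1 := natDegree_hasseDeriv_le g i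
  have h2 := hf.natDegree_pos
  have h3 := (Finset.mem_Icc.1 hi).1
  omega

theorem exists_dominant : ∃ (m : ℕ) (b : G), 1 ≤ m ∧
    (∀ᶠ c in levelFilter lev, DominatesAt v lev f m b c) ∧
    ∀ᶠ c in levelFilter lev, v (f.eval c) = ((b + m • lev c : G) : WithTop G) := by
  obtain ⟨m, b, hm, hd⟩ := hlev.exists_dominatesAt hf.natDegree_pos (hf.fixesVal_hasseDeriv le_rfl)
  exact ⟨m, b, hm, hd, hlev.val_eval_eq_dominant hf.not_fixesVal hm hd⟩

/-- In `g g' = r + s f` the eventual values of `g g'`, `r` and `s` exist, but the value of `s f`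
grows strictly with the level when `s ≠ 0`. So `s f` cannot influence the value of the product, and
even at a low level its value is at least that of the product. -/
theorem evVal_mul_mod_div {m : ℕ} {b : G} (hm : 1 ≤ m)
    (hval : ∀ᶠ c in levelFilter lev, v (f.eval c) = ((b + m • lev c : G) : WithTop G))
    {g g' : K[X]} (hg : g.natDegree < f.natDegree) (hg' : g'.natDegree < f.natDegree) :
    evVal v lev (g * g' %ₘ f) = evVal v lev g + evVal v lev g' ∧
      (g * g' /ₘ f = 0 ∨ ∃ c, evVal v lev g + evVal v lev g' ≤
        evVal v lev (g * g' /ₘ f) + ((b + m • lev c : G) : WithTop G)) := by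
  have hpos := hf.natDegree_pos
  have hrd : (g * g' %ₘ f).natDegree < f.natDegree :=
    natDegree_modByMonic_lt _ hf.monic (by rintro rfl; simp at hpos)
  have hsd : (g * g' /ₘ f).natDegree < f.natDegree := by
    rw [natDegree_divByMonic _ hf.monic]
    have := natDegree_mul_le (p := g) (q := g')
    omega
  have hprod : g * g' %ₘ f + f * (g * g' /ₘ f) = g * g' := modByMonic_add_div _ f
  rw [← evVal_mul (hf.fixesVal g hg) (hf.fixesVal g' hg')]
  have hgg : FixesVal v lev (g * g') := (hf.fixesVal g hg).mul (hf.fixesVal g' hg')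
  have hr := hf.fixesVal _ hrd
  have hs := hf.fixesVal _ hsd
  generalize g * g' %ₘ f = r at *
  generalize g * g' /ₘ f = s at *
  generalize g * g' = p at *
  by_cases hs0 : s = 0
  · rw [hs0, mul_zero, add_zero] at hprod
    exact ⟨by rw [hprod], Or.inl hs0⟩
  have hs_ne := hlev.evVal_ne_top hs0 hs
  obtain ⟨e, he⟩ := WithTop.ne_top_iff_exists.1 hs_ne
  obtain ⟨c₀, hc₀⟩ := eventually_levelFilter.1
    (hval.and (hgg.eventually.and (hr.eventually.and hs.eventually)))
  have hfs : ∀ c, lev c₀ ≤ lev c → v ((f * s).eval c) = ((b + m • lev c + e : G) : WithTop G) := by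
    intro c hc
    obtain ⟨h1, -, -, h4⟩ := hc₀ c hc
    rw [eval_mul, AddValuation.map_mul, h1, h4, ← he]
    rfl
  have hdiff : ∀ c, (f * s).eval c = p.eval c - r.eval c := by
    intro c
    rw [← hprod, eval_add, add_sub_cancel_left]
  -- If the two eventual values differed, the value of `f * s` would be their minimum at all high
  -- levels, hence constant.
  have hrp : evVal v lev r = evVal v lev p := by
    by_contra hne
    obtain ⟨c₁, hc₁⟩ := hlev.exists_lt c₀
    have hmin : ∀ c, lev c₀ ≤ lev c →
        v ((f * s).eval c) = min (evVal v lev p) (evVal v lev r) := by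
      intro c hc
      obtain ⟨-, h2, h3, -⟩ := hc₀ c hc
      rw [hdiff, sub_eq_add_neg, AddValuation.map_add_of_distinct_val, AddValuation.map_neg, h2, h3]
      rw [AddValuation.map_neg, h2, h3]
      exact Ne.symm hne
    have h1 := hmin c₀ le_rfl
    rw [← hmin c₁ hc₁.le, hfs _ le_rfl, hfs _ hc₁.le] at h1
    have h2 := WithTop.coe_injective h1
    have h3 := dominant_lt hm b hc₁
    exact h3.ne (add_right_cancel h2)
  refine ⟨hrp, Or.inr ⟨c₀, ?_⟩⟩
  obtain ⟨-, h2, h3, -⟩ := hc₀ c₀ le_rfl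
  have h4 : evVal v lev p ≤ v ((f * s).eval c₀) := by
    rw [hdiff]
    exact AddValuation.map_le_sub _ h2.ge (by rw [h3, hrp])
  rw [hfs _ le_rfl] at h4
  rw [← he, ← WithTop.coe_add, add_comm e]
  exact h4

/-- The strict inequality `mul_div` comes from comparing `α` with the value of `f` at a single high
level. -/
theorem isAugmentable {m : ℕ} {b : G} (hm : 1 ≤ m)
    (hval : ∀ᶠ c in levelFilter lev, v (f.eval c) = ((b + m • lev c : G) : WithTop G))
    {H : Type*} [AddCommGroup H] [LinearOrder H] [IsOrderedAddMonoid H] {ι : G →+ H}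
    (hι : StrictMono ι) {α : H} (hα : ∀ c, ι (b + m • lev c) < α) :
    IsAugmentable f (fun p => (evVal v lev p).map ι) α where
  monic := hf.monic
  natDegree_pos := hf.natDegree_pos
  zero := by rw [← C_0, evVal_C, AddValuation.map_zero, WithTop.map_top]
  one := by rw [← C_1, evVal_C, AddValuation.map_one, withTop_map_zero]
  ne_top g hg h0 := by
    rw [Ne, withTop_map_eq_top]
    exact hlev.evVal_ne_top h0 (hf.fixesVal g hg)
  neg g hg := by rw [evVal_neg (hf.fixesVal g hg)]
  add g g' hg hg' := by
    rw [← hι.monotone.withTop_map.map_min]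
    exact hι.monotone.withTop_map (evVal_add (hf.fixesVal g hg) (hf.fixesVal g' hg')
      (hf.fixesVal _ ((natDegree_add_le _ _).trans_lt (max_lt hg hg'))))
  mul_mod g g' hg hg' := by
    rw [(hf.evVal_mul_mod_div hlev hm hval hg hg').1, withTop_map_add]
  mul_div g g' hg hg' h0 h0' := by
    have h1 : (evVal v lev g).map ι + (evVal v lev g').map ι ≠ ⊤ := by
      rw [WithTop.add_ne_top, Ne, withTop_map_eq_top, Ne, withTop_map_eq_top]
      exact ⟨hlev.evVal_ne_top h0 (hf.fixesVal g hg), hlev.evVal_ne_top h0' (hf.fixesVal g' hg')⟩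
    rcases (hf.evVal_mul_mod_div hlev hm hval hg hg').2 with hs | ⟨c, hc⟩
    · rw [hs, ← C_0, evVal_C, AddValuation.map_zero, WithTop.map_top, top_add,
        lt_top_iff_ne_top]
      exact h1
    · have h2 := hι.monotone.withTop_map hc
      rw [withTop_map_add, withTop_map_add, WithTop.map_coe] at h2
      by_cases htop : (evVal v lev (g * g' /ₘ f)).map ι = ⊤
      · rw [htop, top_add, lt_top_iff_ne_top]
        exact h1
      · exact h2.trans_lt ((WithTop.add_lt_add_iff_left htop).2 (WithTop.coe_lt_coe.2 (hα c)))

end IsMinimalNonfixed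

end Levels

/-! ### Existence and uniqueness for algebraic immediate types -/

section Algebraic

variable {K : Type u} [Field K] {Γ : Type v} [AddCommGroup Γ] [LinearOrder Γ]
  [IsOrderedAddMonoid Γ] {v₀ : AddValuation K (WithTop Γ)} {A : ApproxType v₀}
  {lev : K → valueGroup v₀} {f : K[X]}

theorem IsMinimalNonfixed.polyVal_eq_evVal (hf : IsMinimalNonfixed (val v₀) lev f)
    (hlev : IsLevel (val v₀) lev) (E : Extension.{u, v, w, u} v₀ (RatFunc K))
    (hE : ∀ c, E.polyVal (X - C c) = ((E.ι (lev c) : E.Γ') : WithTop E.Γ')) {p : K[X]}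
    (hp : p.natDegree < f.natDegree) (hp0 : p ≠ 0) :
    E.polyVal p = (evVal (val v₀) lev p).map E.ι ∧ ∃ c, E.polyVal p < E.polyVal (p - C c) :=
  E.polyVal_eq_evVal hlev hE (hf.fixesVal p hp) (hf.fixesVal_hasseDeriv hp.le) hp0

/-- The extensions with approximation type `A` that assign to `f` a sufficiently large value. -/
theorem IsMinimalNonfixed.exists_extension (hf : IsMinimalNonfixed (val v₀) lev f)
    (h : IsLevelOf A lev) (hlev : IsLevel (val v₀) lev) {m : ℕ} {b : valueGroup v₀} (hm : 1 ≤ m)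
    (hval : ∀ᶠ c in levelFilter lev,
      val v₀ (f.eval c) = ((b + m • lev c : valueGroup v₀) : WithTop (valueGroup v₀)))
    {H : Type w} [AddCommGroup H] [LinearOrder H] [IsOrderedAddMonoid H] {ι : valueGroup v₀ →+ H}
    (hι : StrictMono ι) {α : H} (hα : ∀ c, ι (b + m • lev c) < α) :
    ∃ (v : AddValuation (RatFunc K) (WithTop H)) (hv : Extends v₀ ι v),
      (Extension.mk ι hι v hv).appr RatFunc.X = A ∧
      (Extension.mk ι hι v hv).polyVal f = α ∧
      (∀ g q : K[X], g.natDegree < f.natDegree → (Extension.mk ι hι v hv).polyVal (g + q * f) ≤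
        (Extension.mk ι hι v hv).polyVal g) ∧
      ∀ g : K[X], g.natDegree < f.natDegree → g ≠ 0 →
        ∃ c : K, (Extension.mk ι hι v hv).polyVal g <
          (Extension.mk ι hι v hv).polyVal (g - C c) := by
  obtain ⟨v, hv, h1, h2, h3⟩ := exists_extension_of_isAugmentable ι hι
    (hf.isAugmentable hlev hm hval hι hα) (fun a => by rw [evVal_C])
  have hE : (Extension.mk ι hι v hv).appr RatFunc.X = A := by
    rw [h.appr_eq_iff]
    intro c
    rw [h3 _ (by rw [natDegree_X_sub_C]; exact hf.one_lt_natDegree hlev),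
      evVal_eq (hlev.evVal_X_sub_C c)]
    rfl
  exact ⟨v, hv, hE, h1, h2, fun g hg hg0 =>
    (hf.polyVal_eq_evVal hlev _ ((h.appr_eq_iff _).1 hE) hg hg0).2⟩

theorem IsMinimalNonfixed.exists_isValueTranscendental (hf : IsMinimalNonfixed (val v₀) lev f)
    (h : IsLevelOf A lev) (hlev : IsLevel (val v₀) lev) :
    ∃ E : Extension.{u, v, v, u} v₀ (RatFunc K), E.appr RatFunc.X = A ∧
      E.IsValueTranscendental := by
  obtain ⟨m, b, hm, -, hval⟩ := hf.exists_dominant hlev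
  obtain ⟨H, _, _, _, ι, α, hι, hα, hcut⟩ :=
    -- Placing `α` above the whole value group puts it above all dominant terms, whether or not the
    -- levels are bounded.
    exists_nontorsion_of_cut (Set.univ : Set (valueGroup v₀)) isLowerSet_univ
  obtain ⟨v, hv, hE, h1, -, h3⟩ := hf.exists_extension h hlev hm hval hι
    (fun c => (hcut _).1 (Set.mem_univ _))
  exact ⟨_, hE, Extension.isValueTranscendental_of_approx _ hf.monic hf.natDegree_pos h1 hα h3⟩

theorem IsMinimalNonfixed.exists_isResidueTranscendental (hf : IsMinimalNonfixed (val v₀) lev f)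
    (h : IsLevelOf A lev) (hlev : IsLevel (val v₀) lev) {ε : valueGroup v₀}
    (hε : ∀ c, lev c < ε) :
    ∃ E : Extension.{u, v, v, u} v₀ (RatFunc K), E.appr RatFunc.X = A ∧
      E.IsResidueTranscendental := by
  obtain ⟨m, b, hm, -, hval⟩ := hf.exists_dominant hlev
  obtain ⟨v, hv, hE, h1, h2, h3⟩ := hf.exists_extension h hlev hm hval
    -- A bound `ε` of the levels provides a value for `f` inside `v₀K`, as the
    -- residue-transcendental criterion requires.
    (ι := AddMonoidHom.id (valueGroup v₀)) (fun _ _ h => h) (α := b + m • ε)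
    (fun c => dominant_lt hm b (hε c))
  obtain ⟨a, ha⟩ := exists_val_eq v₀ (b + m • ε)
  refine ⟨_, hE, Extension.isResidueTranscendental_of_le _ hf.monic hf.natDegree_pos (a := a)
    ?_ ?_ h2 h3⟩
  · rintro rfl
    rw [AddValuation.map_zero] at ha
    exact WithTop.coe_ne_top ha.symm
  · rw [h1, Extension.polyVal_C, ha]
    rfl

/-- If the levels are cofinal, then `f` has a value larger than the value group. -/
theorem IsMinimalNonfixed.lt_polyVal (hf : IsMinimalNonfixed (val v₀) lev f)
    (hlev : IsLevel (val v₀) lev) (hcof : ∀ γ, ∃ c, γ ≤ lev c)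
    (E : Extension.{u, v, w, u} v₀ (RatFunc K))
    (hE : ∀ c, E.polyVal (X - C c) = ((E.ι (lev c) : E.Γ') : WithTop E.Γ')) :
    ∃ α : E.Γ', E.polyVal f = α ∧ ∀ γ, E.ι γ < α := by
  obtain ⟨m, b, hm, hd, hval⟩ := hf.exists_dominant hlev
  have hlt : ∀ γ, ((E.ι γ : E.Γ') : WithTop E.Γ') < E.polyVal f := by
    intro γ
    -- Levels above `0` satisfy `lev c ≤ m • lev c`, so a level above `γ - b` already gives `γ < b +
    -- m • lev c`.
    obtain ⟨c₁, hc₁⟩ := hcof (max 0 (γ - b))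
    have := levelFilter_neBot (lev := lev)
    obtain ⟨c, h1, h2, h3⟩ := ((hlev.eventually_lt c₁).and (hd.and hval)).exists
    have h4 := h2.val_aeval_sub (V := E.polyVal) E.strictMono (fun a => E.polyVal_C a) (hE c)
    rw [aeval_X_left_apply] at h4
    have h5 : E.polyVal (algebraMap K K[X] (f.eval c)) =
        ((E.ι (b + m • lev c) : E.Γ') : WithTop E.Γ') := by
      refine (E.polyVal_C _).trans ?_
      rw [h3]
      rfl
    -- Both `f - f c` and `f c` have the value of the dominant term.
    have h6 : ((E.ι (b + m • lev c) : E.Γ') : WithTop E.Γ') ≤ E.polyVal f := by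
      have := AddValuation.map_le_add E.polyVal h4.ge h5.ge
      rwa [sub_add_cancel] at this
    refine lt_of_lt_of_le (WithTop.coe_lt_coe.2 (E.strictMono ?_)) h6
    have h7 : 0 ≤ lev c := ((le_max_left _ _).trans hc₁).trans h1.le
    have h8 : γ - b < lev c := ((le_max_right _ _).trans hc₁).trans_lt h1
    have h9 : lev c ≤ m • lev c := by
      simpa using nsmul_le_nsmul_left h7 hm
    rw [← sub_lt_iff_lt_add']
    exact h8.trans_le h9
  cases hx : E.polyVal f with
  | top => exact absurd (E.polyVal_eq_top.1 hx) hf.monic.ne_zero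
  | coe α =>
    refine ⟨α, rfl, fun γ => ?_⟩
    have := hlt γ
    rw [hx] at this
    exact WithTop.coe_lt_coe.1 this

theorem add_nsmul_lt_of_lt {G H : Type*} [AddCommGroup G] [LinearOrder G] [IsOrderedAddMonoid G]
    [AddCommGroup H] [LinearOrder H] [IsOrderedAddMonoid H] {ι : G →+ H} {α : H}
    (hα : ∀ γ, ι γ < α) {γ δ : G} {n m : ℕ} (hnm : n < m) : ι γ + n • α < ι δ + m • α := by
  obtain ⟨k, rfl⟩ : ∃ k, m = n + (k + 1) := ⟨m - n - 1, by omega⟩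
  have h0 : 0 ≤ α := by
    have := hα 0
    rw [map_zero] at this
    exact this.le
  have h1 := hα (γ - δ)
  rw [map_sub] at h1
  have h2 : 0 ≤ k • α := nsmul_nonneg h0 k
  rw [add_nsmul, add_nsmul, one_nsmul]
  generalize k • α = x at *
  generalize n • α = y at *
  generalize ι γ = z at *
  generalize ι δ = z' at *
  grind

theorem add_nsmul_le_iff {G H : Type*} [AddCommGroup G] [LinearOrder G] [IsOrderedAddMonoid G]
    [AddCommGroup H] [LinearOrder H] [IsOrderedAddMonoid H] {ι : G →+ H} (hι : StrictMono ι) {α : H}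
    (hα : ∀ γ, ι γ < α) {γ δ : G} {n m : ℕ} :
    ι γ + n • α ≤ ι δ + m • α ↔ n < m ∨ n = m ∧ γ ≤ δ := by
  rcases lt_trichotomy n m with h | rfl | h
  · simp [h, (add_nsmul_lt_of_lt hα h).le]
  · simp [hι.le_iff_le]
  · simp [not_lt.2 h.le, h.ne', add_nsmul_lt_of_lt hα h]

/-- Since `f` has a value above `v₀K`, the lowest nonzero term of the `f`-adic expansion decides.
Its exponent is `n` and the eventual value of its coefficient is `γ`; neither depends on the
extension. -/
theorem IsMinimalNonfixed.polyVal_eq_polyVal (hf : IsMinimalNonfixed (val v₀) lev f)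
    (hlev : IsLevel (val v₀) lev) (E : Extension.{u, v, w, u} v₀ (RatFunc K))
    (hE : ∀ c, E.polyVal (X - C c) = ((E.ι (lev c) : E.Γ') : WithTop E.Γ'))
    {α : E.Γ'} (hα : E.polyVal f = α) (hα' : ∀ γ, E.ι γ < α)
    (E' : Extension.{u, v, w', u} v₀ (RatFunc K))
    (hE' : ∀ c, E'.polyVal (X - C c) = ((E'.ι (lev c) : E'.Γ') : WithTop E'.Γ'))
    {β : E'.Γ'} (hβ : E'.polyVal f = β) (hβ' : ∀ γ, E'.ι γ < β) (p : K[X]) :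
    p ≠ 0 → ∃ (γ : valueGroup v₀) (n : ℕ),
      E.polyVal p = ((E.ι γ + n • α : E.Γ') : WithTop E.Γ') ∧
      E'.polyVal p = ((E'.ι γ + n • β : E'.Γ') : WithTop E'.Γ') := by
  have hbase : ∀ g : K[X], g.natDegree < f.natDegree → g ≠ 0 → ∃ γ : valueGroup v₀,
      E.polyVal g = ((E.ι γ : E.Γ') : WithTop E.Γ') ∧
      E'.polyVal g = ((E'.ι γ : E'.Γ') : WithTop E'.Γ') := by
    intro g hg h0
    obtain ⟨γ, hγ⟩ := WithTop.ne_top_iff_exists.1 (hlev.evVal_ne_top h0 (hf.fixesVal g hg))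
    refine ⟨γ, ?_, ?_⟩
    · rw [(hf.polyVal_eq_evVal hlev E hE hg h0).1, ← hγ]; rfl
    · rw [(hf.polyVal_eq_evVal hlev E' hE' hg h0).1, ← hγ]; rfl
  refine expansion_induction hf.monic hf.natDegree_pos (P := fun p => p ≠ 0 →
    ∃ (γ : valueGroup v₀) (n : ℕ), E.polyVal p = ((E.ι γ + n • α : E.Γ') : WithTop E.Γ') ∧
      E'.polyVal p = ((E'.ι γ + n • β : E'.Γ') : WithTop E'.Γ'))
      (fun g hg h0 => ?_) (fun g q hg h0 ih _ => ?_) p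
  · obtain ⟨γ, h1, h2⟩ := hbase g hg h0
    exact ⟨γ, 0, by simpa using h1, by simpa using h2⟩
  · obtain ⟨γ, n, h1, h2⟩ := ih h0
    have h3 : E.polyVal (q * f) = ((E.ι γ + (n + 1) • α : E.Γ') : WithTop E.Γ') := by
      rw [AddValuation.map_mul, h1, hα, add_nsmul, one_nsmul, ← add_assoc]
      rfl
    have h4 : E'.polyVal (q * f) = ((E'.ι γ + (n + 1) • β : E'.Γ') : WithTop E'.Γ') := by
      rw [AddValuation.map_mul, h2, hβ, add_nsmul, one_nsmul, ← add_assoc]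
      rfl
    by_cases hg0 : g = 0
    · exact ⟨γ, n + 1, by rw [hg0, zero_add, h3], by rw [hg0, zero_add, h4]⟩
    obtain ⟨δ, h5, h6⟩ := hbase g hg hg0
    refine ⟨δ, 0, ?_, ?_⟩
    · rw [zero_nsmul, add_zero, AddValuation.map_add_eq_of_lt_left _ ?_, h5]
      rw [h5, h3, WithTop.coe_lt_coe]
      simpa using add_nsmul_lt_of_lt hα' (γ := δ) (δ := γ) n.succ_pos
    · rw [zero_nsmul, add_zero, AddValuation.map_add_eq_of_lt_left _ ?_, h6]
      rw [h6, h4, WithTop.coe_lt_coe]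
      simpa using add_nsmul_lt_of_lt hβ' (γ := δ) (δ := γ) n.succ_pos

/-- In both extensions the values `γ + n α` are ordered lexicographically with `n` first, so all
comparisons agree. -/
theorem IsMinimalNonfixed.equivOver (hf : IsMinimalNonfixed (val v₀) lev f) (h : IsLevelOf A lev)
    (hlev : IsLevel (val v₀) lev) (hcof : ∀ γ, ∃ c, γ ≤ lev c)
    (E : Extension.{u, v, w, u} v₀ (RatFunc K)) (hE : E.appr RatFunc.X = A)
    (E' : Extension.{u, v, w', u} v₀ (RatFunc K)) (hE' : E'.appr RatFunc.X = A) :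
    E.EquivOver E' := by
  rw [h.appr_eq_iff] at hE hE'
  obtain ⟨α, hα, hα'⟩ := hf.lt_polyVal hlev hcof E hE
  obtain ⟨β, hβ, hβ'⟩ := hf.lt_polyVal hlev hcof E' hE'
  have key := hf.polyVal_eq_polyVal hlev E hE hα hα' E' hE' hβ hβ'
  apply Extension.equivOver_of_le_iff
  intro y z
  rw [Extension.le_iff_of_polyVal, Extension.le_iff_of_polyVal]
  generalize z.num * y.denom = q
  generalize y.num * z.denom = p
  by_cases hq : q = 0
  · simp [hq]
  by_cases hp : p = 0
  · rw [hp, AddValuation.map_zero, AddValuation.map_zero, top_le_iff, top_le_iff,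
      E.polyVal_eq_top, E'.polyVal_eq_top]
  obtain ⟨γ, n, h1, h2⟩ := key p hp
  obtain ⟨δ, m, h3, h4⟩ := key q hq
  rw [h1, h2, h3, h4, WithTop.coe_le_coe, WithTop.coe_le_coe, add_nsmul_le_iff E.strictMono hα',
    add_nsmul_le_iff E'.strictMono hβ']

end Algebraic

/-! ### Realizing every non-trivial type, and the final assembly -/

section Surjectivity

variable {K : Type u} [Field K] {Γ : Type v} [AddCommGroup Γ] [LinearOrder Γ]
  [IsOrderedAddMonoid Γ] {v₀ : AddValuation K (WithTop Γ)} {A : ApproxType v₀}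

theorem ApproxType.exists_nontorsion_cut_supp (A : ApproxType v₀) :
    ∃ (Γ' : Type v) (_ : AddCommGroup Γ') (_ : LinearOrder Γ') (_ : IsOrderedAddMonoid Γ')
      (ι : valueGroup v₀ →+ Γ') (α : Γ'), StrictMono ι ∧
      (∀ n : ℕ, 0 < n → n • α ∉ ι.range) ∧
      (∀ γ : valueGroup v₀, (↑γ ∈ A.supp → ι γ < α) ∧ (↑γ ∉ A.supp → α < ι γ)) :=
  exists_nontorsion_of_cut {γ : valueGroup v₀ | (γ : WithTop (valueGroup v₀)) ∈ A.supp}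
    fun _ _ hle h => ApproxType.supp_down (WithTop.coe_le_coe.2 hle) h

theorem ApproxType.IsTranscendentalImmediate.exists_extension (h : A.IsTranscendentalImmediate) :
    ∃ E : Extension.{u, v, v, u} v₀ (RatFunc K), E.appr RatFunc.X = A ∧ E.IsImmediate ∧
      ∀ E' : Extension.{u, v, w, u} v₀ (RatFunc K), E'.appr RatFunc.X = A → E.EquivOver E' := by
  obtain ⟨lev, hlev⟩ := exists_isLevelOf h.1
  exact exists_extension_of_transcendental hlev (hlev.isLevel h.1)
    fun p => (hlev.fixesValue_iff p).1 (h.2 p)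

theorem ApproxType.IsAlgebraicImmediate.exists_isMinimalNonfixed (h : A.IsAlgebraicImmediate) :
    ∃ lev f, IsLevelOf A lev ∧ IsLevel (val v₀) lev ∧ IsMinimalNonfixed (val v₀) lev f := by
  obtain ⟨lev, hlev⟩ := exists_isLevelOf h.1
  obtain ⟨p, hp⟩ := h.2
  obtain ⟨f, hf⟩ := ApproxTypes.exists_isMinimalNonfixed (v := val v₀) (lev := lev)
    ⟨p, fun h' => hp ((hlev.fixesValue_iff p).2 h')⟩
  exact ⟨lev, f, hlev, hlev.isLevel h.1, hf⟩

theorem ApproxType.isImmediate_of_inter_eq_empty (h : A.inter = ∅) : A.IsImmediate := by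
  refine ⟨Set.nonempty_iff_ne_empty.2 fun h0 => ?_, h⟩
  have : (0 : K) ∈ A.inter := by
    intro B hB
    rw [h0] at hB
    exact hB.elim
  rw [h] at this
  exact this

/-- A residue-extending approximation type has an empty open ball at some radius of its support. -/
theorem ApproxType.IsResidueExtending.exists_openBall_eq_empty (h : A.IsResidueExtending) :
    ∃ δ : valueGroup v₀, (δ : WithTop (valueGroup v₀)) ∈ A.supp ∧ A.openBall δ = ∅ := by
  obtain ⟨hA, b, hb⟩ := h
  obtain ⟨δ, hδ, -, hbδ⟩ := hA b
  exact ⟨δ, hδ, Set.not_nonempty_iff_eq_empty.1 fun hne =>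
    hbδ (ApproxType.mem_ballAt_of_mem_inter hb hne)⟩

theorem exists_appr_eq (hA : ¬ A.IsTrivial) :
    ∃ E : Extension.{u, v, v, u} v₀ (RatFunc K), E.appr RatFunc.X = A := by
  rcases Set.eq_empty_or_nonempty A.inter with hempty | ⟨b, hb⟩
  · have himm := ApproxType.isImmediate_of_inter_eq_empty hempty
    by_cases hfix : ∀ f, A.FixesValue f
    · obtain ⟨E, hE, -⟩ :=
        ApproxType.IsTranscendentalImmediate.exists_extension.{u, v, v} ⟨himm, hfix⟩
      exact ⟨E, hE⟩
    · obtain ⟨lev, f, h, hlev, hf⟩ :=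
        ApproxType.IsAlgebraicImmediate.exists_isMinimalNonfixed ⟨himm, not_forall.1 hfix⟩
      obtain ⟨E, hE, -⟩ := hf.exists_isValueTranscendental h hlev
      exact ⟨E, hE⟩
  by_cases hres : A.IsResidueImmediate
  · obtain ⟨H, _, _, _, ι, α, hι, -, hα⟩ := A.exists_nontorsion_cut_supp
    obtain ⟨v, hv, -⟩ := existsUnique_isGaussExtension ι hι b α
    exact ⟨_, appr_eq_of_isValueExtending hA ⟨hres, b, hb⟩ hb ι hι hα hv⟩
  -- A single missing open ball at a radius of the support is enough for the assignment of `δ` to `x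
  -- - b` to work.
  · unfold ApproxType.IsResidueImmediate at hres
    push Not at hres
    obtain ⟨δ, hδ, hδ'⟩ := hres
    have hι : StrictMono (AddMonoidHom.id (valueGroup v₀)) := fun _ _ h => h
    obtain ⟨v, hv, -⟩ := existsUnique_isGaussExtension _ hι b δ
    exact ⟨_, appr_eq_of_openBall_eq_empty hb hδ hδ' _ hι hv⟩

end Surjectivity

end ApproxTypes

theorem theorem4p1 {K : Type u} [Field K] {Γ : Type v} [AddCommGroup Γ] [LinearOrder Γ]
    [IsOrderedAddMonoid Γ] (v₀ : AddValuation K (WithTop Γ)) :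
    -- `v ↦ appr_v(x,K)` is a function from (equivalence classes of) extensions of `v₀` to `K(x)`
    -- to non-trivial approximation types
    (∀ E : Extension.{u, v, w, u} v₀ (RatFunc K), ¬ (E.appr RatFunc.X).IsTrivial) ∧
    (∀ (E : Extension.{u, v, w, u} v₀ (RatFunc K)) (E' : Extension.{u, v, w', u} v₀ (RatFunc K)),
      E.EquivOver E' → E.appr RatFunc.X = E'.appr RatFunc.X) ∧
    ∀ A : ApproxType v₀, ¬ A.IsTrivial →
      -- surjectivity
      (∃ E : Extension.{u, v, v, u} v₀ (RatFunc K), E.appr RatFunc.X = A) ∧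
      -- transcendental immediate approximation types
      (A.IsTranscendentalImmediate →
        ∃ E : Extension.{u, v, v, u} v₀ (RatFunc K), E.appr RatFunc.X = A ∧ E.IsImmediate ∧
          ∀ E' : Extension.{u, v, w, u} v₀ (RatFunc K), E'.appr RatFunc.X = A → E.EquivOver E') ∧
      -- algebraic immediate approximation types
      (A.IsAlgebraicImmediate →
        (A.supp ≠ Set.range (fun γ : valueGroup v₀ => (γ : WithTop (valueGroup v₀))) →
          (∃ E : Extension.{u, v, v, u} v₀ (RatFunc K),
            E.appr RatFunc.X = A ∧ E.IsValueTranscendental) ∧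
          (∃ E : Extension.{u, v, v, u} v₀ (RatFunc K),
            E.appr RatFunc.X = A ∧ E.IsResidueTranscendental)) ∧
        (A.supp = Set.range (fun γ : valueGroup v₀ => (γ : WithTop (valueGroup v₀))) →
          ∃ E : Extension.{u, v, v, u} v₀ (RatFunc K),
            E.appr RatFunc.X = A ∧ E.IsValueTranscendental ∧
            ∀ E' : Extension.{u, v, w, u} v₀ (RatFunc K),
              E'.appr RatFunc.X = A → E.EquivOver E')) ∧
      -- value-extending approximation types
      (A.IsValueExtending →
        (∃ (Γ' : Type v) (_ : AddCommGroup Γ') (_ : LinearOrder Γ') (_ : IsOrderedAddMonoid Γ')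
          (ι : valueGroup v₀ →+ Γ') (α : Γ'), StrictMono ι ∧
          (∀ n : ℕ, 0 < n → n • α ∉ ι.range) ∧
          (∀ γ : valueGroup v₀, (↑γ ∈ A.supp → ι γ < α) ∧ (↑γ ∉ A.supp → α < ι γ))) ∧
        ∀ b ∈ A.inter, ∀ (Γ' : Type w) [AddCommGroup Γ'] [LinearOrder Γ'] [IsOrderedAddMonoid Γ']
          (ι : valueGroup v₀ →+ Γ') (hι : StrictMono ι) (α : Γ'),
          (∀ n : ℕ, 0 < n → n • α ∉ ι.range) →
          (∀ γ : valueGroup v₀, (↑γ ∈ A.supp → ι γ < α) ∧ (↑γ ∉ A.supp → α < ι γ)) →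
          (∃! v : AddValuation (RatFunc K) (WithTop Γ'), IsGaussExtension v₀ ι b α v) ∧
          ∀ (v : AddValuation (RatFunc K) (WithTop Γ')) (hv : IsGaussExtension v₀ ι b α v),
            (Extension.mk ι hι v hv.1).appr RatFunc.X = A ∧
            (Extension.mk ι hι v hv.1).IsValueTranscendental) ∧
      -- residue-extending approximation types
      (A.IsResidueExtending →
        ∃ δ : valueGroup v₀, IsGreatest A.supp (δ : WithTop (valueGroup v₀)) ∧
          A.inter = A.closedBall δ ∧
          ∀ b ∈ A.inter, ∀ (Γ' : Type w) [AddCommGroup Γ'] [LinearOrder Γ'] [IsOrderedAddMonoid Γ']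
            (ι : valueGroup v₀ →+ Γ') (hι : StrictMono ι),
            (∃! v : AddValuation (RatFunc K) (WithTop Γ'), IsGaussExtension v₀ ι b (ι δ) v) ∧
            ∀ (v : AddValuation (RatFunc K) (WithTop Γ')) (hv : IsGaussExtension v₀ ι b (ι δ) v),
              (Extension.mk ι hι v hv.1).appr RatFunc.X = A ∧
              (Extension.mk ι hι v hv.1).IsResidueTranscendental) := by
  refine ⟨fun E => E.appr_X_not_isTrivial, fun E E' h => Extension.appr_eq_of_equivOver h _,
    fun A hA => ⟨exists_appr_eq hA, fun h => h.exists_extension, fun h => ?_, fun h => ?_,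
      fun h => ?_⟩⟩
  · obtain ⟨lev, f, hl, hlev, hf⟩ := h.exists_isMinimalNonfixed
    -- The dichotomy on the support becomes: the levels are cofinal in `v₀K`, or strictly bounded by
    -- some `ε`.
    rw [ne_eq, hl.supp_eq_range_iff]
    refine ⟨fun hcof => ⟨hf.exists_isValueTranscendental hl hlev, ?_⟩, fun hcof => ?_⟩
    · push Not at hcof
      obtain ⟨ε, hε⟩ := hcof
      exact hf.exists_isResidueTranscendental hl hlev hε
    · obtain ⟨E, hE, hE'⟩ := hf.exists_isValueTranscendental hl hlev
      exact ⟨E, hE, hE', fun E' h' => hf.equivOver hl hlev hcof E hE E' h'⟩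
  · refine ⟨A.exists_nontorsion_cut_supp, fun b hb Γ' _ _ _ ι hι α hα hcut =>
      ⟨existsUnique_isGaussExtension ι hι b α, fun v hv =>
        ⟨appr_eq_of_isValueExtending hA h hb ι hι hcut hv,
          isValueTranscendental_of_isGaussExtension ι hι hα hv⟩⟩⟩
  · obtain ⟨δ, hδ, hδ'⟩ := h.exists_openBall_eq_empty
    exact ⟨δ, ApproxType.isGreatest_of_openBall_eq_empty hδ hδ',
      ApproxType.inter_eq_closedBall hδ hδ', fun b hb Γ' _ _ _ ι hι =>
        ⟨existsUnique_isGaussExtension ι hι b (ι δ), fun v hv =>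
          ⟨appr_eq_of_openBall_eq_empty hb hδ hδ' ι hι hv,
            isResidueTranscendental_of_isGaussExtension ι hι hv⟩⟩⟩
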